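/- Let $0\le k\le n$ be integers and $[n]=\{1,\dots,n\}$. For a permutation $w\in S_n$ let $\ell(w)$ be its number of inversions, and let $\le$, $\lessdot$ denote Bruhat order on $S_n$ and its cover relation. Define three posets. (1) $\mathcal Q(k,n)$. The $k$-Bruhat order $\le_k$ on $S_n$ is the reflexive-transitive closure of the relations $u\lessdot w$ with $u([k])\ne w([k])$. A $k$-Bruhat interval $[u,w]_k$ is given by a pair $u\le_k w$. Let $\sim$ be the equivalence relation on $k$-Bruhat intervals generated by $[u,w]_k\sim[uz,wz]_k$ whenever both are $k$-Bruhat intervals, $z\in S_k\times S_{n-k}$, $\ell(uz)=\ell(u)+\ell(z)$ and $\ell(wz)=\ell(w)+\ell(z)$. $\mathcal Q(k,n)$ is the set of equivalence classes, with $q'\le q$ if and only if there are representatives $[u',w']_k\in q'$ and $[u,w]_k\in q$ such that the Bruhat intervals satisfy $[u',w']\subseteq[u,w]$. (2) $\mathrm{Bound}(k,n)$ is the set of bijections $f:\mathbb Z\to\mathbb Z$ with $f(i+n)=f(i)+n$ and $i\le f(i)\le i+n$ for all $i$, and $\frac1n\sum_{i=1}^n(f(i)-i)=k$ (the left-hand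 side being read as $0$ if $n=0$), ordered by the restriction of the affine Bruhat order, i.e. of the reflexive-transitive closure on affine permutations of the relations $f<ft$ where $t$ is an affine transposition (exchanging $i+rn$ and $j+rn$ for all $r\in\mathbb Z$, for some $i\not\equiv j \bmod n$, and fixing all other integers) and $\ell(f)<\ell(ft)$; here $\ell(f)$ is the number of inversions $(i,j)$, $i<j$, $f(i)>f(j)$, up to simultaneous translation by multiples of $n$. (3) $\mathrm{Jugg}(k,n)$ is the set of sequences $(J_1,\dots,J_n)$ of $k$-element subsets of $[n]$ such that for each $i$ (indices modulo $n$) the set $J_{i+1}\cup\{m\in\mathbb Z: m\le 0\}$ is obtained from $\{x-1: x\in J_i\cup\{m\in\mathbb Z: m\le0\}\}$ by adding exactly one new element, ordered by $(J_i)\le(J'_i)$ if and only if for each $i$ and each $r\le k$ the $r$-th smallest element of $J_i$ is at most the $r$-th smallest element of $J'_i$. Then these relations are partial orders, and the posets $\mathcal Q(k,n)$, $\mathrm{Bound}(k,n)$ and $\mathrm{Jugg}(k,n)$, and their duals, are Eulerian and EL-shellable. Here a poset $P$ is Eulerian if it is graded (it has a strictly increasing rank function $P\to\mathbb Z$ that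 goes up by exactly one along each cover) and its Möbius function satisfies $\mu(x,y)=(-1)^{\operatorname{rank}(x)-\operatorname{rank}(y)}$ for all $x\le y$ such that $[x,y]$ is finite. It is EL-shellable if the edges of its Hasse diagram can be labeled by elements of a totally ordered set so that for all $x\le y$ there is a unique saturated chain from $x$ to $y$ with strictly increasing labels, and its label sequence is lexicographically minimal among the label sequences of all saturated chains from $x$ to $y$. -/

import Mathlib

namespace Positroid

universe u

section PosetNotions

/-- A poset is Eulerian if it is graded (it has a rank function, strictly monotone and going up by
one along each cover) and, for all `x ≤ y` whose interval `[x, y]` is finite, the Möbius function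
satisfies `μ(x, y) = (-1) ^ (rank x - rank y)`.  (A `LocallyFiniteOrder` structure on the interval
`[x, y]` exists if and only if that interval is finite, and it is then unique.) -/
def IsEulerian (P : Type u) [PartialOrder P] : Prop :=
  ∃ G : GradeOrder ℤ P, ∀ (x y : P) (hxy : x ≤ y) [DecidableEq (Set.Icc x y)]
    [LocallyFiniteOrder (Set.Icc x y)],
    IncidenceAlgebra.mu ℤ (⟨x, Set.left_mem_Icc.2 hxy⟩ : Set.Icc x y)
        (⟨y, Set.right_mem_Icc.2 hxy⟩ : Set.Icc x y) =
      (((-1 : ℤˣ) ^ (G.grade x - G.grade y) : ℤˣ) : ℤ)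

/-- `c` is a saturated chain `x = c₀ ⋖ c₁ ⋖ ⋯ ⋖ cₘ = y`. -/
def IsSaturatedChain {P : Type u} [PartialOrder P] (x y : P) (c : List P) : Prop :=
  c.head? = some x ∧ c.getLast? = some y ∧ c.IsChain (· ⋖ ·)

/-- The sequence of labels `lab c₀ c₁, lab c₁ c₂, …` read along a list `c₀, c₁, …`. -/
def labelSeq {P : Type u} {L : Type u} (lab : P → P → L) (c : List P) : List L :=
  List.zipWith lab c c.tail

/-- A labeling `lab` of the edges of the Hasse diagram (only the values `lab a b` with `a ⋖ b`
matter) is an EL-labeling if for all `x ≤ y` there is a unique saturated chain from `x` to `y` whose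
labels strictly increase, and its label sequence is lexicographically minimal among the label
sequences of all saturated chains from `x` to `y`. -/
def IsELLabeling {P : Type u} [PartialOrder P] {L : Type u} [LinearOrder L]
    (lab : P → P → L) : Prop :=
  ∀ x y : P, x ≤ y → ∃ c : List P, IsSaturatedChain x y c ∧
    (labelSeq lab c).Pairwise (· < ·) ∧
    (∀ c' : List P, IsSaturatedChain x y c' → (labelSeq lab c').Pairwise (· < ·) → c' = c) ∧
    ∀ c' : List P, IsSaturatedChain x y c' →
      labelSeq lab c = labelSeq lab c' ∨
        List.Lex (· < ·) (labelSeq lab c) (labelSeq lab c')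

/-- A poset is EL-shellable if it has an EL-labeling with labels in some totally ordered set. -/
def IsELShellable (P : Type u) [PartialOrder P] : Prop :=
  ∃ (L : Type u) (_ : LinearOrder L) (lab : P → P → L), IsELLabeling lab

/-- The poset structure given by a relation that is a partial order. -/
abbrev posetOf {P : Type u} (r : P → P → Prop) (h : IsPartialOrder P r) : PartialOrder P where
  le := r
  le_refl := h.refl
  le_trans := h.trans
  le_antisymm := h.antisymm

end PosetNotions

section SymmetricGroup

/-- The length of a permutation: its number of inversions. -/
def permLength {n : ℕ} (w : Equiv.Perm (Fin n)) : ℕ :=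
  (Finset.univ.filter fun p : Fin n × Fin n => p.1 < p.2 ∧ w p.2 < w p.1).card

/-- Bruhat order on the symmetric group: generated by `u ≤ u * t` for the reflections
(transpositions) `t` with `ℓ(u) < ℓ(u * t)`. -/
def bruhatLE {n : ℕ} : Equiv.Perm (Fin n) → Equiv.Perm (Fin n) → Prop :=
  Relation.ReflTransGen fun u w =>
    ∃ i j : Fin n, i ≠ j ∧ w = u * Equiv.swap i j ∧ permLength u < permLength w

/-- `w` covers `u` in Bruhat order. -/
def bruhatCovers {n : ℕ} (u w : Equiv.Perm (Fin n)) : Prop :=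
  bruhatLE u w ∧ u ≠ w ∧ ∀ v, bruhatLE u v → bruhatLE v w → v = u ∨ v = w

/-- The `k`-element set `σ_k(w) = w([k])`, where `[k]` is the set of the first `k` elements. -/
def sigma {n : ℕ} (k : ℕ) (w : Equiv.Perm (Fin n)) : Finset (Fin n) :=
  (Finset.univ.filter fun i : Fin n => (i : ℕ) < k).image w

/-- The `k`-Bruhat order: generated by the Bruhat covers that change `σ_k`. -/
def kBruhatLE {n : ℕ} (k : ℕ) : Equiv.Perm (Fin n) → Equiv.Perm (Fin n) → Prop :=
  Relation.ReflTransGen fun u w => bruhatCovers u w ∧ sigma k u ≠ sigma k w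

/-- The Bruhat interval `[u, w]`. -/
def bruhatIcc {n : ℕ} (u w : Equiv.Perm (Fin n)) : Set (Equiv.Perm (Fin n)) :=
  {v | bruhatLE u v ∧ bruhatLE v w}

/-- Membership in the parabolic subgroup `S_k × S_{n-k}` of `S_n`. -/
def InParabolic {n : ℕ} (k : ℕ) (z : Equiv.Perm (Fin n)) : Prop :=
  ∀ i : Fin n, ((z i : Fin n) : ℕ) < k ↔ (i : ℕ) < k

/-- The `k`-Bruhat intervals `[u, w]_k`, recorded as the pairs `u ≤_k w`. -/
structure KInterval (k n : ℕ) where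
  bot : Equiv.Perm (Fin n)
  top : Equiv.Perm (Fin n)
  le : kBruhatLE k bot top

/-- The generating relation `[u, w]_k ∼ [uz, wz]_k`, for `z ∈ S_k × S_{n-k}` such that both
products are length-additive. -/
def KInterval.Rel {k n : ℕ} (a b : KInterval k n) : Prop :=
  ∃ z : Equiv.Perm (Fin n), InParabolic k z ∧
    b.bot = a.bot * z ∧ permLength b.bot = permLength a.bot + permLength z ∧
    b.top = a.top * z ∧ permLength b.top = permLength a.top + permLength z

/-- `Q(k, n)`: classes of `k`-Bruhat intervals for the equivalence relation generated by the
relation above. -/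
def Q (k n : ℕ) : Type :=
  Quotient (Relation.EqvGen.setoid (KInterval.Rel (k := k) (n := n)))

/-- `q' ≤ q` in `Q(k, n)` if there are representatives `[u', w']_k` of `q'` and `[u, w]_k` of `q`
with `[u', w'] ⊆ [u, w]` as Bruhat intervals. -/
def Q.Rel {k n : ℕ} (q' q : Q k n) : Prop :=
  ∃ a' a : KInterval k n, (Quotient.mk _ a' : Q k n) = q' ∧ (Quotient.mk _ a : Q k n) = q ∧
    bruhatIcc a'.bot a'.top ⊆ bruhatIcc a.bot a.top

end SymmetricGroup

section AffinePermutations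

/-- Affine permutations: bijections `f` of `ℤ` with `f(i + n) = f(i) + n`. -/
def IsAffinePerm (n : ℕ) (f : Equiv.Perm ℤ) : Prop :=
  ∀ i : ℤ, f (i + n) = f i + n

/-- The ball number `(1/n) ∑_{i=1}^n (f(i) - i)`. -/
noncomputable def ballNumber (n : ℕ) (f : Equiv.Perm ℤ) : ℚ :=
  (1 / (n : ℚ)) * ∑ i ∈ Finset.Icc (1 : ℤ) n, ((f i : ℚ) - (i : ℚ))

/-- The length of an affine permutation: the number of inversions `(i, j)` up to simultaneous
translation by multiples of `n`; each class has exactly one representative with `1 ≤ i ≤ n`. -/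
noncomputable def affLength (n : ℕ) (f : Equiv.Perm ℤ) : ℕ :=
  Set.ncard {p : ℤ × ℤ | 1 ≤ p.1 ∧ p.1 ≤ n ∧ p.1 < p.2 ∧ f p.2 < f p.1}

/-- `t` is an affine transposition, that is, a reflection of the Coxeter group of affine
permutations of ball number zero: for some `i, j` that are distinct modulo `n` it exchanges
`i + rn` and `j + rn` for all `r`, and it fixes all other integers. -/
def IsAffineReflection (n : ℕ) (t : Equiv.Perm ℤ) : Prop :=
  ∃ i j : ℤ, ¬ i ≡ j [ZMOD n] ∧
    (∀ r : ℤ, t (i + r * n) = j + r * n ∧ t (j + r * n) = i + r * n) ∧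
    ∀ m : ℤ, ¬ m ≡ i [ZMOD n] → ¬ m ≡ j [ZMOD n] → t m = m

/-- Bruhat order on affine permutations: generated by `f ≤ f * t` for the reflections `t` with
`ℓ(f) < ℓ(f * t)`.  Ball numbers are preserved, so this is the disjoint union of the orders on the
sets of affine permutations of ball number `k`; for `k = 0` it is the Bruhat order of the Coxeter
group, and since composing with `i ↦ i + k` on the right preserves lengths and permutes reflections
by conjugation, for other `k` it is the order carried over by that bijection. -/
def affBruhatLE (n : ℕ) : Equiv.Perm ℤ → Equiv.Perm ℤ → Prop :=
  Relation.ReflTransGen fun f g =>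
    ∃ t : Equiv.Perm ℤ, IsAffineReflection n t ∧ g = f * t ∧ affLength n f < affLength n g

theorem affBruhatLE_length {n : ℕ} {f g : Equiv.Perm ℤ} (h : affBruhatLE n f g) :
    f = g ∨ affLength n f < affLength n g := by
  induction h with
  | refl => exact Or.inl rfl
  | tail _ hs ih =>
    obtain ⟨t, _, _, hl⟩ := hs
    rcases ih with rfl | ih
    · exact Or.inr hl
    · exact Or.inr (ih.trans hl)

/-- `Bound(k, n)`: the bounded affine permutations of ball number `k`. -/
@[ext]
structure Bound (k n : ℕ) where
  toPerm : Equiv.Perm ℤ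
  affine : IsAffinePerm n toPerm
  ball : ballNumber n toPerm = k
  bounded : ∀ i : ℤ, i ≤ toPerm i ∧ toPerm i ≤ i + n

/-- `Bound(k, n)` carries the restriction of the affine Bruhat order. -/
noncomputable instance (k n : ℕ) : PartialOrder (Bound k n) where
  le f g := affBruhatLE n f.toPerm g.toPerm
  le_refl _ := Relation.ReflTransGen.refl
  le_trans _ _ _ h h' := Relation.ReflTransGen.trans h h'
  le_antisymm f g h h' := by
    rcases affBruhatLE_length h with e | e
    · exact Bound.ext e
    · rcases affBruhatLE_length h' with e' | e'
      · exact Bound.ext e'.symm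
      · exact absurd e (lt_asymm e')

end AffinePermutations

section JugglingStates

/-- The juggling state `T` can follow `S`: `T` is `S` shifted down by one together with exactly one
new element `t`. -/
def CanFollow (S T : Set ℤ) : Prop :=
  ∃ t : ℤ, t ∉ {x : ℤ | x + 1 ∈ S} ∧ T = insert t {x : ℤ | x + 1 ∈ S}

/-- `Jugg(k, n)`: sequences `(J_1, …, J_n)` of `k`-element subsets of `{1, …, n}` such that
`J_{i+1} ∪ {m ≤ 0}` can follow `J_i ∪ {m ≤ 0}` for each `i`, with indices modulo `n`. -/
@[ext]
structure Jugg (k n : ℕ) where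
  state : Fin n → Finset ℤ
  subset : ∀ i, state i ⊆ Finset.Icc 1 (n : ℤ)
  card : ∀ i, (state i).card = k
  follow : ∀ i, CanFollow (↑(state i) ∪ Set.Iic 0) (↑(state (finRotate n i)) ∪ Set.Iic 0)

/-- Comparison of `k`-element sets `I = {i_1 < ⋯ < i_k}` and `J = {j_1 < ⋯ < j_k}`:
`i_r ≤ j_r` for all `r`. -/
def subsetLE {k : ℕ} (I J : Finset ℤ) (hI : I.card = k) (hJ : J.card = k) : Prop :=
  ∀ r : Fin k, I.orderEmbOfFin hI r ≤ J.orderEmbOfFin hJ r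

theorem subsetLE_antisymm {k : ℕ} {I J : Finset ℤ} {hI : I.card = k} {hJ : J.card = k}
    (h : subsetLE I J hI hJ) (h' : subsetLE J I hJ hI) : I = J := by
  have e : (I.orderEmbOfFin hI : Fin k → ℤ) = J.orderEmbOfFin hJ :=
    funext fun r => le_antisymm (h r) (h' r)
  have hr := congrArg Set.range e
  rw [Finset.range_orderEmbOfFin, Finset.range_orderEmbOfFin] at hr
  exact_mod_cast hr

/-- `Jugg(k, n)` is ordered componentwise. -/
noncomputable instance (k n : ℕ) : PartialOrder (Jugg k n) where
  le J J' := ∀ i, subsetLE (J.state i) (J'.state i) (J.card i) (J'.card i)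
  le_refl _ _ _ := le_rfl
  le_trans _ _ _ h h' i r := (h i r).trans (h' i r)
  le_antisymm _ _ h h' := Jugg.ext (funext fun i => subsetLE_antisymm (h i) (h' i))

end JugglingStates

end Positroid

namespace Positroid

universe u

section GoodLabelings

variable {P : Type u} [PartialOrder P] {L : Type u}

/-- `Path lab x y ks`: there is a saturated chain from `x` to `y` with label sequence `ks`. -/
inductive Path (lab : P → P → L) : P → P → List L → Prop
  | nil (x : P) : Path lab x x []
  | cons {x y z : P} {ks : List L} (h : x ⋖ y) (p : Path lab y z ks) : Path lab x z (lab x y :: ks)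

namespace Path

variable {lab : P → P → L}

theorem le {x y : P} {ks : List L} (p : Path lab x y ks) : x ≤ y := by
  induction p with
  | nil => exact le_rfl
  | cons h _ ih => exact h.le.trans ih

theorem append {x y z : P} {ks ls : List L} (p : Path lab x y ks) (q : Path lab y z ls) :
    Path lab x z (ks ++ ls) := by
  induction p with
  | nil => exact q
  | cons h _ ih => exact .cons h (ih q)

theorem single {x y : P} (h : x ⋖ y) : Path lab x y [lab x y] := .cons h (.nil y)

theorem of_append {ks : List L} : ∀ {x z : P} {ls : List L}, Path lab x z (ks ++ ls) →
    ∃ y, Path lab x y ks ∧ Path lab y z ls := by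
  induction ks with
  | nil => intro x z ls p; exact ⟨x, .nil x, p⟩
  | cons k ks ih =>
    intro x z ls p
    cases p with
    | cons h p =>
      obtain ⟨y, hy, hy'⟩ := ih p
      exact ⟨y, .cons h hy, hy'⟩

theorem single_iff {x y : P} {k : L} : Path lab x y [k] ↔ x ⋖ y ∧ lab x y = k := by
  constructor
  · rintro (_ | ⟨h, p⟩)
    cases p
    exact ⟨h, rfl⟩
  · rintro ⟨h, rfl⟩
    exact single h

theorem eq_of_nil {x y : P} (p : Path lab x y []) : x = y := by
  cases p; rfl

theorem dual {x y : P} {ks : List L} (p : Path lab x y ks) :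
    Path (P := Pᵒᵈ) (fun a b => lab (OrderDual.ofDual b) (OrderDual.ofDual a))
      (OrderDual.toDual y) (OrderDual.toDual x) ks.reverse := by
  induction p with
  | nil => exact .nil _
  | cons h _ ih =>
    rw [List.reverse_cons]
    exact ih.append (single (lab := fun a b => lab (OrderDual.ofDual b) (OrderDual.ofDual a))
      (toDual_covBy_toDual_iff.2 h))

theorem exists_chain {x y : P} {ks : List L} (p : Path lab x y ks) :
    ∃ c, IsSaturatedChain x y c ∧ labelSeq lab c = ks := by
  induction p with
  | nil x => exact ⟨[x], by simp [IsSaturatedChain], by simp [labelSeq]⟩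
  | @cons x y z ks h _ ih =>
    obtain ⟨c, ⟨h1, h2, h3⟩, h4⟩ := ih
    cases c with
    | nil => simp at h1
    | cons a c =>
      simp only [List.head?_cons, Option.some.injEq] at h1
      subst h1
      refine ⟨x :: a :: c, ⟨rfl, by simpa using h2, List.isChain_cons_cons.2 ⟨h, h3⟩⟩, ?_⟩
      rw [← h4]
      simp [labelSeq]

theorem of_chain {y : P} (c : List P) : ∀ {x : P}, IsSaturatedChain x y c →
    Path lab x y (labelSeq lab c) := by
  induction c with
  | nil => intro x h; simp [IsSaturatedChain] at h
  | cons a c ih =>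
    rintro x ⟨h1, h2, h3⟩
    simp only [List.head?_cons, Option.some.injEq] at h1
    subst h1
    cases c with
    | nil =>
      simp only [List.getLast?_singleton, Option.some.injEq] at h2
      subst h2
      exact .nil _
    | cons b c =>
      rw [List.isChain_cons_cons] at h3
      have := ih (x := b) ⟨rfl, by simpa using h2, h3.2⟩
      exact .cons h3.1 this

theorem of_orderIso {R : Type u} [PartialOrder R] (e : R ≃o P) {x y : P} {ks : List L}
    (p : Path lab x y ks) : Path (fun a b => lab (e a) (e b)) (e.symm x) (e.symm y) ks := by
  induction p with
  | nil => exact .nil _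
  | @cons x y z ks h _ ih =>
    have := Path.cons (lab := fun a b => lab (e a) (e b)) ((apply_covBy_apply_iff e.symm).2 h) ih
    simpa using this

theorem orderIso {R : Type u} [PartialOrder R] (e : R ≃o P) {x y : R} {ks : List L}
    (p : Path (fun a b => lab (e a) (e b)) x y ks) : Path lab (e x) (e y) ks := by
  induction p with
  | nil => exact .nil _
  | cons h _ ih => exact .cons ((apply_covBy_apply_iff e).2 h) ih

end Path

/-- A graded poset with edge labels such that each interval has a unique rising and a unique
falling maximal chain, together with local conditions on intervals of length two. -/
structure GoodLabeling [LinearOrder L] (grade : P → ℤ) (lab : P → P → L) : Prop where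
  strictMono : StrictMono grade
  grade_covBy : ∀ {x y : P}, x ⋖ y → grade y = grade x + 1
  exists_rising : ∀ {x y : P}, x ≤ y → ∃ ks, Path lab x y ks ∧ ks.Pairwise (· < ·)
  rising_unique : ∀ {x y : P} {ks ls : List L}, Path lab x y ks → ks.Pairwise (· < ·) →
    Path lab x y ls → ls.Pairwise (· < ·) → ks = ls
  exists_falling : ∀ {x y : P}, x ≤ y → ∃ ks, Path lab x y ks ∧ ks.Pairwise (· > ·)
  falling_unique : ∀ {x y : P} {ks ls : List L}, Path lab x y ks → ks.Pairwise (· > ·) →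
    Path lab x y ls → ls.Pairwise (· > ·) → ks = ls
  inj_left : ∀ {x h e : P}, x ⋖ h → x ⋖ e → lab x h = lab x e → h = e
  inj_right : ∀ {h e y : P}, h ⋖ y → e ⋖ y → lab h y = lab e y → h = e
  ne : ∀ {x h y : P}, x ⋖ h → h ⋖ y → lab x h ≠ lab h y
  not_above : ∀ {x h e y : P}, x ⋖ h → h ⋖ y → x ⋖ e → e ⋖ y →
    ¬ (lab h y < lab x h ∧ lab x h < lab x e ∧ lab x e < lab e y)
  not_below : ∀ {x h e y : P}, x ⋖ h → h ⋖ y → x ⋖ e → e ⋖ y →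
    ¬ (lab x h < lab h y ∧ lab h y < lab e y ∧ lab e y < lab x e)

namespace GoodLabeling

variable [LinearOrder L] {grade : P → ℤ} {lab : P → P → L}

theorem dual (G : GoodLabeling grade lab) :
    GoodLabeling (P := Pᵒᵈ) (fun x => - grade (OrderDual.ofDual x))
      (fun a b => lab (OrderDual.ofDual b) (OrderDual.ofDual a)) := by
  have back : ∀ {x y : Pᵒᵈ} {ks : List L},
      Path (P := Pᵒᵈ) (fun a b => lab (OrderDual.ofDual b) (OrderDual.ofDual a)) x y ks →
      Path lab (OrderDual.ofDual y) (OrderDual.ofDual x) ks.reverse := fun p => p.dual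
  refine ⟨fun x y h => neg_lt_neg (G.strictMono h), fun h => ?_, fun {x y} h => ?_,
    fun h1 h2 h3 h4 => ?_, fun {x y} h => ?_, fun h1 h2 h3 h4 => ?_,
    fun h1 h2 h3 => G.inj_right h1.ofDual h2.ofDual h3,
    fun h1 h2 h3 => G.inj_left h1.ofDual h2.ofDual h3,
    fun h1 h2 h3 => G.ne h2.ofDual h1.ofDual h3.symm, fun h1 h2 h3 h4 h5 => ?_,
    fun h1 h2 h3 h4 h5 => ?_⟩
  · have := G.grade_covBy h.ofDual
    lia
  · obtain ⟨ks, hp, hk⟩ := G.exists_falling (x := OrderDual.ofDual y) (y := OrderDual.ofDual x) h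
    exact ⟨ks.reverse, hp.dual, List.pairwise_reverse.2 hk⟩
  · exact List.reverse_injective (G.falling_unique (back h1) (List.pairwise_reverse.2 h2) (back h3)
      (List.pairwise_reverse.2 h4))
  · obtain ⟨ks, hp, hk⟩ := G.exists_rising (x := OrderDual.ofDual y) (y := OrderDual.ofDual x) h
    exact ⟨ks.reverse, hp.dual, List.pairwise_reverse.2 hk⟩
  · exact List.reverse_injective (G.rising_unique (back h1) (List.pairwise_reverse.2 h2) (back h3)
      (List.pairwise_reverse.2 h4))
  · exact G.not_below h2.ofDual h1.ofDual h4.ofDual h3.ofDual h5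
  · exact G.not_above h2.ofDual h1.ofDual h4.ofDual h3.ofDual h5

theorem chain_ext (G : GoodLabeling grade lab) {y : P} (c : List P) :
    ∀ {x : P} {c' : List P}, IsSaturatedChain x y c → IsSaturatedChain x y c' →
      labelSeq lab c = labelSeq lab c' → c = c' := by
  induction c with
  | nil => intro x c' h; simp [IsSaturatedChain] at h
  | cons a c ih =>
    rintro x c' ⟨h1, h2, h3⟩ ⟨h1', h2', h3'⟩ e
    simp only [List.head?_cons, Option.some.injEq] at h1
    subst h1
    cases c' with
    | nil => simp at h1'
    | cons a' c' =>
      simp only [List.head?_cons, Option.some.injEq] at h1'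
      subst h1'
      cases c with
      | nil =>
        cases c' with
        | nil => rfl
        | cons b' c' => simp [labelSeq] at e
      | cons b c =>
        cases c' with
        | nil => simp [labelSeq] at e
        | cons b' c' =>
          rw [List.isChain_cons_cons] at h3 h3'
          have e' : lab a' b :: labelSeq lab (b :: c) = lab a' b' :: labelSeq lab (b' :: c') := e
          rw [List.cons.injEq] at e'
          obtain rfl := G.inj_left h3.1 h3'.1 e'.1
          rw [ih (x := b) ⟨rfl, by simpa using h2, h3.2⟩ ⟨rfl, by simpa using h2', h3'.2⟩ e'.2]

theorem length_eq (G : GoodLabeling grade lab) {x y : P} {ks : List L} (p : Path lab x y ks) :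
    grade y = grade x + ks.length := by
  induction p with
  | nil => simp
  | cons h _ ih => rw [ih, G.grade_covBy h]; push_cast [List.length_cons]; ring

theorem first_label_le [Finite P] (G : GoodLabeling grade lab) {x y : P} {k : L} {ks : List L}
    (p : Path lab x y (k :: ks)) (hs : (k :: ks).Pairwise (· < ·)) {h : P} (hh : x ⋖ h)
    (hy : h ≤ y) : k ≤ lab x h := by
  obtain ⟨h0, ⟨hh0, hy0⟩, hmin⟩ := Set.exists_min_image {h : P | x ⋖ h ∧ h ≤ y} (lab x)
    (Set.toFinite _) ⟨h, hh, hy⟩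
  refine le_trans ?_ (hmin h ⟨hh, hy⟩)
  obtain ⟨ls, q, hl⟩ := G.exists_rising hy0
  cases q with
  | nil =>
    have := G.length_eq p
    have h2 := G.grade_covBy hh0
    have h3 : ks = [] := List.length_eq_zero_iff.1 (by simp only [List.length_cons] at this; lia)
    subst h3
    exact (Path.single_iff.1 p).2.ge
  | @cons _ h1 _ ls c q =>
    rcases lt_or_ge (lab x h0) (lab h0 h1) with hlt | hge
    · have : (lab x h0 :: lab h0 h1 :: ls).Pairwise (· < ·) := by
        rw [← List.isChain_iff_pairwise] at hl ⊢
        exact List.isChain_cons_cons.2 ⟨hlt, hl⟩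
      have := G.rising_unique p hs (.cons hh0 (.cons c q)) this
      rw [List.cons.injEq] at this
      exact this.1.le
    · have hlt := lt_of_le_of_ne hge (G.ne hh0 c).symm
      obtain ⟨ms, r, hm⟩ := G.exists_rising (hh0.le.trans c.le)
      have hlen := G.length_eq r
      rw [G.grade_covBy c, G.grade_covBy hh0] at hlen
      cases r with
      | nil => simp at hlen; lia
      | @cons _ e _ ms ce r =>
        cases r with
        | nil => simp at hlen
        | @cons _ e' _ ms ce' r =>
          have h3 : ms = [] := List.length_eq_zero_iff.1
            (by simp only [List.length_cons] at hlen; push_cast at hlen; lia)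
          subst h3
          cases r
          have hab : lab x e < lab e h1 := by simpa using hm
          have hle := hmin e ⟨ce, ce'.le.trans q.le⟩
          rcases hle.lt_or_eq with hl' | heq
          · exact absurd ⟨hlt, hl', hab⟩ (G.not_above hh0 c ce ce')
          · obtain rfl := G.inj_left hh0 ce heq
            exact absurd hab (not_lt.2 hge)

theorem lex_min [Finite P] (G : GoodLabeling grade lab) {ls : List L} :
    ∀ {x y : P} {ks : List L}, Path lab x y ks → ks.Pairwise (· < ·) → Path lab x y ls →
      ks = ls ∨ List.Lex (· < ·) ks ls := by
  induction ls with
  | nil =>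
    intro x y ks p hs q
    obtain rfl := q.eq_of_nil
    have := G.length_eq p
    exact Or.inl (List.length_eq_zero_iff.1 (by lia))
  | cons l ls ih =>
    intro x y ks p hs q
    cases ks with
    | nil => exact Or.inr .nil
    | cons k ks =>
      have key := fun {h} => G.first_label_le p hs (h := h)
      cases q with
      | @cons _ e _ _ c q =>
        rcases (key c q.le).lt_or_eq with hlt | heq
        · exact Or.inr (.rel hlt)
        · cases p with
          | @cons _ h _ _ c' p =>
            obtain rfl := G.inj_left c' c heq
            rcases ih p hs.of_cons q with rfl | hl
            · exact Or.inl rfl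
            · exact Or.inr (.cons hl)

theorem isELShellable [Finite P] (G : GoodLabeling grade lab) : IsELShellable P := by
  refine ⟨L, inferInstance, lab, fun x y hxy => ?_⟩
  obtain ⟨ks, p, hs⟩ := G.exists_rising hxy
  obtain ⟨c, hc, rfl⟩ := p.exists_chain
  refine ⟨c, hc, hs, fun c' hc' hs' => ?_, fun c' hc' => G.lex_min p hs (.of_chain c' hc')⟩
  exact G.chain_ext c' hc' hc (G.rising_unique (.of_chain c' hc') hs' p hs)

/-- The edge `z ⋖ z'` extends the falling chain from `x` to `z` and the rising chain from `z'` to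
`y`. -/
def Matched (lab : P → P → L) (x y z z' : P) : Prop :=
  z ⋖ z' ∧ ∃ ds rs, Path lab x z ds ∧ (ds ++ [lab z z']).Pairwise (· > ·) ∧ Path lab z' y rs ∧
    (lab z z' :: rs).Pairwise (· < ·)

theorem exists_matched (G : GoodLabeling grade lab) {x y z : P} (hxy : x < y) (hxz : x ≤ z)
    (hzy : z ≤ y) : ∃ z', Matched lab x y z z' ∨ Matched lab x y z' z := by
  obtain ⟨ds, p, hd⟩ := G.exists_falling hxz
  obtain ⟨rs, q, hr⟩ := G.exists_rising hzy
  have up : ∀ {z' : P} {rs' : List L}, z ⋖ z' → Path lab z' y rs' →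
      (lab z z' :: rs').Pairwise (· < ·) → (∀ k ∈ ds.getLast?, lab z z' < k) →
      ∃ z', Matched lab x y z z' ∨ Matched lab x y z' z := by
    intro z' rs' c q' hr' hk
    refine ⟨z', Or.inl ⟨c, ds, rs', p, ?_, q', hr'⟩⟩
    rw [← List.isChain_iff_pairwise] at hd ⊢
    exact List.isChain_append.2 ⟨hd, by simp, fun a ha b hb => by
      simp only [List.head?_cons, Option.mem_def, Option.some.injEq] at hb
      subst hb
      exact hk a ha⟩
  rcases List.eq_nil_or_concat' ds with rfl | ⟨ds', k, rfl⟩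
  · obtain rfl := p.eq_of_nil
    cases q with
    | nil => exact absurd rfl hxy.ne
    | cons c q => exact up c q hr (by simp)
  · obtain ⟨w, p1, p2⟩ := p.of_append
    obtain ⟨c, rfl⟩ := Path.single_iff.1 p2
    have down : (lab w z :: rs).Pairwise (· < ·) →
        ∃ z', Matched lab x y z z' ∨ Matched lab x y z' z := fun h =>
      ⟨w, Or.inr ⟨c, ds', rs, p1, hd, q, h⟩⟩
    cases q with
    | nil => exact down (by simp)
    | @cons _ z' _ rs c' q =>
      rcases lt_or_ge (lab w z) (lab z z') with hlt | hge
      · refine down ?_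
        rw [← List.isChain_iff_pairwise] at hr ⊢
        exact List.isChain_cons_cons.2 ⟨hlt, hr⟩
      · refine up c' q hr fun k hk => ?_
        simp only [List.getLast?_append, List.getLast?_singleton, Option.some_or, Option.mem_def,
          Option.some.injEq] at hk
        subst hk
        exact lt_of_le_of_ne hge (G.ne c c').symm

theorem matched_unique (G : GoodLabeling grade lab) {x y z z1 z2 : P}
    (h1 : Matched lab x y z z1 ∨ Matched lab x y z1 z)
    (h2 : Matched lab x y z z2 ∨ Matched lab x y z2 z) : z1 = z2 := by
  have mixed : ∀ {z1 z2 : P}, Matched lab x y z z1 → Matched lab x y z2 z → False := by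
    rintro z1 z2 ⟨c1, ds1, rs1, p1, hd1, q1, hr1⟩ ⟨c2, ds2, rs2, p2, hd2, q2, hr2⟩
    have e1 := G.falling_unique p1 (List.pairwise_append.1 hd1).1
      (p2.append (.single c2)) hd2
    have e2 := G.rising_unique q2 hr2.of_cons (Path.cons c1 q1) hr1
    subst e1 e2
    have a1 : lab z z1 < lab z2 z := (List.pairwise_append.1 hd1).2.2 _ (by simp) _ (by simp)
    have a2 : lab z2 z < lab z z1 := (List.pairwise_cons.1 hr2).1 _ (by simp)
    exact lt_asymm a1 a2
  rcases h1 with h1 | h1 <;> rcases h2 with h2 | h2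
  · obtain ⟨c1, ds1, rs1, p1, hd1, q1, hr1⟩ := h1
    obtain ⟨c2, ds2, rs2, p2, hd2, q2, hr2⟩ := h2
    have := G.rising_unique (Path.cons c1 q1) hr1 (Path.cons c2 q2) hr2
    rw [List.cons.injEq] at this
    exact G.inj_left c1 c2 this.1
  · exact (mixed h1 h2).elim
  · exact (mixed h2 h1).elim
  · obtain ⟨c1, ds1, rs1, p1, hd1, q1, hr1⟩ := h1
    obtain ⟨c2, ds2, rs2, p2, hd2, q2, hr2⟩ := h2
    have := G.falling_unique (p1.append (.single c1)) hd1 (p2.append (.single c2)) hd2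
    exact G.inj_right c1 c2 (by simpa using (List.append_inj' this rfl).2)

theorem sum_sign (G : GoodLabeling grade lab) {x y : P} (hxy : x < y) (s : Finset P)
    (hs : ∀ z, z ∈ s ↔ x ≤ z ∧ z ≤ y) :
    ∑ z ∈ s, (((-1 : ℤˣ) ^ (grade x - grade z) : ℤˣ) : ℤ) = 0 := by
  have ex : ∀ z ∈ s, ∃ z', Matched lab x y z z' ∨ Matched lab x y z' z := fun z hz =>
    G.exists_matched hxy ((hs z).1 hz).1 ((hs z).1 hz).2
  choose! σ hσ using ex
  have mem : ∀ {z z' : P}, Matched lab x y z z' → z ∈ s ∧ z' ∈ s := by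
    rintro z z' ⟨c, ds, rs, p, -, q, -⟩
    exact ⟨(hs z).2 ⟨p.le, c.le.trans q.le⟩, (hs z').2 ⟨p.le.trans c.le, q.le⟩⟩
  have hmem : ∀ z ∈ s, σ z ∈ s := fun z hz => (hσ z hz).elim (fun h => (mem h).2)
    (fun h => (mem h).1)
  have step : ∀ {z z' : P}, z ⋖ z' →
      (((-1 : ℤˣ) ^ (grade x - grade z) : ℤˣ) : ℤ) + (((-1 : ℤˣ) ^ (grade x - grade z') : ℤˣ) : ℤ)
        = 0 := by
    intro z z' c
    rw [show grade x - grade z = (grade x - grade z') + 1 by rw [G.grade_covBy c]; ring,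
      zpow_add, zpow_one]
    push_cast
    ring
  refine Finset.sum_involution (fun z _ => σ z) (fun z hz => ?_) (fun z hz _ => ?_)
    (fun z hz => hmem z hz) (fun z hz => ?_)
  · rcases hσ z hz with h | h
    · exact step h.1
    · rw [add_comm]; exact step h.1
  · rcases hσ z hz with h | h
    · exact h.1.ne'
    · exact h.1.ne
  · exact G.matched_unique (hσ _ (hmem z hz)) (hσ z hz).symm

theorem isEulerian (G : GoodLabeling grade lab) : IsEulerian P := by
  refine ⟨{ grade := grade
            grade_strictMono := G.strictMono
            covBy_grade := fun x y h => by
              rw [G.grade_covBy h]; exact Order.covBy_add_one _ }, ?_⟩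
  intro x y hxy _ _
  have key : ∀ m : ℕ, ∀ (z : P) (hz : x ≤ z ∧ z ≤ y), grade z - grade x = m →
      IncidenceAlgebra.mu ℤ (⟨x, Set.left_mem_Icc.2 hxy⟩ : Set.Icc x y) ⟨z, hz⟩ =
        (((-1 : ℤˣ) ^ (grade x - grade z) : ℤˣ) : ℤ) := by
    intro m
    induction m using Nat.strong_induction_on with
    | _ m ih =>
      intro z hz hm
      rcases hz.1.eq_or_lt with rfl | hlt
      · simp
      · have hne : (⟨x, Set.left_mem_Icc.2 hxy⟩ : Set.Icc x y) ≠ ⟨z, hz⟩ := fun h =>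
          hlt.ne (congrArg Subtype.val h)
        have h1 := IncidenceAlgebra.sum_Icc_mu_right (𝕜 := ℤ)
          (⟨x, Set.left_mem_Icc.2 hxy⟩ : Set.Icc x y) ⟨z, hz⟩
        rw [if_neg hne] at h1
        have h2 := G.sum_sign hlt ((Finset.Icc (⟨x, Set.left_mem_Icc.2 hxy⟩ : Set.Icc x y)
          ⟨z, hz⟩).map (Function.Embedding.subtype _)) (by
            intro w
            simp only [Finset.mem_map, Finset.mem_Icc, Function.Embedding.coe_subtype]
            constructor
            · rintro ⟨⟨w, hw⟩, ⟨ha, hb⟩, rfl⟩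
              exact ⟨ha, hb⟩
            · rintro ⟨ha, hb⟩
              exact ⟨⟨w, ha, hb.trans hz.2⟩, ⟨ha, hb⟩, rfl⟩)
        rw [Finset.sum_map] at h2
        rw [Finset.sum_eq_sum_sdiff_singleton_add (i := (⟨z, hz⟩ : Set.Icc x y))
          (Finset.mem_Icc.2 ⟨hz.1, le_rfl⟩)] at h1 h2
        simp only [Function.Embedding.coe_subtype] at h2
        have h3 : ∀ w ∈ Finset.Icc (⟨x, Set.left_mem_Icc.2 hxy⟩ : Set.Icc x y) ⟨z, hz⟩ \ {⟨z, hz⟩},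
            IncidenceAlgebra.mu ℤ (⟨x, Set.left_mem_Icc.2 hxy⟩ : Set.Icc x y) w =
            (((-1 : ℤˣ) ^ (grade x - grade (w : P)) : ℤˣ) : ℤ) := by
          intro w hw
          rw [Finset.mem_sdiff, Finset.mem_Icc, Finset.mem_singleton] at hw
          have hwz : (w : P) < z := lt_of_le_of_ne hw.1.2 fun h => hw.2 (Subtype.ext h)
          have g1 := G.strictMono hwz
          have g2 := G.strictMono.monotone w.2.1
          exact ih (grade w - grade x).toNat (by lia) w w.2 (by lia)
        rw [Finset.sum_congr rfl h3] at h1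
        lia
  have hg := G.strictMono.monotone hxy
  exact key (grade y - grade x).toNat y ⟨hxy, le_rfl⟩ (by lia)

theorem eulerian_shellable [Finite P] (G : GoodLabeling grade lab) :
    IsEulerian P ∧ IsELShellable P ∧ IsEulerian Pᵒᵈ ∧ IsELShellable Pᵒᵈ :=
  ⟨G.isEulerian, G.isELShellable, G.dual.isEulerian, G.dual.isELShellable⟩

theorem ofOrderIso (G : GoodLabeling grade lab) {R : Type u} [PartialOrder R] (e : R ≃o P) :
    GoodLabeling (fun a => grade (e a)) (fun a b => lab (e a) (e b)) := by
  have cov := fun {a b : R} (h : a ⋖ b) => (apply_covBy_apply_iff e).2 h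
  refine ⟨fun x y h => G.strictMono (e.strictMono h), fun h => G.grade_covBy (cov h),
    fun {x y} h => ?_, fun h1 h2 h3 h4 => G.rising_unique (Path.orderIso e h1) h2
    (Path.orderIso e h3) h4, fun {x y} h => ?_, fun h1 h2 h3 h4 => G.falling_unique
    (Path.orderIso e h1) h2 (Path.orderIso e h3) h4,
    fun h1 h2 h3 => e.injective (G.inj_left (cov h1) (cov h2) h3),
    fun h1 h2 h3 => e.injective (G.inj_right (cov h1) (cov h2) h3),
    fun h1 h2 => G.ne (cov h1) (cov h2),
    fun h1 h2 h3 h4 => G.not_above (cov h1) (cov h2) (cov h3) (cov h4),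
    fun h1 h2 h3 h4 => G.not_below (cov h1) (cov h2) (cov h3) (cov h4)⟩
  · obtain ⟨ks, p, hs⟩ := G.exists_rising (e.monotone h)
    exact ⟨ks, by simpa using Path.of_orderIso e p, hs⟩
  · obtain ⟨ks, p, hs⟩ := G.exists_falling (e.monotone h)
    exact ⟨ks, by simpa using Path.of_orderIso e p, hs⟩

theorem of_subsingleton [Subsingleton P] (grade : P → ℤ) (lab : P → P → L) :
    GoodLabeling grade lab := by
  have nc : ∀ {x y : P}, ¬ x ⋖ y := fun {x y} h => h.ne (Subsingleton.elim x y)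
  have nil : ∀ {x y : P} {ks : List L}, Path lab x y ks → ks = [] := by
    rintro x y ks (_ | ⟨h, -⟩)
    · rfl
    · exact (nc h).elim
  exact ⟨fun x y h => (h.ne (Subsingleton.elim x y)).elim, fun h => (nc h).elim,
    fun {x y} _ => ⟨[], Subsingleton.elim x y ▸ .nil x, .nil⟩,
    fun h1 _ h2 _ => (nil h1).trans (nil h2).symm,
    fun {x y} _ => ⟨[], Subsingleton.elim x y ▸ .nil x, .nil⟩,
    fun h1 _ h2 _ => (nil h1).trans (nil h2).symm, fun h => (nc h).elim, fun h => (nc h).elim,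
    fun h => (nc h).elim, fun h => (nc h).elim, fun h => (nc h).elim⟩

end GoodLabeling

end GoodLabelings

section AffineLength

variable {n : ℕ}

theorem IsAffinePerm.add_mul {f : Equiv.Perm ℤ} (hf : IsAffinePerm n f) (x r : ℤ) :
    f (x + r * n) = f x + r * n := by
  induction r using Int.induction_on with
  | zero => simp
  | succ r ih => rw [show x + ((r : ℤ) + 1) * n = x + r * n + n by ring, hf, ih]; ring
  | pred r ih =>
    have := hf (x + (-(r : ℤ) - 1) * n)
    rw [show x + (-(r : ℤ) - 1) * n + n = x + -(r : ℤ) * n by ring, ih] at this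
    linarith

theorem IsAffinePerm.modEq_iff {f : Equiv.Perm ℤ} (hf : IsAffinePerm n f) {x y : ℤ} :
    f x ≡ f y [ZMOD n] ↔ x ≡ y [ZMOD n] := by
  constructor
  · intro h
    obtain ⟨r, hr⟩ := h.dvd
    have : f y = f (x + r * n) := by rw [hf.add_mul]; linarith
    have := f.injective this
    exact (Int.modEq_iff_dvd).2 ⟨r, by rw [this]; ring⟩
  · intro h
    obtain ⟨r, hr⟩ := h.dvd
    have : y = x + r * n := by linarith
    rw [this, hf.add_mul]
    exact (Int.modEq_iff_dvd).2 ⟨r, by ring⟩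

theorem neg_ediv_of_not_dvd {d m : ℤ} (hm : 0 < m) (h : ¬ m ∣ d) : (-d) / m = -(d / m) - 1 := by
  have h1 := Int.emod_add_mul_ediv d m
  have h2 := Int.emod_nonneg d hm.ne'
  have h3 := Int.emod_lt_of_pos d hm
  have h4 : d % m ≠ 0 := fun h0 => h (Int.dvd_of_emod_eq_zero h0)
  rw [Int.ediv_eq_iff_of_pos hm]
  constructor <;> nlinarith [lt_of_le_of_ne h2 h4.symm]

/-- The number of inversions of `f` between the classes of `x` and `y` modulo `n`. -/
def classInv (n : ℕ) (f : Equiv.Perm ℤ) (x y : ℤ) : ℤ :=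
  |(f x - f y) / n - (x - y) / n|

theorem classInv_comm (hn : 0 < n) {f : Equiv.Perm ℤ} (hf : IsAffinePerm n f) (x y : ℤ) :
    (f x - f y) / n - (x - y) / n = -((f y - f x) / n - (y - x) / n) := by
  have hn' : (0 : ℤ) < n := by exact_mod_cast hn
  by_cases h : (n : ℤ) ∣ x - y
  · obtain ⟨r, hr⟩ := h
    obtain rfl : x = y + r * n := by linarith
    rw [hf.add_mul, show f y + r * n - f y = r * n by ring, show f y - (f y + r * n) = -r * n by ring,
      show y + r * n - y = r * n by ring, show y - (y + r * n) = -r * n by ring]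
    simp
  · have h' : ¬ (n : ℤ) ∣ f x - f y := fun h' =>
      h (Int.modEq_iff_dvd.1 (hf.modEq_iff.1 (Int.modEq_iff_dvd.2 h')))
    rw [← neg_sub (x : ℤ) y, ← neg_sub (f x) (f y), neg_ediv_of_not_dvd hn' h,
      neg_ediv_of_not_dvd hn' h']
    ring

theorem classInv_symm (hn : 0 < n) {f : Equiv.Perm ℤ} (hf : IsAffinePerm n f) (x y : ℤ) :
    classInv n f x y = classInv n f y x := by
  rw [classInv, classInv_comm hn hf, abs_neg, classInv]

theorem classInv_add_left (hn : 0 < n) {f : Equiv.Perm ℤ} (hf : IsAffinePerm n f) (x y r : ℤ) :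
    classInv n f (x + r * n) y = classInv n f x y := by
  have hn' : (n : ℤ) ≠ 0 := by exact_mod_cast hn.ne'
  rw [classInv, classInv, hf.add_mul, show f x + r * n - f y = f x - f y + r * n by ring,
    show x + r * n - y = x - y + r * n by ring, Int.add_mul_ediv_right _ _ hn',
    Int.add_mul_ediv_right _ _ hn']
  congr 1
  ring

theorem classInv_modEq (hn : 0 < n) {f : Equiv.Perm ℤ} (hf : IsAffinePerm n f) {x x' : ℤ}
    (h : x ≡ x' [ZMOD n]) (y : ℤ) : classInv n f x y = classInv n f x' y := by
  obtain ⟨r, hr⟩ := h.dvd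
  obtain rfl : x' = x + r * n := by linarith
  rw [classInv_add_left hn hf]

theorem affLength_eq_sum (hn : 0 < n) {f : Equiv.Perm ℤ} (hf : IsAffinePerm n f) :
    affLength n f = ∑ p ∈ Finset.Icc (1 : ℤ) n ×ˢ Finset.Icc (1 : ℤ) n,
      ((f p.1 - f p.2) / n - (p.1 - p.2) / n).toNat := by
  have hn' : (0 : ℤ) < n := by exact_mod_cast hn
  have hset : {p : ℤ × ℤ | 1 ≤ p.1 ∧ p.1 ≤ n ∧ p.1 < p.2 ∧ f p.2 < f p.1} =
      (((Finset.Icc (1 : ℤ) n ×ˢ Finset.Icc (1 : ℤ) n).sigma fun p =>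
        Finset.Ioc ((p.1 - p.2) / (n : ℤ)) ((f p.1 - f p.2) / (n : ℤ))).image
        fun q => (q.1.1, q.1.2 + q.2 * n) : Finset (ℤ × ℤ)) := by
    ext ⟨x, y⟩
    simp only [Set.mem_ofPred_eq, Finset.coe_image, Set.mem_image, Finset.mem_coe, Finset.mem_sigma,
      Finset.mem_product, Finset.mem_Icc, Finset.mem_Ioc, Sigma.exists, Prod.exists, Prod.mk.injEq]
    constructor
    · rintro ⟨h1, h2, h3, h4⟩
      have e1 := Int.emod_add_mul_ediv (y - 1) n
      have e2 := Int.emod_nonneg (y - 1) hn'.ne'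
      have e3 := Int.emod_lt_of_pos (y - 1) hn'
      set b := (y - 1) % n + 1 with hb
      set m := (y - 1) / n with hm
      have hy : y = b + m * n := by rw [hb]; linarith
      refine ⟨x, b, m, ⟨⟨⟨h1, h2⟩, by lia, by lia⟩, ?_, ?_⟩, rfl, hy.symm⟩
      · rw [Int.ediv_lt_iff_lt_mul hn']
        linarith
      · rw [Int.le_ediv_iff_mul_le hn']
        rw [hy, hf.add_mul] at h4
        linarith
    · rintro ⟨a, b, m, ⟨⟨⟨h1, h2⟩, h3, h4⟩, h5, h6⟩, rfl, rfl⟩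
      rw [Int.ediv_lt_iff_lt_mul hn'] at h5
      rw [Int.le_ediv_iff_mul_le hn'] at h6
      refine ⟨h1, h2, by linarith, ?_⟩
      rw [hf.add_mul]
      rcases h6.lt_or_eq with h6 | h6
      · linarith
      · have : f a = f (b + m * n) := by rw [hf.add_mul]; linarith
        have := f.injective this
        linarith
  rw [affLength, hset, Set.ncard_coe_finset, Finset.card_image_of_injOn, Finset.card_sigma]
  · simp [Int.card_Ioc]
  · rintro ⟨⟨a, b⟩, m⟩ h ⟨⟨a', b'⟩, m'⟩ h' e
    simp only [Finset.coe_sigma, Set.mem_sigma_iff, Finset.mem_coe, Finset.mem_product,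
      Finset.mem_Icc] at h h'
    simp only [Prod.mk.injEq] at e
    obtain ⟨rfl, e⟩ := e
    have h1 := h.1.2
    have h2 := h'.1.2
    have hm : m = m' := by
      by_contra hne
      rcases lt_or_gt_of_ne hne with hlt | hlt
      · nlinarith
      · nlinarith
    subst hm
    obtain rfl : b = b' := by linarith
    rfl

theorem two_mul_affLength (hn : 0 < n) {f : Equiv.Perm ℤ} (hf : IsAffinePerm n f) :
    2 * (affLength n f : ℤ) = ∑ x ∈ Finset.Icc (1 : ℤ) n, ∑ y ∈ Finset.Icc (1 : ℤ) n,
      classInv n f x y := by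
  have key : ∀ x y, classInv n f x y = (((f x - f y) / n - (x - y) / n).toNat : ℤ) +
      (((f y - f x) / n - (y - x) / n).toNat : ℤ) := fun x y => by
    rw [classInv_comm hn hf y x, classInv, abs_eq_max_neg]
    lia
  simp_rw [key, Finset.sum_add_distrib]
  rw [affLength_eq_sum hn hf, Finset.sum_product, two_mul]
  push_cast
  congr 1
  exact Finset.sum_comm

theorem exists_mem_Icc_modEq (hn : 0 < n) (a : ℤ) : ∃ b ∈ Finset.Icc (1 : ℤ) n, b ≡ a [ZMOD n] := by
  have hn' : (0 : ℤ) < n := by exact_mod_cast hn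
  refine ⟨(a - 1) % n + 1, ?_, ?_⟩
  · have e2 := Int.emod_nonneg (a - 1) hn'.ne'
    have e3 := Int.emod_lt_of_pos (a - 1) hn'
    rw [Finset.mem_Icc]
    lia
  · have := (Int.mod_modEq (a - 1) n).add_right 1
    simpa using this

theorem eq_of_mem_Icc_modEq {a b : ℤ} (ha : a ∈ Finset.Icc (1 : ℤ) n)
    (hb : b ∈ Finset.Icc (1 : ℤ) n) (h : a ≡ b [ZMOD n]) : a = b := by
  rw [Finset.mem_Icc] at ha hb
  obtain ⟨r, hr⟩ := h.dvd
  have : r = 0 := by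
    by_contra hne
    rcases lt_or_gt_of_ne hne with hlt | hlt <;> nlinarith
  subst this
  linarith

theorem affLength_split (hn : 0 < n) {a b : ℤ} (hab : ¬ a ≡ b [ZMOD n]) :
    ∃ s : Finset ℤ, (∀ x ∈ s, ¬ x ≡ a [ZMOD n] ∧ ¬ x ≡ b [ZMOD n]) ∧
      ∀ f : Equiv.Perm ℤ, IsAffinePerm n f → 2 * (affLength n f : ℤ) =
        ∑ x ∈ s, ∑ y ∈ s, classInv n f x y +
        2 * (∑ y ∈ s, (classInv n f a y + classInv n f b y) + classInv n f a b) := by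
  obtain ⟨a', ha', ea⟩ := exists_mem_Icc_modEq hn a
  obtain ⟨b', hb', eb⟩ := exists_mem_Icc_modEq hn b
  have hne : a' ≠ b' := fun h => hab (ea.symm.trans (h ▸ eb))
  set W := Finset.Icc (1 : ℤ) n with hW
  refine ⟨(W.erase a').erase b', fun x hx => ?_, fun f hf => ?_⟩
  · simp only [Finset.mem_erase] at hx
    exact ⟨fun h => hx.2.1 (eq_of_mem_Icc_modEq hx.2.2 ha' (h.trans ea.symm)),
      fun h => hx.1 (eq_of_mem_Icc_modEq hx.2.2 hb' (h.trans eb.symm))⟩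
  · have hb'' : b' ∈ W.erase a' := Finset.mem_erase.2 ⟨hne.symm, hb'⟩
    have hsplit : ∀ F : ℤ → ℤ, ∑ x ∈ W, F x = ∑ x ∈ (W.erase a').erase b', F x + F b' + F a' :=
      fun F => by
        rw [Finset.sum_erase_add _ _ hb'', Finset.sum_erase_add _ _ ha']
    have haa : ∀ x, classInv n f x x = 0 := fun x => by simp [classInv]
    rw [two_mul_affLength hn hf, ← hW]
    simp_rw [hsplit, Finset.sum_add_distrib, haa]
    have ca : ∀ y, classInv n f a' y = classInv n f a y := classInv_modEq hn hf ea
    have cb : ∀ y, classInv n f b' y = classInv n f b y := classInv_modEq hn hf eb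
    have ca' : ∀ y, classInv n f y a' = classInv n f a y := fun y => by
      rw [classInv_symm hn hf, ca]
    have cb' : ∀ y, classInv n f y b' = classInv n f b y := fun y => by
      rw [classInv_symm hn hf, cb]
    simp only [ca', cb', ca, cb]
    rw [classInv_symm hn hf b a]
    ring

/-- `g` arises from `f` by exchanging the values at the classes of `a` and `b`. -/
structure Swapped (n : ℕ) (f g : ℤ → ℤ) (a b : ℤ) : Prop where
  not_modEq : ¬ a ≡ b [ZMOD n]
  left : g a = f b
  right : g b = f a
  off : ∀ x, ¬ x ≡ a [ZMOD n] → ¬ x ≡ b [ZMOD n] → g x = f x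

theorem Swapped.affLength_lt (hn : 0 < n) {f g : Equiv.Perm ℤ} (hf : IsAffinePerm n f)
    (hg : IsAffinePerm n g) {a b : ℤ} (h : Swapped n f g a b) (hab : a < b) (hfab : f a < f b) :
    affLength n f < affLength n g := by
  have hn' : (0 : ℤ) < n := by exact_mod_cast hn
  obtain ⟨s, hs, hl⟩ := affLength_split hn h.not_modEq
  have h1 := hl f hf
  have h2 := hl g hg
  have e : ∑ x ∈ s, ∑ y ∈ s, classInv n g x y = ∑ x ∈ s, ∑ y ∈ s, classInv n f x y :=
    Finset.sum_congr rfl fun x hx => Finset.sum_congr rfl fun y hy => by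
      rw [classInv, classInv, h.off x (hs x hx).1 (hs x hx).2, h.off y (hs y hy).1 (hs y hy).2]
  have le : ∑ y ∈ s, (classInv n f a y + classInv n f b y) ≤
      ∑ y ∈ s, (classInv n g a y + classInv n g b y) := by
    refine Finset.sum_le_sum fun y hy => ?_
    simp only [classInv]
    rw [h.off y (hs y hy).1 (hs y hy).2, h.left, h.right]
    have i1 : (a - y) / (n : ℤ) ≤ (b - y) / n := Int.ediv_le_ediv hn' (by linarith)
    have i2 : (f a - f y) / (n : ℤ) ≤ (f b - f y) / n := Int.ediv_le_ediv hn' (by linarith)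
    generalize (a - y) / (n : ℤ) = p1 at *
    generalize (b - y) / (n : ℤ) = p2 at *
    generalize (f a - f y) / (n : ℤ) = q1 at *
    generalize (f b - f y) / (n : ℤ) = q2 at *
    clear * - i1 i2
    simp only [abs_eq_max_neg]
    lia
  have lt : classInv n f a b < classInv n g a b := by
    simp only [classInv]
    rw [h.left, h.right]
    have hd : ¬ (n : ℤ) ∣ b - a := fun hd => h.not_modEq (Int.modEq_iff_dvd.2 hd)
    have hd' : ¬ (n : ℤ) ∣ f b - f a := fun hd =>
      h.not_modEq (hf.modEq_iff.1 (Int.modEq_iff_dvd.2 hd))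
    rw [← neg_sub b a, ← neg_sub (f b) (f a), neg_ediv_of_not_dvd hn' hd,
      neg_ediv_of_not_dvd hn' hd']
    have i1 : 0 ≤ (b - a) / (n : ℤ) := Int.ediv_nonneg (by linarith) hn'.le
    have i2 : 0 ≤ (f b - f a) / (n : ℤ) := Int.ediv_nonneg (by linarith) hn'.le
    generalize (b - a) / (n : ℤ) = p1 at *
    generalize (f b - f a) / (n : ℤ) = q1 at *
    clear * - i1 i2
    simp only [abs_eq_max_neg]
    lia
  lia

theorem Swapped.affLength_eq (hn : 0 < n) {f g : Equiv.Perm ℤ} (hf : IsAffinePerm n f)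
    (hg : IsAffinePerm n g) {a b : ℤ} (h : Swapped n f g a b) (hab : a < b) (hfab : f a < f b)
    (hc : ∀ c, a < c → c < b → ¬ (f a < f c ∧ f c < f b)) :
    affLength n g = affLength n f + 1 := by
  have hn' : (0 : ℤ) < n := by exact_mod_cast hn
  obtain ⟨s, hs, hl⟩ := affLength_split hn h.not_modEq
  have h1 := hl f hf
  have h2 := hl g hg
  have e : ∑ x ∈ s, ∑ y ∈ s, classInv n g x y = ∑ x ∈ s, ∑ y ∈ s, classInv n f x y :=
    Finset.sum_congr rfl fun x hx => Finset.sum_congr rfl fun y hy => by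
      rw [classInv, classInv, h.off x (hs x hx).1 (hs x hx).2, h.off y (hs y hy).1 (hs y hy).2]
  have eq : ∑ y ∈ s, (classInv n g a y + classInv n g b y) =
      ∑ y ∈ s, (classInv n f a y + classInv n f b y) := by
    refine Finset.sum_congr rfl fun y hy => ?_
    simp only [classInv]
    rw [h.off y (hs y hy).1 (hs y hy).2, h.left, h.right]
    have i1 : (a - y) / (n : ℤ) ≤ (b - y) / n := Int.ediv_le_ediv hn' (by linarith)
    have i2 : (f a - f y) / (n : ℤ) ≤ (f b - f y) / n := Int.ediv_le_ediv hn' (by linarith)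
    have key : ∀ m : ℤ, (a - y) / (n : ℤ) < m → m ≤ (b - y) / n → (f a - f y) / (n : ℤ) < m →
        m ≤ (f b - f y) / n → False := by
      intro m k1 k2 k3 k4
      rw [Int.ediv_lt_iff_lt_mul hn'] at k1 k3
      rw [Int.le_ediv_iff_mul_le hn'] at k2 k4
      have hne : y + m * n ≠ b := fun hne => (hs y hy).2 (Int.modEq_iff_dvd.2 ⟨m, by
        rw [← hne]; ring⟩)
      have hne' : f (y + m * n) ≠ f b := fun h => hne (f.injective h)
      refine hc (y + m * n) (by linarith) (lt_of_le_of_ne (by linarith) hne) ⟨?_, ?_⟩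
      · rw [hf.add_mul]; linarith
      · exact lt_of_le_of_ne (by rw [hf.add_mul]; linarith) hne'
    generalize (a - y) / (n : ℤ) = p1 at *
    generalize (b - y) / (n : ℤ) = p2 at *
    generalize (f a - f y) / (n : ℤ) = q1 at *
    generalize (f b - f y) / (n : ℤ) = q2 at *
    have := key (max p1 q1 + 1)
    clear * - i1 i2 this
    simp only [abs_eq_max_neg]
    lia
  have eq' : classInv n g a b = classInv n f a b + 1 := by
    simp only [classInv]
    rw [h.left, h.right]
    have hd : ¬ (n : ℤ) ∣ b - a := fun hd => h.not_modEq (Int.modEq_iff_dvd.2 hd)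
    have hd' : ¬ (n : ℤ) ∣ f b - f a := fun hd =>
      h.not_modEq (hf.modEq_iff.1 (Int.modEq_iff_dvd.2 hd))
    rw [← neg_sub b a, ← neg_sub (f b) (f a), neg_ediv_of_not_dvd hn' hd,
      neg_ediv_of_not_dvd hn' hd']
    have i1 : 0 ≤ (b - a) / (n : ℤ) := Int.ediv_nonneg (by linarith) hn'.le
    have i2 : 0 ≤ (f b - f a) / (n : ℤ) := Int.ediv_nonneg (by linarith) hn'.le
    have key : ¬ (1 ≤ (b - a) / (n : ℤ) ∧ 1 ≤ (f b - f a) / (n : ℤ)) := by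
      rintro ⟨k1, k2⟩
      rw [Int.le_ediv_iff_mul_le hn'] at k1 k2
      have hne : a + n ≠ b := fun hne => hd ⟨1, by linarith⟩
      have hne' : f (a + n) ≠ f b := fun h => hne (f.injective h)
      refine hc (a + n) (by linarith) (lt_of_le_of_ne (by linarith) hne) ⟨?_, ?_⟩
      · rw [hf]; linarith
      · exact lt_of_le_of_ne (by rw [hf]; linarith) hne'
    generalize (b - a) / (n : ℤ) = p1 at *
    generalize (f b - f a) / (n : ℤ) = q1 at *
    clear * - i1 i2 key
    simp only [abs_eq_max_neg]
    lia
  lia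

end AffineLength

section Rank

variable {n : ℕ}

/-- A bounded affine permutation, of any ball number. -/
structure IsBounded (n : ℕ) (f : Equiv.Perm ℤ) : Prop where
  affine : IsAffinePerm n f
  le : ∀ i, i ≤ f i
  le' : ∀ i, f i ≤ i + n

/-- The number of `a ≤ x` with `f a ≥ y`, for bounded `f`. -/
noncomputable def rk (n : ℕ) (f : Equiv.Perm ℤ) (x y : ℤ) : ℤ :=
  (((Finset.Icc (y - n) x).filter fun a => y ≤ f a).card : ℤ)

variable {f g : Equiv.Perm ℤ}

theorem rk_eq_zero {x y : ℤ} (h : x + n < y) : rk n f x y = 0 := by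
  rw [rk, Finset.Icc_eq_empty (by lia)]
  simp

theorem IsBounded.rk_eq (hf : IsBounded n f) {x y m : ℤ} (h : m ≤ y - n) :
    rk n f x y = (((Finset.Icc m x).filter fun a => y ≤ f a).card : ℤ) := by
  rw [rk]
  congr 2
  ext a
  simp only [Finset.mem_filter, Finset.mem_Icc]
  have := hf.le' a
  constructor <;> rintro ⟨⟨h1, h2⟩, h3⟩ <;> exact ⟨⟨by lia, h2⟩, h3⟩

theorem IsBounded.rk_pred (hf : IsBounded n f) (x y : ℤ) :
    rk n f x y = rk n f (x - 1) y + if y ≤ f x then 1 else 0 := by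
  rcases lt_or_ge x (y - n) with h | h
  · have := hf.le' x
    rw [rk_eq_zero (by lia), rk_eq_zero (by lia), if_neg (by lia)]
    rfl
  · rw [rk, rk]
    have : Finset.Icc (y - n) x = insert x (Finset.Icc (y - n) (x - 1)) := by
      ext a
      simp only [Finset.mem_insert, Finset.mem_Icc]
      lia
    rw [this, Finset.filter_insert]
    split_ifs with h2
    · rw [Finset.card_insert_of_notMem (by simp)]
      push_cast
      ring
    · simp

theorem IsBounded.rk_succ_right (hf : IsBounded n f) (x y : ℤ) :
    rk n f x y = rk n f x (y + 1) + if f.symm y ≤ x then 1 else 0 := by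
  rw [rk, hf.rk_eq (m := y - n) (by lia)]
  have hs := hf.le' (f.symm y)
  rw [Equiv.apply_symm_apply] at hs
  split_ifs with h
  · have : (Finset.Icc (y - n) x).filter (fun a => y ≤ f a) =
        insert (f.symm y) ((Finset.Icc (y - n) x).filter fun a => y + 1 ≤ f a) := by
      ext a
      simp only [Finset.mem_insert, Finset.mem_filter, Finset.mem_Icc]
      constructor
      · rintro ⟨h1, h2⟩
        rcases h2.eq_or_lt with e | h2
        · left
          rw [e, Equiv.symm_apply_apply]
        · exact Or.inr ⟨h1, h2⟩
      · rintro (rfl | ⟨h1, h2⟩)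
        · exact ⟨⟨by lia, h⟩, by simp⟩
        · exact ⟨h1, by lia⟩
    rw [this, Finset.card_insert_of_notMem (by simp)]
    push_cast
    ring
  · rw [add_zero]
    congr 2
    ext a
    simp only [Finset.mem_filter, Finset.mem_Icc]
    constructor
    · rintro ⟨h1, h2⟩
      refine ⟨h1, ?_⟩
      rcases h2.eq_or_lt with e | h2
      · rw [e, Equiv.symm_apply_apply] at h
        exact absurd h1.2 h
      · exact h2
    · rintro ⟨h1, h2⟩
      exact ⟨h1, by lia⟩

theorem IsBounded.rk_add (hf : IsBounded n f) (x y r : ℤ) :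
    rk n f (x + r * n) (y + r * n) = rk n f x y := by
  rw [rk, rk]
  congr 1
  refine Finset.card_bij' (fun a _ => a - r * n) (fun a _ => a + r * n) ?_ ?_ ?_ ?_
  · intro a
    simp only [Finset.mem_filter, Finset.mem_Icc]
    rintro ⟨⟨h1, h2⟩, h3⟩
    refine ⟨⟨by linarith, by linarith⟩, ?_⟩
    have := hf.affine.add_mul (a - r * n) r
    rw [sub_add_cancel] at this
    linarith
  · intro a
    simp only [Finset.mem_filter, Finset.mem_Icc]
    rintro ⟨⟨h1, h2⟩, h3⟩
    refine ⟨⟨by linarith, by linarith⟩, ?_⟩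
    rw [hf.affine.add_mul]
    linarith
  · intros; simp
  · intros; simp

theorem IsBounded.rk_diag_pred (hf : IsBounded n f) (x : ℤ) :
    rk n f x (x + 1) = rk n f (x - 1) x := by
  rw [hf.rk_pred, hf.rk_succ_right (x - 1) x]
  congr 1
  have h1 := hf.le x
  have h2 := hf.le (f.symm x)
  rw [Equiv.apply_symm_apply] at h2
  by_cases h : f x = x
  · have h' : f.symm x = x := by rw [Equiv.symm_apply_eq, h]
    rw [h, h', if_neg (by lia), if_neg (by lia)]
  · have h' : f.symm x ≠ x := by
      rw [Ne, Equiv.symm_apply_eq]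
      exact fun e => h e.symm
    rw [if_pos (by lia), if_pos (by lia)]

theorem IsBounded.rk_diag (hf : IsBounded n f) (x : ℤ) :
    rk n f x (x + 1) = rk n f 0 1 := by
  induction x using Int.induction_on with
  | zero => rfl
  | succ i ih => rw [hf.rk_diag_pred, ← ih]; congr 1; ring
  | pred i ih =>
    rw [hf.rk_diag_pred] at ih
    rw [← ih]; congr 1; ring

theorem IsBounded.rk_of_le (hf : IsBounded n f) {x y : ℤ} (h : y ≤ x + 1) :
    rk n f x y = rk n f 0 1 + (x + 1 - y) := by
  obtain ⟨m, hm⟩ : ∃ m : ℕ, y = x + 1 - m := ⟨(x + 1 - y).toNat, by lia⟩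
  subst hm
  induction m with
  | zero => simpa using hf.rk_diag x
  | succ m ih =>
    rw [hf.rk_succ_right, show x + 1 - ((m + 1 : ℕ) : ℤ) + 1 = x + 1 - m by push_cast; ring,
      ih (by lia), if_pos]
    · push_cast; ring
    · have := hf.le (f.symm (x + 1 - ((m + 1 : ℕ) : ℤ)))
      rw [Equiv.apply_symm_apply] at this
      push_cast at this ⊢
      lia

theorem IsBounded.sum_sub_eq (hf : IsBounded n f) :
    ∑ i ∈ Finset.Icc (1 : ℤ) n, (f i - i) = n * rk n f 0 1 := by
  rcases Nat.eq_zero_or_pos n with rfl | hn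
  · simp
  have hn' : (0 : ℤ) < n := by exact_mod_cast hn
  set φ : ℤ → ℤ := fun x => ∑ y ∈ Finset.Icc (x + 1) (x + n), rk n f x y with hφ
  have split : ∀ x, φ x = φ (x - 1) - rk n f 0 1 + (f x - x) := by
    intro x
    have e1 : φ (x - 1) = rk n f 0 1 + ∑ y ∈ Finset.Icc (x + 1) (x + n - 1), rk n f (x - 1) y := by
      have : Finset.Icc (x - 1 + 1) (x - 1 + n) = insert x (Finset.Icc (x + 1) (x + n - 1)) := by
        ext a
        simp only [Finset.mem_insert, Finset.mem_Icc]
        lia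
      rw [hφ]
      simp only
      rw [this, Finset.sum_insert (by simp), ← hf.rk_diag (x - 1), sub_add_cancel]
    have e2 : φ x = ∑ y ∈ Finset.Icc (x + 1) (x + n - 1), rk n f (x - 1) y + (f x - x) := by
      rw [hφ]
      simp only
      simp_rw [hf.rk_pred x, Finset.sum_add_distrib]
      congr 1
      · have : Finset.Icc (x + 1) (x + n) = insert (x + n) (Finset.Icc (x + 1) (x + n - 1)) := by
          ext a
          simp only [Finset.mem_insert, Finset.mem_Icc]
          lia
        rw [this, Finset.sum_insert (by simp), rk_eq_zero (by lia), zero_add]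
      · rw [Finset.sum_boole]
        have : (Finset.Icc (x + 1) (x + n)).filter (fun y => y ≤ f x) = Finset.Icc (x + 1) (f x) := by
          ext a
          have := hf.le' x
          simp only [Finset.mem_filter, Finset.mem_Icc]
          lia
        rw [this, Int.card_Icc]
        have := hf.le x
        lia
    lia
  have tele : ∀ m : ℕ, ∑ i ∈ Finset.Icc (1 : ℤ) m, (f i - i) = φ m - φ 0 + m * rk n f 0 1 := by
    intro m
    induction m with
    | zero => simp
    | succ m ih =>
      have : Finset.Icc (1 : ℤ) ((m + 1 : ℕ) : ℤ) = insert ((m : ℤ) + 1) (Finset.Icc (1 : ℤ) m) := by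
        ext a
        simp only [Finset.mem_insert, Finset.mem_Icc]
        lia
      have s := split (m + 1)
      rw [add_sub_cancel_right] at s
      rw [this, Finset.sum_insert (by simp), ih]
      push_cast
      rw [s]
      ring
  have per : φ n = φ 0 := by
    rw [hφ]
    simp only
    refine Finset.sum_bij' (fun a _ => a - n) (fun a _ => a + n) ?_ ?_ ?_ ?_ ?_
    · intro a; simp only [Finset.mem_Icc]; lia
    · intro a; simp only [Finset.mem_Icc]; lia
    · intros; simp
    · intros; simp
    · intro a _
      have := hf.rk_add 0 (a - n) 1
      simpa using this
  rw [tele n, per]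
  ring

theorem IsBounded.ballNumber_eq (hn : 0 < n) (hf : IsBounded n f) :
    ballNumber n f = (rk n f 0 1 : ℤ) := by
  have h := hf.sum_sub_eq
  have hn' : (n : ℚ) ≠ 0 := by exact_mod_cast hn.ne'
  have h' : ∑ i ∈ Finset.Icc (1 : ℤ) n, ((f i : ℚ) - (i : ℚ)) = n * (rk n f 0 1 : ℤ) := by
    exact_mod_cast h
  rw [ballNumber, h']
  field_simp

/-- The set of `(x, y)` at which exchanging the values at `a` and `b` increases the rank. -/
def InRegion (n : ℕ) (f : ℤ → ℤ) (a b x y : ℤ) : Prop :=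
  ∃ r : ℤ, a + r * n ≤ x ∧ x < b + r * n ∧ f a + r * n < y ∧ y ≤ f b + r * n

theorem modEq_iff_exists {a x : ℤ} : x ≡ a [ZMOD n] ↔ ∃ r : ℤ, x = a + r * n := by
  rw [Int.modEq_comm, Int.modEq_iff_dvd]
  constructor
  · rintro ⟨r, hr⟩; exact ⟨r, by linarith⟩
  · rintro ⟨r, rfl⟩; exact ⟨r, by ring⟩

theorem mul_lt_of_lt_add {b a r s m : ℤ} (hm : 0 ≤ m) (hba : b ≤ a + m)
    (h : a + r * m < b + s * m) : r ≤ s := by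
  by_contra hlt
  nlinarith

open Classical in
theorem IsBounded.rk_swapped (hf : IsBounded n f) (hg : IsBounded n g) {a b : ℤ}
    (h : Swapped n f g a b) (hab : a < b) (hfab : f a < f b) (x y : ℤ) :
    rk n g x y = rk n f x y + if InRegion n f a b x y then 1 else 0 := by
  have hb : b < a + n := by
    have h1 := hg.le b
    have h2 := hg.le' a
    rw [h.right] at h1
    rw [h.left] at h2
    lia
  have hn' : (0 : ℤ) ≤ n := by positivity
  have base : ∀ x, x + n < y →
      rk n g x y = rk n f x y + if InRegion n f a b x y then 1 else 0 := by
    intro x hx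
    rw [rk_eq_zero hx, rk_eq_zero hx, if_neg]
    · rfl
    · rintro ⟨r, h1, h2, h3, h4⟩
      have h2 := hg.le' a
      rw [h.left] at h2
      lia
  suffices H : ∀ m : ℕ, rk n g (y - n - 1 + m) y = rk n f (y - n - 1 + m) y +
      if InRegion n f a b (y - n - 1 + m) y then 1 else 0 by
    rcases lt_or_ge (x + n) y with hx | hx
    · exact base x hx
    · have := H (x - (y - n - 1)).toNat
      rwa [show y - n - 1 + ((x - (y - n - 1)).toNat : ℤ) = x by lia] at this
  intro m
  induction m with
  | zero => exact base _ (by push_cast; lia)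
  | succ m ih =>
    obtain ⟨x, hx⟩ : ∃ x, x = y - n - 1 + ((m + 1 : ℕ) : ℤ) := ⟨_, rfl⟩
    rw [show y - n - 1 + (m : ℤ) = x - 1 by rw [hx]; push_cast; ring] at ih
    rw [← hx, hg.rk_pred, hf.rk_pred, ih]
    suffices hs : ((if InRegion n f a b (x - 1) y then 1 else 0 : ℤ) + if y ≤ g x then 1 else 0) =
        (if y ≤ f x then 1 else 0) + if InRegion n f a b x y then 1 else 0 by linarith
    by_cases ha : x ≡ a [ZMOD n]
    · obtain ⟨r, rfl⟩ := modEq_iff_exists.1 ha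
      have hno : ¬ InRegion n f a b (a + r * n - 1) y := by
        rintro ⟨s, h1, h2, h3, h4⟩
        have := mul_lt_of_lt_add (r := s) (s := r) (a := a) (b := a) hn' (by lia) (by lia)
        have := mul_lt_of_lt_add (r := r) (s := s) (a := a) (b := b + 1) hn' (by lia) (by lia)
        obtain rfl : r = s := by lia
        lia
      have hyes : InRegion n f a b (a + r * n) y ↔ f a + r * n < y ∧ y ≤ f b + r * n := by
        constructor
        · rintro ⟨s, h1, h2, h3, h4⟩
          have := mul_lt_of_lt_add (r := s) (s := r) (a := a) (b := a + 1) hn' (by lia) (by lia)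
          have := mul_lt_of_lt_add (r := r) (s := s) (a := a) (b := b) hn' (by lia) (by lia)
          obtain rfl : r = s := by lia
          exact ⟨h3, h4⟩
        · rintro ⟨h1, h2⟩
          exact ⟨r, le_rfl, by lia, h1, h2⟩
      rw [if_neg hno, if_congr hyes rfl rfl, hg.affine.add_mul, hf.affine.add_mul, h.left]
      clear * - hfab
      split_ifs <;> lia
    · by_cases hb' : x ≡ b [ZMOD n]
      · obtain ⟨r, rfl⟩ := modEq_iff_exists.1 hb'
        have hno : ¬ InRegion n f a b (b + r * n) y := by
          rintro ⟨s, h1, h2, h3, h4⟩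
          have := mul_lt_of_lt_add (r := r) (s := s) (a := b) (b := b) hn' (by lia) (by lia)
          have := mul_lt_of_lt_add (r := s) (s := r) (a := a) (b := b + 1) hn' (by lia) (by lia)
          obtain rfl : r = s := by lia
          lia
        have hyes : InRegion n f a b (b + r * n - 1) y ↔ f a + r * n < y ∧ y ≤ f b + r * n := by
          constructor
          · rintro ⟨s, h1, h2, h3, h4⟩
            have := mul_lt_of_lt_add (r := s) (s := r) (a := a) (b := b) hn' (by lia) (by lia)
            have := mul_lt_of_lt_add (r := r) (s := s) (a := b) (b := b + 1) hn' (by lia) (by lia)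
            obtain rfl : r = s := by lia
            exact ⟨h3, h4⟩
          · rintro ⟨h1, h2⟩
            exact ⟨r, by lia, by lia, h1, h2⟩
        rw [if_neg hno, if_congr hyes rfl rfl, hg.affine.add_mul, hf.affine.add_mul, h.right]
        clear * - hfab
        split_ifs <;> lia
      · have hiff : InRegion n f a b (x - 1) y ↔ InRegion n f a b x y := by
          constructor
          · rintro ⟨r, h1, h2, h3, h4⟩
            refine ⟨r, by lia, lt_of_le_of_ne (by lia) fun e => hb' (modEq_iff_exists.2 ⟨r, e⟩),
              h3, h4⟩
          · rintro ⟨r, h1, h2, h3, h4⟩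
            have : a + r * n ≠ x := fun e => ha (modEq_iff_exists.2 ⟨r, e.symm⟩)
            refine ⟨r, by lia, by lia, h3, h4⟩
        rw [if_congr hiff rfl rfl, h.off x ha hb', add_comm]

/-- The affine transposition of the classes of `a` and `b`. -/
noncomputable def affineSwap (n : ℕ) (a b : ℤ) (h : ¬ a ≡ b [ZMOD n]) : Equiv.Perm ℤ := by
  classical
  refine Function.Involutive.toPerm (fun x => if x ≡ a [ZMOD n] then x + (b - a) else
    if x ≡ b [ZMOD n] then x + (a - b) else x) fun x => ?_
  by_cases h1 : x ≡ a [ZMOD n]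
  · have h2 : x + (b - a) ≡ b [ZMOD n] := by simpa using h1.add_right (b - a)
    have h3 : ¬ x + (b - a) ≡ a [ZMOD n] := fun h3 => h (h3.symm.trans h2)
    simp only [h1, h2, h3, if_true, if_false]
    ring
  · by_cases h2 : x ≡ b [ZMOD n]
    · have h3 : x + (a - b) ≡ a [ZMOD n] := by simpa using h2.add_right (a - b)
      simp only [h1, h2, h3, if_true, if_false]
      ring
    · simp only [h1, h2, if_false]

theorem affineSwap_spec {a b : ℤ} (h : ¬ a ≡ b [ZMOD n]) :
    (∀ r : ℤ, affineSwap n a b h (a + r * n) = b + r * n ∧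
      affineSwap n a b h (b + r * n) = a + r * n) ∧
    ∀ m : ℤ, ¬ m ≡ a [ZMOD n] → ¬ m ≡ b [ZMOD n] → affineSwap n a b h m = m := by
  have e : ∀ x, affineSwap n a b h x = if x ≡ a [ZMOD n] then x + (b - a) else
    if x ≡ b [ZMOD n] then x + (a - b) else x := fun x => by
      simp only [affineSwap]
      rfl
  refine ⟨fun r => ⟨?_, ?_⟩, fun m h1 h2 => ?_⟩
  · rw [e, if_pos (modEq_iff_exists.2 ⟨r, rfl⟩)]
    ring
  · rw [e, if_neg, if_pos (modEq_iff_exists.2 ⟨r, rfl⟩)]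
    · ring
    · exact fun h' => h (h'.symm.trans (modEq_iff_exists.2 ⟨r, rfl⟩))
  · rw [e, if_neg h1, if_neg h2]

end Rank

section BoundSteps

variable {k n : ℕ}

instance : CoeFun (Bound k n) fun _ => ℤ → ℤ := ⟨fun f => f.toPerm⟩

namespace Bound

theorem isBounded (f : Bound k n) : IsBounded n f.toPerm :=
  ⟨f.affine, fun i => (f.bounded i).1, fun i => (f.bounded i).2⟩

theorem rk_zero_one (hn : 0 < n) (f : Bound k n) : rk n f.toPerm 0 1 = k := by
  have := f.isBounded.ballNumber_eq hn
  rw [f.ball] at this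
  exact_mod_cast this.symm

/-- A bounded affine permutation as an element of `Bound k n`. -/
def ofIsBounded (hn : 0 < n) (f : Equiv.Perm ℤ) (hf : IsBounded n f) (h : rk n f 0 1 = k) : Bound k n :=
  ⟨f, hf.affine, by rw [hf.ballNumber_eq hn, h]; simp, fun i => ⟨hf.le i, hf.le' i⟩⟩

theorem ext_fun {f g : Bound k n} (h : ∀ x, f x = g x) : f = g :=
  Bound.ext (Equiv.ext h)

theorem add_mul (f : Bound k n) (x r : ℤ) : f (x + r * n) = f x + r * n :=
  f.affine.add_mul x r

theorem le_apply (f : Bound k n) (x : ℤ) : x ≤ f x := (f.bounded x).1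

theorem apply_le (f : Bound k n) (x : ℤ) : f x ≤ x + n := (f.bounded x).2

theorem inj (f : Bound k n) {x y : ℤ} : f x = f y ↔ x = y := f.toPerm.injective.eq_iff

variable {f g h f1 g1 : Bound k n} {a b x y : ℤ}

/-- The difference of the ranks of two elements. -/
noncomputable def gap (f g : Bound k n) (x y : ℤ) : ℤ := rk n g.toPerm x y - rk n f.toPerm x y

/-- Comparison of ranks. -/
def RankLE (f g : Bound k n) : Prop := ∀ x y, 0 ≤ gap f g x y

theorem gap_pred (f g : Bound k n) (x y : ℤ) : gap f g x y = gap f g (x - 1) y +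
    (if y ≤ g x then 1 else 0) - (if y ≤ f x then 1 else 0) := by
  rw [gap, gap, f.isBounded.rk_pred x y, g.isBounded.rk_pred x y]
  ring

theorem gap_succ_right (f g : Bound k n) (x y : ℤ) : gap f g x y = gap f g x (y + 1) +
    (if g.toPerm.symm y ≤ x then 1 else 0) - (if f.toPerm.symm y ≤ x then 1 else 0) := by
  rw [gap, gap, f.isBounded.rk_succ_right x y, g.isBounded.rk_succ_right x y]
  ring

theorem gap_eq_zero_of_le (hn : 0 < n) (f g : Bound k n) (h : y ≤ x + 1) : gap f g x y = 0 := by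
  rw [gap, f.isBounded.rk_of_le h, g.isBounded.rk_of_le h, f.rk_zero_one hn, g.rk_zero_one hn]
  ring

theorem gap_eq_zero_of_lt (f g : Bound k n) (h : x + n < y) : gap f g x y = 0 := by
  rw [gap, rk_eq_zero h, rk_eq_zero h, sub_self]

theorem gap_add (f g : Bound k n) (x y r : ℤ) : gap f g (x + r * n) (y + r * n) = gap f g x y := by
  rw [gap, gap, f.isBounded.rk_add, g.isBounded.rk_add]

theorem gap_add_gap (f g h : Bound k n) (x y : ℤ) : gap f g x y + gap g h x y = gap f h x y := by
  simp only [gap]; ring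

theorem gap_same (h : f x = g x) : gap f g x (f x) = gap f g x (f x + 1) ∧
    gap f g (x - 1) (f x) = gap f g x (f x + 1) := by
  have h1 := gap_succ_right f g x (f x)
  have h2 := gap_pred f g x (f x)
  have e : g.toPerm.symm (f x) = x := by rw [h, Equiv.symm_apply_apply]
  rw [e, Equiv.symm_apply_apply] at h1
  rw [← h] at h2
  lia

theorem RankLE.refl (f : Bound k n) : RankLE f f := fun x y => by simp [gap]

theorem RankLE.trans (h1 : RankLE f g) (h2 : RankLE g h) : RankLE f h := fun x y => by
  rw [← gap_add_gap f g h]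
  exact add_nonneg (h1 x y) (h2 x y)

theorem swapped_bounds (s : Swapped n f g a b) (hv : f a < f b) :
    b ≤ f a ∧ f b ≤ a + n ∧ b < a + n := by
  have h1 := g.le_apply b
  have h2 := g.apply_le a
  rw [s.right] at h1
  rw [s.left] at h2
  lia

theorem _root_.Positroid.Swapped.symm {f g : ℤ → ℤ} (h : Swapped n f g a b) : Swapped n g f a b :=
  ⟨h.not_modEq, h.right.symm, h.left.symm, fun x h1 h2 => (h.off x h1 h2).symm⟩

theorem exists_swapped (hn : 0 < n) (f : Bound k n) (hm : ¬ a ≡ b [ZMOD n]) (hab : a < b)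
    (h1 : b ≤ f a) (h3 : f b ≤ a + n) : ∃ g : Bound k n, Swapped n f g a b := by
  obtain ⟨t1, t2⟩ := affineSwap_spec hm
  set t := affineSwap n a b hm with ht
  have sw : Swapped n f ⇑(f.toPerm * t) a b := by
    have := t1 0
    simp only [zero_mul, add_zero] at this
    exact ⟨hm, by rw [Equiv.Perm.mul_apply, this.1], by rw [Equiv.Perm.mul_apply, this.2],
      fun x hx hx' => by rw [Equiv.Perm.mul_apply, t2 x hx hx']⟩
  have aff : IsAffinePerm n (f.toPerm * t) := by
    intro x
    rw [Equiv.Perm.mul_apply, Equiv.Perm.mul_apply, ← f.affine]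
    congr 1
    by_cases ha : x ≡ a [ZMOD n]
    · obtain ⟨r, rfl⟩ := modEq_iff_exists.1 ha
      rw [show a + r * n + n = a + (r + 1) * n by ring, (t1 _).1, (t1 _).1]
      ring
    · by_cases hb : x ≡ b [ZMOD n]
      · obtain ⟨r, rfl⟩ := modEq_iff_exists.1 hb
        rw [show b + r * n + n = b + (r + 1) * n by ring, (t1 _).2, (t1 _).2]
        ring
      · rw [t2 x ha hb, t2]
        · exact fun h => ha (by simpa using h)
        · exact fun h => hb (by simpa using h)
  have h2 := f.le_apply b
  have h4 := f.apply_le a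
  have bd : IsBounded n (f.toPerm * t) := by
    have key : ∀ x, x ≤ (f.toPerm * t) x ∧ (f.toPerm * t) x ≤ x + n := by
      intro x
      by_cases ha : x ≡ a [ZMOD n]
      · obtain ⟨r, rfl⟩ := modEq_iff_exists.1 ha
        rw [aff.add_mul, sw.left]
        lia
      · by_cases hb : x ≡ b [ZMOD n]
        · obtain ⟨r, rfl⟩ := modEq_iff_exists.1 hb
          rw [aff.add_mul, sw.right]
          lia
        · rw [sw.off x ha hb]
          exact f.bounded x
    exact ⟨aff, fun x => (key x).1, fun x => (key x).2⟩
  refine ⟨ofIsBounded hn _ bd ?_, sw⟩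
  have h0 := bd.rk_diag (b - 1)
  have h0' := f.isBounded.rk_diag (b - 1)
  rw [f.rk_zero_one hn] at h0'
  rcases lt_or_ge (f a) (f b) with hlt | hge
  · rw [f.isBounded.rk_swapped bd sw hab hlt, h0', if_neg, add_zero] at h0
    · exact h0.symm
    · rintro ⟨r, e1, e2, e3, e4⟩
      lia
  · have hlt : f b < f a := lt_of_le_of_ne hge fun e => hab.ne' (f.inj.1 e)
    rw [bd.rk_swapped f.isBounded sw.symm hab (by rw [sw.left, sw.right]; exact hlt), h0,
      if_neg, add_zero] at h0'
    · exact h0'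
    · rintro ⟨r, e1, e2, e3, e4⟩
      rw [sw.left] at e3
      lia

theorem not_modEq_of_bounds (f : Bound k n) (h2 : f a < f b) (h3 : f b < f a + n) :
    ¬ a ≡ b [ZMOD n] := by
  intro hm
  obtain ⟨r, rfl⟩ := modEq_iff_exists.1 hm.symm
  rw [f.add_mul] at h2 h3
  have : 0 < r := by
    by_contra hr
    nlinarith
  nlinarith

theorem swapped_unique (h1 : Swapped n f g a b) (h2 : Swapped n f g1 a b) : g = g1 := by
  refine ext_fun fun x => ?_
  by_cases ha : x ≡ a [ZMOD n]
  · obtain ⟨r, rfl⟩ := modEq_iff_exists.1 ha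
    rw [g.add_mul, g1.add_mul, h1.left, h2.left]
  · by_cases hb : x ≡ b [ZMOD n]
    · obtain ⟨r, rfl⟩ := modEq_iff_exists.1 hb
      rw [g.add_mul, g1.add_mul, h1.right, h2.right]
    · rw [h1.off x ha hb, h2.off x ha hb]

theorem _root_.Positroid.Swapped.comm {f g : ℤ → ℤ} (h : Swapped n f g a b) : Swapped n f g b a :=
  ⟨fun e => h.not_modEq e.symm, h.right, h.left, fun x h1 h2 => h.off x h2 h1⟩

/-- A cover `f ⋖ g` which exchanges the values at `a < b`. -/
structure Step (f g : Bound k n) (a b : ℤ) : Prop where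
  lt : a < b
  val : f a < f b
  none : ∀ c, a < c → c < b → ¬ (f a < f c ∧ f c < f b)
  swap : Swapped n f g a b

theorem Step.lt_add (s : Step f g a b) : b < a + n := (swapped_bounds s.swap s.val).2.2

theorem Step.translate (s : Step f g a b) (r : ℤ) : Step f g (a + r * n) (b + r * n) := by
  have e1 : a + r * n ≡ a [ZMOD n] := modEq_iff_exists.2 ⟨r, rfl⟩
  have e2 : b + r * n ≡ b [ZMOD n] := modEq_iff_exists.2 ⟨r, rfl⟩
  refine ⟨by linarith [s.lt], ?_, fun c h1 h2 h3 => ?_, ?_, ?_, ?_, ?_⟩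
  · rw [f.add_mul, f.add_mul]
    linarith [s.val]
  · have := f.add_mul (c - r * n) r
    rw [sub_add_cancel] at this
    rw [f.add_mul, f.add_mul, this] at h3
    exact s.none (c - r * n) (by linarith) (by linarith) ⟨by linarith, by linarith⟩
  · exact fun h => s.swap.not_modEq (e1.symm.trans (h.trans e2))
  · rw [f.add_mul, g.add_mul, s.swap.left]
  · rw [f.add_mul, g.add_mul, s.swap.right]
  · exact fun x h1 h2 => s.swap.off x (fun h => h1 (h.trans e1.symm)) fun h => h2 (h.trans e2.symm)

/-- A step can be translated so that its left position is any given position of the same class. -/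
theorem Step.exists_left (s : Step f g a b) {p : ℤ} (h : a ≡ p [ZMOD n]) :
    ∃ r, a + r * n = p ∧ Step f g p (b + r * n) := by
  obtain ⟨r, rfl⟩ := modEq_iff_exists.1 h.symm
  exact ⟨r, rfl, s.translate r⟩

theorem Step.exists_right (s : Step f g a b) {p : ℤ} (h : b ≡ p [ZMOD n]) :
    ∃ r, b + r * n = p ∧ Step f g (a + r * n) p := by
  obtain ⟨r, rfl⟩ := modEq_iff_exists.1 h.symm
  exact ⟨r, rfl, s.translate r⟩

open Classical in
theorem gap_swapped (s : Swapped n f g a b) (hab : a < b) (hv : f a < f b) (x y : ℤ) :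
    gap f g x y = if InRegion n f a b x y then 1 else 0 := by
  rw [gap, f.isBounded.rk_swapped g.isBounded s hab hv]
  ring

theorem Step.rankLE (s : Step f g a b) : RankLE f g := fun x y => by
  rw [gap_swapped s.swap s.lt s.val]
  split_ifs <;> simp

theorem Step.gap_eq_one (s : Step f g a b) {x y : ℤ} (h1 : a ≤ x) (h2 : x < b) (h3 : f a < y)
    (h4 : y ≤ f b) : gap f g x y = 1 := by
  rw [gap_swapped s.swap s.lt s.val, if_pos ⟨0, by lia, by lia, by lia, by lia⟩]

/-- Integers strictly between `a` and `a + n` are not congruent to `a`. -/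
theorem _root_.Positroid.not_modEq_of_lt {c : ℤ} (h1 : a < c) (h2 : c < a + n) : ¬ c ≡ a [ZMOD n] := by
  intro h
  obtain ⟨r, rfl⟩ := modEq_iff_exists.1 h
  have : 0 < r := by
    by_contra hr
    nlinarith
  nlinarith

theorem Step.off_between (s : Step f g a b) {c : ℤ} (h1 : a < c) (h2 : c < b) : g c = f c := by
  have := s.lt_add
  exact s.swap.off c (not_modEq_of_lt h1 (by lia)) fun h =>
    not_modEq_of_lt h2 (by lia) h.symm

theorem exists_up (hn : 0 < n) (H : RankLE f g) {p v : ℤ} (hv : f p < v)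
    (h1 : ∀ y, f p < y → y ≤ v → 1 ≤ gap f g p y) (h2 : gap f g p (v + 1) = 0) :
    ∃ (b : ℤ) (f1 : Bound k n), f b ≤ v ∧ (∀ c, p < c → c < b → ¬ (f p < f c ∧ f c ≤ v)) ∧
      Step f f1 p b ∧ RankLE f1 g := by
  have ex : p < f.toPerm.symm v := by
    have := h1 v hv le_rfl
    have e := gap_succ_right f g p v
    by_contra hle
    rw [if_pos (not_lt.1 hle)] at e
    split_ifs at e <;> lia
  obtain ⟨b, ⟨hb, hb1, hb2⟩, hmin⟩ := Int.exists_least_of_bdd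
    (P := fun b => p < b ∧ f p < f b ∧ f b ≤ v) ⟨p, fun z hz => hz.1.le⟩
    ⟨f.toPerm.symm v, ex, by rw [Equiv.apply_symm_apply]; exact hv,
      by rw [Equiv.apply_symm_apply]⟩
  have hno : ∀ c, p < c → c < b → ¬ (f p < f c ∧ f c ≤ v) := fun c hc hc' h =>
    absurd (hmin c ⟨hc, h⟩) (not_le.2 hc')
  have reg : ∀ m : ℕ, p + m < b → ∀ y, f p < y → y ≤ v →
      gap f g (p + m) (v + 1) + 1 ≤ gap f g (p + m) y := by
    intro m
    induction m with
    | zero =>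
      intro _ y hy hy'
      have := h1 y hy hy'
      simp only [Nat.cast_zero, add_zero]
      lia
    | succ m ih =>
      intro hm y hy hy'
      have i := ih (by push_cast at hm; lia) y hy hy'
      have e1 := gap_pred f g (p + (m + 1 : ℕ)) y
      have e2 := gap_pred f g (p + (m + 1 : ℕ)) (v + 1)
      rw [show p + ((m + 1 : ℕ) : ℤ) - 1 = p + m by push_cast; ring] at e1 e2
      have hc := hno (p + (m + 1 : ℕ)) (by push_cast; lia) hm
      rw [e1, e2]
      clear e1 e2 ih
      split_ifs <;> lia
  have reg' : ∀ x y, p ≤ x → x < b → f p < y → y ≤ v → 1 ≤ gap f g x y := by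
    intro x y hx hx' hy hy'
    have := reg (x - p).toNat (by lia) y hy hy'
    rw [show p + ((x - p).toNat : ℤ) = x by lia] at this
    have := H x (v + 1)
    lia
  have hbp : b ≤ f p := by
    by_contra hlt
    have := reg' (b - 1) (f p + 1) (by lia) (by lia) (by lia) (by lia)
    rw [gap_eq_zero_of_le hn _ _ (by lia)] at this
    lia
  have hbn : f b ≤ p + n := by
    by_contra hlt
    have := reg' p (f b) le_rfl hb hb1 hb2
    rw [gap_eq_zero_of_lt _ _ (by lia)] at this
    lia
  obtain ⟨f1, hf1⟩ := exists_swapped hn f (not_modEq_of_bounds f hb1 (by lia)) hb hbp hbn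
  refine ⟨b, f1, hb2, hno, ⟨hb, hb1, fun c hc hc' h => hno c hc hc' ⟨h.1, by lia⟩, hf1⟩, ?_⟩
  intro x y
  have e := gap_add_gap f f1 g x y
  rw [gap_swapped hf1 hb hb1] at e
  split_ifs at e with hr
  · obtain ⟨r, r1, r2, r3, r4⟩ := hr
    have := reg' (x - r * n) (y - r * n) (by lia) (by lia) (by lia) (by lia)
    rw [← gap_add f g _ _ r, sub_add_cancel, sub_add_cancel] at this
    lia
  · have := H x y
    lia

theorem exists_down (hn : 0 < n) (H : RankLE f g) {p v : ℤ} (hv : g p < v)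
    (h1 : ∀ y, g p < y → y ≤ v → 1 ≤ gap f g (p - 1) y) (h2 : gap f g (p - 1) (v + 1) = 0) :
    ∃ (a : ℤ) (g1 : Bound k n), g a ≤ v ∧ (∀ c, a < c → c < p → ¬ (g p < g c ∧ g c ≤ v)) ∧
      Step g1 g a p ∧ RankLE f g1 := by
  have ex : g.toPerm.symm v < p := by
    have := h1 v hv le_rfl
    have e := gap_succ_right f g (p - 1) v
    by_contra hle
    rw [if_neg (show ¬ g.toPerm.symm v ≤ p - 1 by lia)] at e
    split_ifs at e <;> lia
  obtain ⟨a, ⟨ha, ha1, ha2⟩, hmax⟩ := Int.exists_greatest_of_bdd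
    (P := fun a => a < p ∧ g p < g a ∧ g a ≤ v) ⟨p, fun z hz => hz.1.le⟩
    ⟨g.toPerm.symm v, ex, by rw [Equiv.apply_symm_apply]; exact hv,
      by rw [Equiv.apply_symm_apply]⟩
  have hno : ∀ c, a < c → c < p → ¬ (g p < g c ∧ g c ≤ v) := fun c hc hc' h =>
    absurd (hmax c ⟨hc', h⟩) (not_le.2 hc)
  have reg : ∀ m : ℕ, a ≤ p - 1 - m → ∀ y, g p < y → y ≤ v →
      gap f g (p - 1 - m) (v + 1) + 1 ≤ gap f g (p - 1 - m) y := by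
    intro m
    induction m with
    | zero =>
      intro _ y hy hy'
      have := h1 y hy hy'
      simp only [Nat.cast_zero, sub_zero]
      lia
    | succ m ih =>
      intro hm y hy hy'
      have i := ih (by push_cast at hm; lia) y hy hy'
      have e1 := gap_pred f g (p - 1 - m) y
      have e2 := gap_pred f g (p - 1 - m) (v + 1)
      rw [show p - 1 - (m : ℤ) - 1 = p - 1 - ((m + 1 : ℕ) : ℤ) by push_cast; ring] at e1 e2
      have hc := hno (p - 1 - m) (by push_cast at hm; lia) (by lia)
      rw [e1, e2] at i
      clear e1 e2 ih
      split_ifs at i <;> lia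
  have reg' : ∀ x y, a ≤ x → x < p → g p < y → y ≤ v → 1 ≤ gap f g x y := by
    intro x y hx hx' hy hy'
    have := reg (p - 1 - x).toNat (by lia) y hy hy'
    rw [show p - 1 - ((p - 1 - x).toNat : ℤ) = x by lia] at this
    have := H x (v + 1)
    lia
  have hbp : p ≤ g p := g.le_apply p
  have hbn : g a ≤ a + n := g.apply_le a
  have hm : ¬ a ≡ p [ZMOD n] := fun h => not_modEq_of_bounds g ha1 (by lia) h.symm
  obtain ⟨g1, hg1⟩ := exists_swapped hn g hm ha (by lia) (by lia)
  have hval : g1 a < g1 p := by rw [hg1.left, hg1.right]; exact ha1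
  have hst : Step g1 g a p := by
    refine ⟨ha, hval, fun c hc hc' h => ?_, hg1.symm⟩
    have e : g1 c = g c := hg1.off c (not_modEq_of_lt hc (by lia)) fun h =>
      not_modEq_of_lt hc' (by lia) h.symm
    rw [hg1.left, hg1.right, e] at h
    exact hno c hc hc' ⟨h.1, by lia⟩
  refine ⟨a, g1, ha2, hno, hst, fun x y => ?_⟩
  have e := gap_add_gap f g1 g x y
  rw [gap_swapped hg1.symm ha hval] at e
  split_ifs at e with hr
  · obtain ⟨r, r1, r2, r3, r4⟩ := hr
    rw [hg1.left] at r3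
    rw [hg1.right] at r4
    have := reg' (x - r * n) (y - r * n) (by lia) (by lia) (by lia) (by lia)
    rw [← gap_add f g _ _ r, sub_add_cancel, sub_add_cancel] at this
    lia
  · have := H x y
    lia

end Bound

end BoundSteps

section Rising

variable {k n : ℕ}

/-- A priority function: a bijection from the classes modulo `n` to `{0, …, n - 1}`. -/
structure IsPriority (n : ℕ) (pri : ℤ → ℤ) : Prop where
  nonneg : ∀ x, 0 ≤ pri x
  lt : ∀ x, pri x < n
  eq_iff : ∀ x y, pri x = pri y ↔ x ≡ y [ZMOD n]
  surj : ∀ l : ℤ, 0 ≤ l → l < n → ∃ p, pri p = l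

/-- The label of the exchange of positions `a < b`. -/
noncomputable def key (n : ℕ) (pri : ℤ → ℤ) (a b : ℤ) : ℤ ×ₗ ℤ :=
  toLex (if pri a < pri b then (pri a, b - a) else (2 * n - pri b, a - b))

namespace Bound

variable {pri : ℤ → ℤ} {f g h f1 g1 : Bound k n} {a b : ℤ}

/-- Chains of steps, with their labels. -/
inductive KeyPath (pri : ℤ → ℤ) : Bound k n → Bound k n → List (ℤ ×ₗ ℤ) → Prop
  | nil (f : Bound k n) : KeyPath pri f f []
  | cons {f f1 g : Bound k n} {a b : ℤ} {ks : List (ℤ ×ₗ ℤ)} (s : Step f f1 a b)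
      (p : KeyPath pri f1 g ks) : KeyPath pri f g (key n pri a b :: ks)

namespace KeyPath

theorem append {ks ls : List (ℤ ×ₗ ℤ)} (p : KeyPath pri f g ks) (q : KeyPath pri g h ls) :
    KeyPath pri f h (ks ++ ls) := by
  induction p with
  | nil => exact q
  | cons s _ ih => exact .cons s (ih q)

theorem single (s : Step f g a b) : KeyPath pri f g [key n pri a b] := .cons s (.nil g)

theorem of_snoc {l : ℤ ×ₗ ℤ} {ks : List (ℤ ×ₗ ℤ)} : ∀ {f : Bound k n},
    KeyPath pri f g (ks ++ [l]) →
    ∃ h a b, KeyPath pri f h ks ∧ Step h g a b ∧ l = key n pri a b := by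
  induction ks with
  | nil =>
    intro f p
    rcases p with _ | ⟨s, p⟩
    cases p
    exact ⟨f, _, _, .nil f, s, rfl⟩
  | cons k ks ih =>
    intro f p
    rcases p with _ | ⟨s, p⟩
    obtain ⟨h, a, b, p', s', e⟩ := ih p
    exact ⟨h, a, b, .cons s p', s', e⟩

theorem rankLE {ks : List (ℤ ×ₗ ℤ)} (p : KeyPath pri f g ks) : RankLE f g := by
  induction p with
  | nil => exact .refl _
  | cons s _ ih => exact s.rankLE.trans ih

end KeyPath

theorem pri_add_mul (hp : IsPriority n pri) (x r : ℤ) : pri (x + r * n) = pri x :=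
  (hp.eq_iff _ _).2 (modEq_iff_exists.2 ⟨r, rfl⟩)

theorem key_translate (hp : IsPriority n pri) (a b r : ℤ) :
    key n pri (a + r * n) (b + r * n) = key n pri a b := by
  simp only [key, pri_add_mul hp, add_sub_add_right_eq_sub]

theorem Step.pri_ne (hp : IsPriority n pri) (s : Step f g a b) : pri a ≠ pri b := fun e =>
  s.swap.not_modEq ((hp.eq_iff _ _).1 e)

theorem key_up (h : pri a < pri b) : key n pri a b = toLex (pri a, b - a) := by
  rw [key, if_pos h]

theorem key_down (h : pri b < pri a) : key n pri a b = toLex (2 * (n : ℤ) - pri b, a - b) := by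
  rw [key, if_neg (not_lt.2 h.le)]

/-- The range of the first components of the labels at levels at least `l`. -/
def LevelGE (n : ℕ) (l : ℤ) (k : ℤ ×ₗ ℤ) : Prop := l ≤ (ofLex k).1 ∧ (ofLex k).1 ≤ 2 * n - l

theorem levelGE_key_iff (hp : IsPriority n pri) {l : ℤ} :
    LevelGE n l (key n pri a b) ↔ l ≤ pri a ∧ l ≤ pri b := by
  have := hp.lt a
  have := hp.lt b
  rw [LevelGE, key]
  split_ifs <;> simp <;> lia

/-- A label of level at least `l` is an upward label at `p` if its first component is `l`. -/
theorem Step.exists_up (hp : IsPriority n pri) (s : Step f g a b) {p : ℤ}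
    (h : (ofLex (key n pri a b)).1 = pri p) :
    ∃ b', Step f g p b' ∧ pri p < pri b' ∧ key n pri a b = toLex (pri p, b' - p) := by
  have h1 := hp.lt p
  have h2 := hp.lt b
  rcases lt_or_gt_of_ne (s.pri_ne hp) with hlt | hlt
  · rw [key_up hlt] at h
    obtain ⟨r, rfl, s'⟩ := s.exists_left ((hp.eq_iff a p).1 h)
    rw [pri_add_mul hp]
    refine ⟨_, s', by rwa [pri_add_mul hp], ?_⟩
    rw [key_up hlt]
    congr 2
    ring
  · rw [key_down hlt] at h
    simp only [ofLex_toLex] at h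
    lia

theorem Step.exists_down (hp : IsPriority n pri) (s : Step f g a b) {p : ℤ}
    (h : (ofLex (key n pri a b)).1 = 2 * n - pri p) :
    ∃ a', Step f g a' p ∧ pri p < pri a' ∧ key n pri a b = toLex (2 * (n : ℤ) - pri p, a' - p) := by
  have h1 := hp.lt p
  have h2 := hp.lt a
  rcases lt_or_gt_of_ne (s.pri_ne hp) with hlt | hlt
  · rw [key_up hlt] at h
    simp only [ofLex_toLex] at h
    lia
  · rw [key_down hlt] at h
    simp only [ofLex_toLex] at h
    obtain ⟨r, rfl, s'⟩ := s.exists_right ((hp.eq_iff b p).1 (by lia))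
    rw [pri_add_mul hp]
    refine ⟨_, s', by rwa [pri_add_mul hp], ?_⟩
    rw [key_down hlt]
    congr 2
    ring

theorem sorted_cons {L : Type*} [LinearOrder L] {l : L} {ks : List L} (hs : ks.Pairwise (· < ·))
    (h : ∀ k ∈ ks.head?, l < k) : (l :: ks).Pairwise (· < ·) := by
  rw [← List.isChain_iff_pairwise] at hs ⊢
  cases ks with
  | nil => simp
  | cons k ks => exact List.isChain_cons_cons.2 ⟨h k rfl, hs⟩

theorem sorted_snoc {L : Type*} [LinearOrder L] {l : L} {ks : List L} (hs : ks.Pairwise (· < ·))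
    (h : ∀ k ∈ ks.getLast?, k < l) : (ks ++ [l]).Pairwise (· < ·) := by
  rw [← List.isChain_iff_pairwise] at hs ⊢
  exact List.isChain_append.2 ⟨hs, by simp, fun a ha b hb => by
    simp only [List.head?_cons, Option.mem_def, Option.some.injEq] at hb
    subst hb
    exact h a ha⟩

/-- The elements agree at all positions of priority less than `l`, and are not separated there. -/
def Agree (pri : ℤ → ℤ) (l : ℤ) (f g : Bound k n) : Prop :=
  ∀ x, pri x < l → f x = g x ∧ gap f g x (f x + 1) = 0

theorem Agree.le_pri {l : ℤ} (H : RankLE f1 g) (A : Agree pri l f g) (s : Step f f1 a b) {x : ℤ}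
    (h : x = a ∨ x = b) : l ≤ pri x := by
  by_contra hlt
  obtain ⟨h1, h2⟩ := A x (not_le.1 hlt)
  obtain ⟨e1, e2⟩ := gap_same h1
  have := s.lt
  have := s.val
  rcases h with rfl | rfl
  · have o := s.gap_eq_one (x := x) (y := f x + 1) (by lia) (by lia) (by lia) (by lia)
    have := gap_add_gap f f1 g x (f x + 1)
    have := H x (f x + 1)
    lia
  · have o := s.gap_eq_one (x := x - 1) (y := f x) (by lia) (by lia) (by lia) (by lia)
    have := gap_add_gap f f1 g (x - 1) (f x)
    have := H (x - 1) (f x)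
    lia

theorem Agree.le_pri' {l : ℤ} (H : RankLE f g1) (A : Agree pri l f g) (s : Step g1 g a b) {x : ℤ}
    (h : x = a ∨ x = b) : l ≤ pri x := by
  by_contra hlt
  obtain ⟨h1, h2⟩ := A x (not_le.1 hlt)
  obtain ⟨e1, e2⟩ := gap_same h1
  have := s.lt
  have := s.val
  have sl := s.swap.left
  have sr := s.swap.right
  rcases h with rfl | rfl
  · have o := s.gap_eq_one (x := x) (y := f x) (by lia) (by lia) (by lia) (by lia)
    have := gap_add_gap f g1 g x (f x)
    have := H x (f x)
    lia
  · have o := s.gap_eq_one (x := x - 1) (y := f x + 1) (by lia) (by lia) (by lia) (by lia)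
    have := gap_add_gap f g1 g (x - 1) (f x + 1)
    have := H (x - 1) (f x + 1)
    have e := gap_pred f g x (f x + 1)
    rw [← h1] at e
    lia

theorem Step.off_pri (hp : IsPriority n pri) {l : ℤ} (s : Step f g a b) (ha : l ≤ pri a)
    (hb : l ≤ pri b) {x : ℤ} (hx : pri x < l) : g x = f x :=
  s.swap.off x (fun h => by rw [(hp.eq_iff _ _).2 h] at hx; lia)
    fun h => by rw [(hp.eq_iff _ _).2 h] at hx; lia

/-- The largest `v` such that the gap at `p` is positive on `(f p, v]`. -/
theorem exists_max (H : RankLE f g) (p : ℤ) (h1 : 1 ≤ gap f g p (f p + 1)) :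
    ∃ v, f p < v ∧ (∀ y, f p < y → y ≤ v → 1 ≤ gap f g p y) ∧ gap f g p (v + 1) = 0 := by
  obtain ⟨w, ⟨hw, hw'⟩, hmin⟩ := Int.exists_least_of_bdd
    (P := fun w => f p < w ∧ gap f g p w = 0) ⟨f p, fun z hz => hz.1.le⟩
    ⟨p + n + 1, by have := f.apply_le p; lia, gap_eq_zero_of_lt _ _ (by lia)⟩
  refine ⟨w - 1, ?_, fun y hy hy' => ?_, by rwa [sub_add_cancel]⟩
  · by_contra hlt
    obtain rfl : w = f p + 1 := by lia
    lia
  · have := H p y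
    by_contra hlt
    have := hmin y ⟨hy, by lia⟩
    lia

theorem exists_rising_aux (hn : 0 < n) (hp : IsPriority n pri) (m : ℕ) :
    ∀ l : ℤ, 0 ≤ l → l + m = n → ∀ f g : Bound k n, RankLE f g → Agree pri l f g →
      ∃ ks, KeyPath pri f g ks ∧ ks.Pairwise (· < ·) ∧ ∀ k ∈ ks, LevelGE n l k := by
  induction m with
  | zero =>
    intro l _ hl f g _ A
    obtain rfl : f = g := ext_fun fun x => (A x (by have := hp.lt x; lia)).1
    exact ⟨[], .nil f, .nil, by simp⟩
  | succ m IH =>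
    intro l hl0 hl
    obtain ⟨p, hpl⟩ := hp.surj l hl0 (by lia)
    suffices key' : ∀ N : ℕ, ∀ f g : Bound k n, RankLE f g → Agree pri l f g →
        (2 * p + 2 * n - f p - g p).toNat = N →
        ∃ ks, KeyPath pri f g ks ∧ ks.Pairwise (· < ·) ∧ ∀ k ∈ ks, LevelGE n l k from
      fun f g H A => key' _ f g H A rfl
    intro N
    induction N using Nat.strong_induction_on with
    | _ N ih =>
    intro f g H A hN
    have bf := f.apply_le p
    have bg := g.apply_le p
    rcases (H p (f p + 1)).lt_or_eq with h1 | h1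
    · obtain ⟨v, hv, hv1, hv2⟩ := exists_max H p h1
      obtain ⟨b, f1, hbv, hno, s, H1⟩ := exists_up hn H hv hv1 hv2
      have pb : l ≤ pri b := A.le_pri H1 s (Or.inr rfl)
      have pb' : pri p < pri b := by
        have := s.pri_ne hp
        lia
      have f1p := s.swap.left
      have hval := s.val
      have A1 : Agree pri l f1 g := fun x hx => by
        have e : f1 x = f x := s.off_pri hp hpl.ge pb hx
        obtain ⟨a1, a2⟩ := A x hx
        refine ⟨e.trans a1, ?_⟩
        have := gap_add_gap f f1 g x (f x + 1)
        have := s.rankLE x (f x + 1)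
        have := H1 x (f x + 1)
        rw [e]
        lia
      obtain ⟨ks, q, hs, hk⟩ := ih _ (by have := f1.apply_le p; lia) f1 g H1 A1 rfl
      refine ⟨_, .cons s q, sorted_cons hs fun k hk' => ?_, ?_⟩
      · rw [key_up pb']
        cases q with
        | nil => simp at hk'
        | @cons _ f2 _ a' b' ks s' q =>
          simp only [List.head?_cons, Option.mem_def, Option.some.injEq] at hk'
          subst hk'
          have hk := hk _ List.mem_cons_self
          rcases (hpl ▸ hk.1 : pri p ≤ _).lt_or_eq with hlt | heq
          · exact Prod.Lex.lt_iff.2 (Or.inl hlt)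
          · obtain ⟨b2, s2, -, e⟩ := s'.exists_up hp heq.symm
            rw [e]
            refine Prod.Lex.lt_iff.2 (Or.inr ⟨rfl, ?_⟩)
            simp only [ofLex_toLex]
            by_contra hle
            have l1 := s.lt
            have l2 := s2.lt
            have hval2 := s2.val
            have l3 := s.lt_add
            have hv' : f1 b2 ≤ v := by
              by_contra hlt
              have := s2.gap_eq_one (x := p) (y := v + 1) le_rfl l2 (by lia) (by lia)
              have := gap_add_gap f1 f2 g p (v + 1)
              have := gap_add_gap f f1 g p (v + 1)
              have := q.rankLE p (v + 1)
              have := s.rankLE p (v + 1)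
              lia
            have hne : b2 ≠ b := by
              rintro rfl
              have := s.swap.right
              lia
            have e2 : f1 b2 = f b2 := s.off_between l2 (by lia)
            exact hno b2 l2 (by lia) ⟨by lia, by lia⟩
      · intro k hk'
        rcases List.mem_cons.1 hk' with rfl | hk'
        · exact (levelGE_key_iff hp).2 ⟨hpl.ge, pb⟩
        · exact hk k hk'
    · have g2 := gap_pred f g p (f p + 1)
      rw [if_neg (show ¬ f p + 1 ≤ f p by lia), ← h1] at g2
      have hle := H (p - 1) (f p + 1)
      have hfg : g p ≤ f p := by
        by_contra hlt
        rw [if_pos (by lia)] at g2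
        lia
      rw [if_neg (by lia)] at g2
      rcases hfg.lt_or_eq with hlt | heq
      · obtain ⟨a, g1, hav, hno, s, H1⟩ := Bound.exists_down (v := f p) hn H hlt (fun y hy hy' => by
          have e := gap_pred f g p y
          rw [if_neg (by lia), if_pos hy'] at e
          have := H p y
          lia) (by lia)
        have pa : l ≤ pri a := A.le_pri' H1 s (Or.inl rfl)
        have pa' : pri p < pri a := by
          have := s.pri_ne hp
          lia
        have sl := s.swap.left
        have sr := s.swap.right
        have hval := s.val
        have A1 : Agree pri l f g1 := fun x hx => by
          have e : g x = g1 x := s.off_pri hp pa hpl.ge hx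
          obtain ⟨a1, a2⟩ := A x hx
          refine ⟨a1.trans e, ?_⟩
          have := gap_add_gap f g1 g x (f x + 1)
          have := s.rankLE x (f x + 1)
          have := H1 x (f x + 1)
          lia
        obtain ⟨ks, q, hs, hk⟩ := ih _ (by have := g1.apply_le p; lia) f g1 H1 A1 rfl
        refine ⟨_, q.append (.single s), sorted_snoc hs fun k hk' => ?_, ?_⟩
        · rw [key_down pa']
          rcases List.eq_nil_or_concat' ks with rfl | ⟨ks, k', rfl⟩
          · simp at hk'
          · simp only [List.getLast?_append, List.getLast?_singleton, Option.some_or,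
              Option.mem_def, Option.some.injEq] at hk'
            subst hk'
            obtain ⟨h, a', b', q', s', rfl⟩ := q.of_snoc
            have hk := hk _ (List.mem_append_right _ List.mem_cons_self)
            rcases (hpl ▸ hk.2 : _ ≤ 2 * (n : ℤ) - pri p).lt_or_eq with hlt | heq
            · exact Prod.Lex.lt_iff.2 (Or.inl hlt)
            · obtain ⟨a2, s2, -, e⟩ := s'.exists_down hp heq
              rw [e]
              refine Prod.Lex.lt_iff.2 (Or.inr ⟨rfl, ?_⟩)
              simp only [ofLex_toLex]
              by_contra hle
              have l1 := s.lt
              have l2 := s2.lt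
              have hval2 := s2.val
              have sl2 := s2.swap.left
              have sr2 := s2.swap.right
              have l3 := s.lt_add
              have hv' : g1 a2 ≤ f p := by
                by_contra hlt
                have := s2.gap_eq_one (x := p - 1) (y := f p + 1) (by lia) (by lia) (by lia)
                  (by lia)
                have := gap_add_gap f h g1 (p - 1) (f p + 1)
                have := gap_add_gap f g1 g (p - 1) (f p + 1)
                have := q'.rankLE (p - 1) (f p + 1)
                have := s.rankLE (p - 1) (f p + 1)
                lia
              have hne : a2 ≠ a := by
                rintro rfl
                lia
              have e2 : g a2 = g1 a2 := s.off_between (by lia) l2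
              exact hno a2 (by lia) l2 ⟨by lia, by lia⟩
        · intro k hk'
          rcases List.mem_append.1 hk' with hk' | hk'
          · exact hk k hk'
          · rw [List.mem_singleton.1 hk']
            exact (levelGE_key_iff hp).2 ⟨pa, hpl.ge⟩
      · have A1 : Agree pri (l + 1) f g := fun x hx => by
          rcases (Int.lt_add_one_iff.1 hx).lt_or_eq with hx | hx
          · exact A x hx
          · obtain ⟨r, rfl⟩ := modEq_iff_exists.1 ((hp.eq_iff x p).1 (hx.trans hpl.symm))
            rw [f.add_mul, g.add_mul, heq, add_right_comm, gap_add]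
            exact ⟨rfl, h1.symm⟩
        obtain ⟨ks, q, hs, hk⟩ := IH (l + 1) (by lia) (by push_cast at hl; lia) f g H A1
        exact ⟨ks, q, hs, fun k hk' => ⟨by have := (hk k hk').1; lia, by have := (hk k hk').2; lia⟩⟩

theorem RankLE.exists_rising (hn : 0 < n) (hp : IsPriority n pri) (H : RankLE f g) :
    ∃ ks, KeyPath pri f g ks ∧ ks.Pairwise (· < ·) := by
  obtain ⟨ks, q, hs, -⟩ := exists_rising_aux hn hp n 0 le_rfl (by simp) f g H fun x hx =>
    absurd hx (not_lt.2 (hp.nonneg x))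
  exact ⟨ks, q, hs⟩

end Bound

end Rising

section Uniqueness

variable {k n : ℕ}

namespace Bound

variable {pri : ℤ → ℤ} {f g h f1 g1 : Bound k n} {a b p : ℤ} {ks ls : List (ℤ ×ₗ ℤ)}

theorem Step.down_gap (s : Step f g a p) (y : ℤ) : gap f g p y = 0 := by
  rw [gap_swapped s.swap s.lt s.val, if_neg]
  rintro ⟨r, h1, h2, -, -⟩
  have := s.lt_add
  have hn : (0 : ℤ) ≤ n := by positivity
  have : 0 < r := by
    by_contra hr
    nlinarith
  nlinarith

theorem Step.up_gap (s : Step f g p b) {y : ℤ} (hy : f b < y) : gap f g p y = 0 := by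
  rw [gap_swapped s.swap s.lt s.val, if_neg]
  rintro ⟨r, h1, h2, -, h4⟩
  have := s.lt_add
  have hn : (0 : ℤ) ≤ n := by positivity
  have : r = 0 := by
    by_contra hr
    rcases lt_or_gt_of_ne hr with hr | hr <;> nlinarith
  subst this
  lia

theorem KeyPath.gap_of_down (hp : IsPriority n pri) (q : KeyPath pri f g ks)
    (hk : ∀ k ∈ ks, (ofLex k).1 = 2 * n - pri p) (y : ℤ) : gap f g p y = 0 := by
  induction q with
  | nil => simp [gap]
  | @cons f f1 g a b ks s q ih =>
    obtain ⟨a', s', -, -⟩ := s.exists_down hp (hk _ List.mem_cons_self)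
    rw [← gap_add_gap f f1 g, s'.down_gap, ih fun k hk' => hk k (List.mem_cons_of_mem _ hk')]
    rfl

/-- A step whose label is neither upward nor downward at `p`. -/
theorem Step.mid (hp : IsPriority n pri) (s : Step f g a b) (hl : LevelGE n (pri p) (key n pri a b))
    (h1 : (ofLex (key n pri a b)).1 ≠ pri p) (h2 : (ofLex (key n pri a b)).1 ≠ 2 * n - pri p) :
    g p = f p ∧ gap f g p (f p + 1) = 0 := by
  rw [levelGE_key_iff hp] at hl
  have hne := s.pri_ne hp
  have ha : pri p ≠ pri a := by
    intro e
    rw [key_up (by lia)] at h1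
    exact h1 e.symm
  have hb : pri p ≠ pri b := by
    intro e
    rw [key_down (by lia)] at h2
    exact h2 (by simp [e])
  refine ⟨s.swap.off p (fun e => ha ((hp.eq_iff _ _).2 e)) fun e => hb ((hp.eq_iff _ _).2 e), ?_⟩
  rw [gap_swapped s.swap s.lt s.val, if_neg]
  rintro ⟨r, r1, r2, r3, r4⟩
  have s' := s.translate r
  have n1 : a + r * n ≠ p := by
    rintro rfl
    exact ha (pri_add_mul hp _ _)
  have n2 : f (a + r * n) ≠ f p := fun e => n1 (f.inj.1 e)
  refine s'.none p (by lia) r2 ?_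
  rw [f.add_mul] at n2 ⊢
  rw [f.add_mul]
  exact ⟨by lia, by lia⟩

theorem KeyPath.apply_le_of_no_up (hp : IsPriority n pri) (q : KeyPath pri f g ks)
    (hl : ∀ k ∈ ks, LevelGE n (pri p) k) (h1 : ∀ k ∈ ks, (ofLex k).1 ≠ pri p) : g p ≤ f p := by
  induction q with
  | nil => exact le_rfl
  | @cons f f1 g a b ks s q ih =>
    refine (ih (fun k hk => hl k (List.mem_cons_of_mem _ hk))
      fun k hk => h1 k (List.mem_cons_of_mem _ hk)).trans ?_
    by_cases e : (ofLex (key n pri a b)).1 = 2 * n - pri p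
    · obtain ⟨a', s', -, -⟩ := s.exists_down hp e
      rw [s'.swap.right]
      exact s'.val.le
    · exact (s.mid hp (hl _ List.mem_cons_self) (h1 _ List.mem_cons_self) e).1.le

theorem KeyPath.apply_eq_of_mid (hp : IsPriority n pri) (q : KeyPath pri f g ks)
    (hl : ∀ k ∈ ks, LevelGE n (pri p) k) (h1 : ∀ k ∈ ks, (ofLex k).1 ≠ pri p)
    (h2 : ∀ k ∈ ks, (ofLex k).1 ≠ 2 * n - pri p) : g p = f p := by
  induction q with
  | nil => rfl
  | @cons f f1 g a b ks s q ih =>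
    exact (ih (fun k hk => hl k (List.mem_cons_of_mem _ hk))
      (fun k hk => h1 k (List.mem_cons_of_mem _ hk))
      fun k hk => h2 k (List.mem_cons_of_mem _ hk)).trans
      (s.mid hp (hl _ List.mem_cons_self) (h1 _ List.mem_cons_self) (h2 _ List.mem_cons_self)).1

theorem fst_le_of_lt {x y : ℤ ×ₗ ℤ} (h : x < y) : (ofLex x).1 ≤ (ofLex y).1 := by
  rcases Prod.Lex.lt_iff.1 h with h | h
  · exact h.le
  · exact h.1.le

theorem KeyPath.gap_of_no_up (hp : IsPriority n pri) (q : KeyPath pri f g ks)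
    (hs : ks.Pairwise (· < ·)) (hl : ∀ k ∈ ks, LevelGE n (pri p) k)
    (h1 : ∀ k ∈ ks, (ofLex k).1 ≠ pri p) : gap f g p (f p + 1) = 0 := by
  induction q with
  | nil => simp [gap]
  | @cons f f1 g a b ks s q ih =>
    by_cases e : (ofLex (key n pri a b)).1 = 2 * n - pri p
    · refine KeyPath.gap_of_down hp (.cons s q) (fun k hk => ?_) _
      rcases List.mem_cons.1 hk with rfl | hk'
      · exact e
      · have := fst_le_of_lt ((List.pairwise_cons.1 hs).1 k hk')
        have := (hl k hk).2
        lia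
    · have := s.mid hp (hl _ List.mem_cons_self) (h1 _ List.mem_cons_self) e
      have i := ih hs.of_cons (fun k hk => hl k (List.mem_cons_of_mem _ hk))
        fun k hk => h1 k (List.mem_cons_of_mem _ hk)
      rw [this.1] at i
      rw [← gap_add_gap f f1 g, this.2, i]
      rfl

theorem no_up_of_head {k : ℤ ×ₗ ℤ} (hs : (k :: ks).Pairwise (· < ·))
    (hl : ∀ j ∈ k :: ks, LevelGE n (pri p) j) (h1 : (ofLex k).1 ≠ pri p) :
    ∀ j ∈ k :: ks, (ofLex j).1 ≠ pri p := by
  intro j hj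
  rcases List.mem_cons.1 hj with rfl | hj
  · exact h1
  · have := fst_le_of_lt ((List.pairwise_cons.1 hs).1 j hj)
    have := (hl k List.mem_cons_self).1
    lia

theorem KeyPath.none_of_up (hp : IsPriority n pri) {v : ℤ} :
    ∀ {f f1 : Bound k n} {b : ℤ}, Step f f1 p b → pri p < pri b → KeyPath pri f1 g ks →
      (key n pri p b :: ks).Pairwise (· < ·) → (∀ k ∈ ks, LevelGE n (pri p) k) →
      (∀ y, f p < y → y ≤ v → 1 ≤ gap f g p y) → gap f g p (v + 1) = 0 →
      ∀ c, p < c → c < b → ¬ (f p < f c ∧ f c ≤ v) := by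
  induction ks with
  | nil =>
    intro f f1 b s _ q _ _ h1 _ c hc hc' h
    have hg : f1 = g := by cases q; rfl
    subst hg
    have := h1 (f c) h.1 h.2
    refine s.none c hc hc' ⟨h.1, ?_⟩
    have hne : f c ≠ f b := fun e => hc'.ne (f.inj.1 e)
    by_contra hlt
    rw [s.up_gap (by lia)] at this
    lia
  | cons k' ks ih =>
    intro f f1 b s hb q hs hl h1 h2 c hc hc' h
    have hne : f c ≠ f b := fun e => hc'.ne (f.inj.1 e)
    have f1p := s.swap.left
    have hval := s.val
    have gf : ∀ y, f b < y → gap f1 g p y = gap f g p y := fun y hy => by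
      rw [← gap_add_gap f f1 g, s.up_gap hy, zero_add]
    by_cases e : (ofLex k').1 = pri p
    · cases q with
      | @cons _ f2 _ a' b' _ s' q =>
        obtain ⟨b2, s2, hb2, e'⟩ := s'.exists_up hp e
        have hlt : b < b2 := by
          have := (List.pairwise_cons.1 hs).1 _ List.mem_cons_self
          rw [e', key_up hb] at this
          rcases Prod.Lex.lt_iff.1 this with h | h
          · simp at h
          · simpa using h.2
        have hs' := hs.of_cons
        rw [e', ← key_up hb2] at hs'
        have hv2 := s2.val
        rcases lt_or_ge (f b) v with hbv | hbv
        · have := ih s2 hb2 q hs' (fun k hk => hl k (List.mem_cons_of_mem _ hk))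
            (fun y hy hy' => by rw [gf y (by lia)]; exact h1 y (by lia) hy')
            (by rw [gf _ (by lia), h2]) c hc (by lia)
          rw [s.off_between hc hc', f1p] at this
          have := s.none c hc hc'
          lia
        · exact s.none c hc hc' ⟨h.1, by lia⟩
    · have h0 := q.gap_of_no_up hp hs.of_cons hl (no_up_of_head hs.of_cons hl e)
      rw [f1p, gf _ (by lia)] at h0
      have hvb : v ≤ f b := by
        by_contra hlt
        have := h1 (f b + 1) (by lia) (by lia)
        lia
      exact s.none c hc hc' ⟨h.1, by lia⟩

theorem KeyPath.none_of_down (hp : IsPriority n pri) (ks : List (ℤ ×ₗ ℤ)) :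
    ∀ {h g : Bound k n} {a : ℤ}, Step h g a p → pri p < pri a → KeyPath pri f h ks →
      (ks ++ [key n pri a p]).Pairwise (· < ·) → (∀ k ∈ ks, LevelGE n (pri p) k) →
      (∀ k ∈ ks, (ofLex k).1 ≠ pri p) →
      ∀ c, a < c → c < p → ¬ (g p < g c ∧ g c ≤ f p) := by
  induction ks using List.reverseRecOn with
  | nil =>
    intro h g a s _ q _ _ _ c hc hc' hcon
    obtain rfl : f = h := by cases q; rfl
    rw [s.off_between hc hc', s.swap.right] at hcon
    have hne : f c ≠ f p := fun e => hc'.ne (f.inj.1 e)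
    exact s.none c hc hc' ⟨hcon.1, by lia⟩
  | append_singleton ks k' ih =>
    intro h g a s ha q hs hl h1 c hc hc' hcon
    rw [s.off_between hc hc', s.swap.right] at hcon
    have hne : h c ≠ h p := fun e => hc'.ne (h.inj.1 e)
    obtain ⟨hs1, -, hs2⟩ := List.pairwise_append.1 hs
    by_cases e : (ofLex k').1 = 2 * n - pri p
    · obtain ⟨h', a', b', q', s', rfl⟩ := q.of_snoc
      obtain ⟨a2, s2, ha2, e'⟩ := s'.exists_down hp e
      have hlt : a2 < a := by
        have := hs2 _ (List.mem_append_right _ List.mem_cons_self) _ List.mem_cons_self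
        rw [e', key_down ha] at this
        rcases Prod.Lex.lt_iff.1 this with h | h
        · simp at h
        · simpa using h.2
      rw [e', ← key_down ha2] at hs1
      have := ih s2 ha2 q' hs1 (fun k hk => hl k (List.mem_append_left _ hk))
        (fun k hk => h1 k (List.mem_append_left _ hk)) c (by lia) hc'
      have := s.none c hc hc'
      lia
    · have h2 : ∀ k ∈ ks ++ [k'], (ofLex k).1 ≠ 2 * n - pri p := by
        intro k hk
        rcases List.mem_append.1 hk with hk1 | hk1
        · have := fst_le_of_lt ((List.pairwise_append.1 hs1).2.2 k hk1 k' List.mem_cons_self)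
          have := (hl k' (List.mem_append_right _ List.mem_cons_self)).2
          lia
        · rw [List.mem_singleton.1 hk1]
          exact e
      have := q.apply_eq_of_mid hp hl h1 h2
      exact s.none c hc hc' ⟨hcon.1, by lia⟩

theorem KeyPath.exists_head_up (hp : IsPriority n pri) (q : KeyPath pri f g ks)
    (hs : ks.Pairwise (· < ·)) (hl : ∀ k ∈ ks, LevelGE n (pri p) k)
    (h : gap f g p (f p + 1) ≠ 0) : ∃ b f1 ks', Step f f1 p b ∧ pri p < pri b ∧
      KeyPath pri f1 g ks' ∧ ks = key n pri p b :: ks' := by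
  cases q with
  | nil => simp [gap] at h
  | @cons _ f1 _ a b ks s q =>
    by_cases e : (ofLex (key n pri a b)).1 = pri p
    · obtain ⟨b', s', hb', e'⟩ := s.exists_up hp e
      exact ⟨b', f1, ks, s', hb', q, by rw [e', key_up hb']⟩
    · exact absurd (KeyPath.gap_of_no_up hp (.cons s q) hs hl (no_up_of_head hs hl e)) h

theorem KeyPath.exists_last_down (hp : IsPriority n pri) (q : KeyPath pri f g ks)
    (hs : ks.Pairwise (· < ·)) (hl : ∀ k ∈ ks, LevelGE n (pri p) k)
    (h1 : ∀ k ∈ ks, (ofLex k).1 ≠ pri p)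
    (h : g p ≠ f p) : ∃ a g1 ks', Step g1 g a p ∧ pri p < pri a ∧
      KeyPath pri f g1 ks' ∧ ks = ks' ++ [key n pri a p] := by
  rcases List.eq_nil_or_concat' ks with rfl | ⟨ks, k', rfl⟩
  · cases q
    exact absurd rfl h
  · by_cases e : (ofLex k').1 = 2 * n - pri p
    · obtain ⟨h', a', b', q', s', rfl⟩ := q.of_snoc
      obtain ⟨a2, s2, ha2, e'⟩ := s'.exists_down hp e
      exact ⟨a2, h', ks, s2, ha2, q', by rw [e', key_down ha2]⟩
    · refine absurd (q.apply_eq_of_mid hp hl h1 fun k hk => ?_) h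
      rcases List.mem_append.1 hk with hk1 | hk1
      · have := fst_le_of_lt ((List.pairwise_append.1 hs).2.2 k hk1 k' List.mem_cons_self)
        have := (hl k' (List.mem_append_right _ List.mem_cons_self)).2
        lia
      · rw [List.mem_singleton.1 hk1]
        exact e

theorem no_up_of_gap (hp : IsPriority n pri) (q : KeyPath pri f g ks)
    (hs : ks.Pairwise (· < ·)) (hl : ∀ k ∈ ks, LevelGE n (pri p) k)
    (h : gap f g p (f p + 1) = 0) : ∀ k ∈ ks, (ofLex k).1 ≠ pri p := by
  cases q with
  | nil => simp
  | @cons _ f1 _ a b ks s q =>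
    refine no_up_of_head hs hl fun e => ?_
    obtain ⟨b', s', hb', e'⟩ := s.exists_up hp e
    have := s'.gap_eq_one (x := p) (y := f p + 1) le_rfl s'.lt (by lia) (by have := s'.val; lia)
    have := gap_add_gap f f1 g p (f p + 1)
    have := q.rankLE p (f p + 1)
    lia

theorem rising_unique_aux (hp : IsPriority n pri) (m : ℕ) :
    ∀ l : ℤ, 0 ≤ l → l + m = n → ∀ (ks ls : List (ℤ ×ₗ ℤ)) (f g : Bound k n),
      KeyPath pri f g ks → ks.Pairwise (· < ·) → (∀ k ∈ ks, LevelGE n l k) →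
      KeyPath pri f g ls → ls.Pairwise (· < ·) → (∀ k ∈ ls, LevelGE n l k) → ks = ls := by
  induction m with
  | zero =>
    intro l _ hl ks ls f g q1 _ hl1 q2 _ hl2
    have nil : ∀ {ks : List (ℤ ×ₗ ℤ)}, KeyPath pri f g ks → (∀ k ∈ ks, LevelGE n l k) →
        ks = [] := by
      intro ks q hk
      cases q with
      | nil => rfl
      | @cons _ _ _ a b _ s q =>
        have := (levelGE_key_iff hp).1 (hk _ List.mem_cons_self)
        have := hp.lt a
        push_cast at hl
        lia
    rw [nil q1 hl1, nil q2 hl2]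
  | succ m IH =>
    intro l hl0 hl
    obtain ⟨p, hpl⟩ := hp.surj l hl0 (by lia)
    intro ks
    obtain ⟨N, hN⟩ : ∃ N, ks.length = N := ⟨_, rfl⟩
    induction N using Nat.strong_induction_on generalizing ks with
    | _ N ih =>
    intro ls f g q1 hs1 hl1 q2 hs2 hl2
    subst hpl
    by_cases h0 : gap f g p (f p + 1) = 0
    · have n1 := no_up_of_gap hp q1 hs1 hl1 h0
      have n2 := no_up_of_gap hp q2 hs2 hl2 h0
      by_cases he : g p = f p
      · have narrow : ∀ {ks : List (ℤ ×ₗ ℤ)}, KeyPath pri f g ks → (∀ k ∈ ks, LevelGE n (pri p) k) →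
            (∀ k ∈ ks, (ofLex k).1 ≠ pri p) → ∀ k ∈ ks, LevelGE n (pri p + 1) k := by
          intro ks q hl h1 j hk
          suffices h2 : (ofLex j).1 ≠ 2 * n - pri p by
            have := hl j hk
            have := h1 j hk
            unfold LevelGE at *
            lia
          intro e
          obtain ⟨s1, s2, rfl⟩ := List.append_of_mem hk
          rw [List.append_cons] at q hl h1
          clear hk
          have : ∀ (s2 : List (ℤ ×ₗ ℤ)) {g : Bound k n}, KeyPath pri f g (s1 ++ [j] ++ s2) →
              (∀ i ∈ s1 ++ [j] ++ s2, LevelGE n (pri p) i) →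
              (∀ i ∈ s1 ++ [j] ++ s2, (ofLex i).1 ≠ pri p) → g p < f p := by
            intro s2
            induction s2 using List.reverseRecOn with
            | nil =>
              intro g q hl h1
              rw [List.append_nil] at q hl h1
              obtain ⟨h', a', b', q', s', rfl⟩ := q.of_snoc
              obtain ⟨a2, s2, ha2, e'⟩ := s'.exists_down hp e
              have := q'.apply_le_of_no_up hp (fun k hk => hl k (List.mem_append_left _ hk))
                fun k hk => h1 k (List.mem_append_left _ hk)
              have h3 := s2.swap.right
              have h4 := s2.val
              lia
            | append_singleton s2 k' ih' =>
              intro g q hl h1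
              rw [← List.append_assoc] at q hl h1
              obtain ⟨h', a', b', q', s', rfl⟩ := q.of_snoc
              have := ih' q' (fun k hk => hl k (List.mem_append_left _ hk))
                fun k hk => h1 k (List.mem_append_left _ hk)
              have := (KeyPath.single (pri := pri) s').apply_le_of_no_up hp
                (fun k hk => hl k (List.mem_append_right _ hk))
                fun k hk => h1 k (List.mem_append_right _ hk)
              lia
          have := this s2 q hl h1
          lia
        exact IH (pri p + 1) (by lia) (by push_cast at hl; lia) ks ls f g q1 hs1 (narrow q1 hl1 n1)
          q2 hs2 (narrow q2 hl2 n2)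
      · obtain ⟨a, g1, ks, s, ha, q3, rfl⟩ := q1.exists_last_down hp hs1 hl1 n1 he
        obtain ⟨a', g1', ls, s', ha', q4, rfl⟩ := q2.exists_last_down hp hs2 hl2 n2 he
        have nd := KeyPath.none_of_down hp ks s ha q3 hs1
          (fun k hk => hl1 k (List.mem_append_left _ hk))
          fun k hk => n1 k (List.mem_append_left _ hk)
        have nd' := KeyPath.none_of_down hp ls s' ha' q4 hs2
          (fun k hk => hl2 k (List.mem_append_left _ hk))
          fun k hk => n2 k (List.mem_append_left _ hk)
        have le1 := q3.apply_le_of_no_up hp (fun k hk => hl1 k (List.mem_append_left _ hk))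
          fun k hk => n1 k (List.mem_append_left _ hk)
        have le2 := q4.apply_le_of_no_up hp (fun k hk => hl2 k (List.mem_append_left _ hk))
          fun k hk => n2 k (List.mem_append_left _ hk)
        have v1 := s.val
        have v2 := s'.val
        have r1 := s.swap.right
        have r2 := s'.swap.right
        have l1 := s.swap.left
        have l2 := s'.swap.left
        have haa : a = a' := by
          by_contra hne
          rcases lt_or_gt_of_ne hne with hlt | hlt
          · exact nd a' hlt s'.lt ⟨by lia, by lia⟩
          · exact nd' a hlt s.lt ⟨by lia, by lia⟩
        subst haa
        obtain rfl := swapped_unique s.swap.symm s'.swap.symm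
        rw [ih ks.length (by rw [← hN]; simp) ks rfl ls f g1 q3 (List.pairwise_append.1 hs1).1
          (fun k hk => hl1 k (List.mem_append_left _ hk)) q4 (List.pairwise_append.1 hs2).1
          (fun k hk => hl2 k (List.mem_append_left _ hk))]
    · obtain ⟨b, f1, ks, s, hb, q, rfl⟩ := q1.exists_head_up hp hs1 hl1 h0
      obtain ⟨b', f1', ls, s', hb', q', rfl⟩ := q2.exists_head_up hp hs2 hl2 h0
      have H := q1.rankLE
      obtain ⟨v, hv, hv1, hv2⟩ := exists_max H p (by have := H p (f p + 1); lia)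
      have nu := KeyPath.none_of_up hp s hb q hs1 (fun k hk => hl1 k (List.mem_cons_of_mem _ hk))
        hv1 hv2
      have nu' := KeyPath.none_of_up hp s' hb' q' hs2
        (fun k hk => hl2 k (List.mem_cons_of_mem _ hk)) hv1 hv2
      have le : ∀ {b : ℤ} {f1 : Bound k n} {ks : List (ℤ ×ₗ ℤ)}, Step f f1 p b →
          KeyPath pri f1 g ks → f b ≤ v := by
        intro b f1 ks s q
        by_contra hlt
        have := s.gap_eq_one (x := p) (y := v + 1) le_rfl s.lt (by lia) (by lia)
        have := gap_add_gap f f1 g p (v + 1)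
        have := q.rankLE p (v + 1)
        lia
      have hbb : b = b' := by
        by_contra hne
        rcases lt_or_gt_of_ne hne with hlt | hlt
        · exact nu' b s.lt hlt ⟨s.val, le s q⟩
        · exact nu b' s'.lt hlt ⟨s'.val, le s' q'⟩
      subst hbb
      obtain rfl := swapped_unique s.swap s'.swap
      rw [ih ks.length (by rw [← hN]; simp) ks rfl ls f1 g q hs1.of_cons
        (fun k hk => hl1 k (List.mem_cons_of_mem _ hk)) q' hs2.of_cons
        (fun k hk => hl2 k (List.mem_cons_of_mem _ hk))]

theorem KeyPath.rising_unique (hp : IsPriority n pri) (q1 : KeyPath pri f g ks)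
    (hs1 : ks.Pairwise (· < ·)) (q2 : KeyPath pri f g ls) (hs2 : ls.Pairwise (· < ·)) :
    ks = ls := by
  have lev : ∀ {f g : Bound k n} {ks : List (ℤ ×ₗ ℤ)}, KeyPath pri f g ks →
      ∀ k ∈ ks, LevelGE n 0 k := by
    intro f g ks q
    induction q with
    | nil => simp
    | cons s q ih =>
      intro k hk
      rcases List.mem_cons.1 hk with rfl | hk
      · exact (levelGE_key_iff hp).2 ⟨hp.nonneg _, hp.nonneg _⟩
      · exact ih k hk
  exact rising_unique_aux hp n 0 le_rfl (by simp) ks ls f g q1 hs1 (lev q1) q2 hs2 (lev q2)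

end Bound

end Uniqueness

section BoundLabeling

variable {k n : ℕ}

theorem reflection_swapped {F t : Equiv.Perm ℤ} (ht : IsAffineReflection n t)
    (hF : IsAffinePerm n (F * t)) :
    IsAffinePerm n F ∧ ∃ a b, a < b ∧ Swapped n F ⇑(F * t) a b := by
  obtain ⟨i, j, hm, h1, h2⟩ := ht
  have hi : ∀ r : ℤ, F (i + r * n) = (F * t) (j + r * n) := fun r => by
    rw [Equiv.Perm.mul_apply, (h1 r).2]
  have hj : ∀ r : ℤ, F (j + r * n) = (F * t) (i + r * n) := fun r => by
    rw [Equiv.Perm.mul_apply, (h1 r).1]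
  have ho : ∀ x, ¬ x ≡ i [ZMOD n] → ¬ x ≡ j [ZMOD n] → (F * t) x = F x := fun x hx hx' => by
    rw [Equiv.Perm.mul_apply, h2 x hx hx']
  have sw : Swapped n F ⇑(F * t) i j := by
    have a1 := hi 0
    have a2 := hj 0
    simp only [zero_mul, add_zero] at a1 a2
    exact ⟨hm, a2.symm, a1.symm, ho⟩
  refine ⟨fun x => ?_, ?_⟩
  · by_cases ha : x ≡ i [ZMOD n]
    · obtain ⟨r, rfl⟩ := modEq_iff_exists.1 ha
      rw [show i + r * n + n = i + (r + 1) * n by ring, hi, hi, hF.add_mul, hF.add_mul]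
      ring
    · by_cases hb : x ≡ j [ZMOD n]
      · obtain ⟨r, rfl⟩ := modEq_iff_exists.1 hb
        rw [show j + r * n + n = j + (r + 1) * n by ring, hj, hj, hF.add_mul, hF.add_mul]
        ring
      · rw [← ho x ha hb, ← hF, ho]
        · exact fun h => ha (by simpa using h)
        · exact fun h => hb (by simpa using h)
  · rcases lt_trichotomy i j with h | rfl | h
    · exact ⟨i, j, h, sw⟩
    · exact absurd rfl hm
    · exact ⟨j, i, h, sw.comm⟩

namespace Bound

instance instFinite (k n : ℕ) : Finite (Bound k n) := by
  rcases Nat.eq_zero_or_pos n with rfl | hn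
  · have : Subsingleton (Bound k 0) := ⟨fun f g => ext_fun fun x => by
      have h1 := f.bounded x
      have h2 := g.bounded x
      simp only [Nat.cast_zero, add_zero] at h1 h2
      lia⟩
    infer_instance
  · have hn' : (0 : ℤ) < n := by exact_mod_cast hn
    refine Finite.of_injective (β := Fin n → Fin (n + 1)) (fun f i =>
      ⟨(f i - i).toNat, by have := f.bounded i; lia⟩) fun f g hfg => ext_fun fun x => ?_
    have h1 := Int.emod_nonneg x hn'.ne'
    have h2 := Int.emod_lt_of_pos x hn'
    have h3 := congrFun hfg ⟨(x % n).toNat, by lia⟩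
    simp only [Fin.mk.injEq, Int.toNat_of_nonneg h1] at h3
    have b1 := f.le_apply (x % n)
    have b2 := g.le_apply (x % n)
    have h4 : f (x % n) = g (x % n) := by lia
    have e : x = x % n + (x / n) * n := by
      have := Int.emod_add_mul_ediv x n
      linarith
    rw [e, f.add_mul, g.add_mul, h4]

variable {pri : ℤ → ℤ} {f g h f1 g1 : Bound k n} {a b p : ℤ} {ks ls : List (ℤ ×ₗ ℤ)}

theorem Step.affLength_eq (hn : 0 < n) (s : Step f g a b) :
    affLength n g.toPerm = affLength n f.toPerm + 1 :=
  s.swap.affLength_eq hn f.affine g.affine s.lt s.val s.none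

theorem Step.le (hn : 0 < n) (s : Step f g a b) : f ≤ g := by
  obtain ⟨t1, t2⟩ := affineSwap_spec s.swap.not_modEq
  refine Relation.ReflTransGen.single ⟨affineSwap n a b s.swap.not_modEq,
    ⟨a, b, s.swap.not_modEq, t1, t2⟩, ?_, by rw [s.affLength_eq hn]; exact Nat.lt_succ_self _⟩
  ext x
  rw [Equiv.Perm.mul_apply]
  by_cases ha : x ≡ a [ZMOD n]
  · obtain ⟨r, rfl⟩ := modEq_iff_exists.1 ha
    rw [(t1 r).1, g.add_mul, f.add_mul, s.swap.left]
  · by_cases hb : x ≡ b [ZMOD n]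
    · obtain ⟨r, rfl⟩ := modEq_iff_exists.1 hb
      rw [(t1 r).2, g.add_mul, f.add_mul, s.swap.right]
    · rw [t2 x ha hb, s.swap.off x ha hb]

theorem KeyPath.le (hn : 0 < n) (q : KeyPath pri f g ks) : f ≤ g := by
  induction q with
  | nil => exact le_rfl
  | cons s _ ih => exact (s.le hn).trans ih

theorem exists_of_affBruhatLE (hn : 0 < n) {F : Equiv.Perm ℤ} (h : affBruhatLE n F g.toPerm) :
    ∃ f : Bound k n, f.toPerm = F ∧ RankLE f g := by
  induction h using Relation.ReflTransGen.head_induction_on with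
  | refl => exact ⟨g, rfl, .refl g⟩
  | @head F F' hs _ ih =>
    obtain ⟨f', hf', H⟩ := ih
    obtain ⟨t, ht, e, hlt⟩ := hs
    have aff' : IsAffinePerm n (F * t) := by rw [← e, ← hf']; exact f'.affine
    obtain ⟨aff, a, b, hab, sw⟩ := reflection_swapped ht aff'
    rw [← e, ← hf'] at sw
    have hv : F a < F b := by
      rcases lt_trichotomy (F a) (F b) with h | h | h
      · exact h
      · exact absurd (F.injective h) hab.ne
      · have := sw.symm.affLength_lt hn f'.affine aff hab (by rw [sw.left, sw.right]; exact h)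
        rw [hf'] at this
        exact absurd hlt this.not_gt
    have b1 := f'.le_apply b
    have b2 := f'.apply_le a
    have sl := sw.left
    have sr := sw.right
    obtain ⟨f, hf⟩ := exists_swapped hn f' sw.not_modEq hab (by lia) (by lia)
    have ef : f.toPerm = F := by
      ext x
      by_cases ha : x ≡ a [ZMOD n]
      · obtain ⟨r, rfl⟩ := modEq_iff_exists.1 ha
        rw [f.add_mul, aff.add_mul, hf.left, sw.right]
      · by_cases hb : x ≡ b [ZMOD n]
        · obtain ⟨r, rfl⟩ := modEq_iff_exists.1 hb
          rw [f.add_mul, aff.add_mul, hf.right, sw.left]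
        · rw [hf.off x ha hb, sw.off x ha hb]
    refine ⟨f, ef, RankLE.trans (fun x y => ?_) H⟩
    rw [gap_swapped hf.symm hab (by rw [ef]; exact hv)]
    split_ifs <;> simp

theorem isPriority_emod (hn : 0 < n) : IsPriority n fun x => x % n := by
  have hn' : (0 : ℤ) < n := by exact_mod_cast hn
  exact ⟨fun x => Int.emod_nonneg x hn'.ne', fun x => Int.emod_lt_of_pos x hn',
    fun x y => Iff.rfl, fun l h1 h2 => ⟨l, Int.emod_eq_of_lt h1 h2⟩⟩

theorem le_iff_rankLE (hn : 0 < n) : f ≤ g ↔ RankLE f g := by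
  constructor
  · intro h
    obtain ⟨f', e, H⟩ := exists_of_affBruhatLE hn h
    rwa [show f = f' from Bound.ext e.symm]
  · intro H
    obtain ⟨ks, q, -⟩ := H.exists_rising hn (isPriority_emod hn)
    exact q.le hn

theorem strictMono_affLength : StrictMono fun f : Bound k n => (affLength n f.toPerm : ℤ) := by
  intro f g h
  rcases affBruhatLE_length h.le with e | e
  · exact absurd (Bound.ext e) h.ne
  · exact Int.ofNat_lt.2 e

theorem covBy_iff_step (hn : 0 < n) : f ⋖ g ↔ ∃ a b, Step f g a b := by
  constructor
  · intro c
    obtain ⟨ks, q, -⟩ := ((le_iff_rankLE hn).1 c.le).exists_rising hn (isPriority_emod hn)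
    cases q with
    | nil => exact absurd rfl c.ne
    | @cons _ f1 _ a b ks s q =>
      have hlt : f < f1 := lt_of_le_of_ne (s.le hn) fun e => by
        have := s.affLength_eq hn
        rw [e] at this
        lia
      rcases (q.le hn).lt_or_eq with h | rfl
      · exact absurd h (c.2 hlt)
      · exact ⟨a, b, s⟩
  · rintro ⟨a, b, s⟩
    have hl := s.affLength_eq hn
    refine ⟨lt_of_le_of_ne (s.le hn) fun e => by rw [e] at hl; lia, fun x hx hx' => ?_⟩
    have h1 := strictMono_affLength hx
    have h2 := strictMono_affLength hx'
    simp only [hl] at h1 h2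
    push_cast at h1 h2
    lia

open Classical in
/-- The labeling of the covers of `Bound k n` by the exchanged positions. -/
noncomputable def label (pri : ℤ → ℤ) (f g : Bound k n) : ℤ ×ₗ ℤ :=
  if h : ∃ q : ℤ × ℤ, Step f g q.1 q.2 then key n pri h.choose.1 h.choose.2 else toLex (0, 0)

theorem Step.eq_translate (s : Step f g a b) {a' b' : ℤ} (s' : Step f g a' b') :
    ∃ r : ℤ, a' = a + r * n ∧ b' = b + r * n := by
  have ha : a' ≡ a [ZMOD n] := by
    by_contra ha
    have v' := s'.val
    have l' := s'.swap.left
    by_cases hb : a' ≡ b [ZMOD n]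
    · obtain ⟨r, rfl⟩ := modEq_iff_exists.1 hb
      have v := s.val
      rw [g.add_mul, s.swap.right] at l'
      rw [f.add_mul] at v'
      lia
    · have := s.swap.off a' ha hb
      lia
  obtain ⟨r, rfl⟩ := modEq_iff_exists.1 ha
  refine ⟨r, rfl, f.inj.1 ?_⟩
  rw [← s'.swap.left, g.add_mul, s.swap.left, f.add_mul]

theorem label_eq (hp : IsPriority n pri) (s : Step f g a b) : label pri f g = key n pri a b := by
  have ex : ∃ q : ℤ × ℤ, Step f g q.1 q.2 := ⟨(a, b), s⟩
  rw [label, dif_pos ex]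
  obtain ⟨r, h1, h2⟩ := s.eq_translate ex.choose_spec
  rw [h1, h2, key_translate hp]

theorem KeyPath.path (hn : 0 < n) (hp : IsPriority n pri) (q : KeyPath pri f g ks) :
    Path (label pri) f g ks := by
  induction q with
  | nil => exact .nil _
  | cons s _ ih =>
    rw [← label_eq hp s]
    exact .cons ((covBy_iff_step hn).2 ⟨_, _, s⟩) ih

theorem keyPath_of_path (hn : 0 < n) (hp : IsPriority n pri) (q : Path (label pri) f g ks) :
    KeyPath pri f g ks := by
  induction q with
  | nil => exact .nil _
  | cons c _ ih =>
    obtain ⟨a, b, s⟩ := (covBy_iff_step hn).1 c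
    rw [label_eq hp s]
    exact .cons s ih

theorem key_eq (hp : IsPriority n pri) {a' b' : ℤ} (hne : pri a ≠ pri b) (hne' : pri a' ≠ pri b')
    (h : key n pri a b = key n pri a' b') : ∃ r : ℤ, a' = a + r * n ∧ b' = b + r * n := by
  have := hp.lt a
  have := hp.lt a'
  have := hp.lt b
  have := hp.lt b'
  rcases lt_or_gt_of_ne hne with h1 | h1 <;> rcases lt_or_gt_of_ne hne' with h2 | h2
  · rw [key_up h1, key_up h2, toLex_inj, Prod.mk.injEq] at h
    obtain ⟨r, rfl⟩ := modEq_iff_exists.1 ((hp.eq_iff _ _).1 h.1.symm)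
    exact ⟨r, rfl, by lia⟩
  · rw [key_up h1, key_down h2, toLex_inj, Prod.mk.injEq] at h
    lia
  · rw [key_down h1, key_up h2, toLex_inj, Prod.mk.injEq] at h
    lia
  · rw [key_down h1, key_down h2, toLex_inj, Prod.mk.injEq] at h
    obtain ⟨r, rfl⟩ := modEq_iff_exists.1 ((hp.eq_iff b' b).1 (by lia))
    exact ⟨r, by lia, rfl⟩

/-- `f'` is the image of `f` under the automorphism of the order induced by `x ↦ -x`. -/
def IsReverse {k' : ℕ} (f : Bound k n) (f' : Bound k' n) : Prop := ∀ x, f' x = n - f (-x)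

theorem exists_reverse (hn : 0 < n) {k' : ℕ} (hk : k + k' = n) (f : Bound k n) :
    ∃ f' : Bound k' n, IsReverse f f' := by
  set F : Equiv.Perm ℤ := (Equiv.neg ℤ).trans (f.toPerm.trans (Equiv.subLeft (n : ℤ))) with hF
  have e : ∀ x, F x = n - f (-x) := fun x => rfl
  have bd : IsBounded n F := by
    refine ⟨fun x => ?_, fun x => ?_, fun x => ?_⟩
    · have := f.add_mul (-x) (-1)
      rw [e, e, show -(x + (n : ℤ)) = -x + -1 * n by ring, this]
      ring
    · have := f.apply_le (-x)
      rw [e]; lia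
    · have := f.le_apply (-x)
      rw [e]; lia
  refine ⟨ofIsBounded hn F bd ?_, e⟩
  have h0 := f.isBounded.rk_diag (n - 1)
  rw [f.rk_zero_one hn, sub_add_cancel, rk, sub_self] at h0
  have h1 : rk n F 0 1 = ((Finset.Icc (0 : ℤ) (n - 1)).filter fun a => ¬ (n : ℤ) ≤ f a).card := by
    rw [rk]
    congr 1
    refine Finset.card_bij' (fun a _ => -a) (fun a _ => -a) ?_ ?_ ?_ ?_
    · intro a; simp only [Finset.mem_filter, Finset.mem_Icc, e]; lia
    · intro a; simp only [Finset.mem_filter, Finset.mem_Icc, e, neg_neg]; lia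
    · intros; simp
    · intros; simp
  have h2 := Finset.card_filter_add_card_filter_not (s := Finset.Icc (0 : ℤ) (n - 1))
    (fun a => (n : ℤ) ≤ f a)
  rw [Int.card_Icc] at h2
  rw [h1]
  lia

theorem IsReverse.symm {k' : ℕ} {f : Bound k n} {f' : Bound k' n} (h : IsReverse f f') :
    IsReverse f' f := fun x => by rw [h, neg_neg]; ring

theorem IsReverse.step {k' : ℕ} {f' g' : Bound k' n} (hf : IsReverse f f') (hg : IsReverse g g')
    (s : Step f g a b) : Step f' g' (-b) (-a) := by
  have h1 := s.lt
  have h2 := s.val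
  have h3 := s.swap.left
  have h4 := s.swap.right
  refine ⟨by lia, ?_, fun c hc hc' h => ?_, ?_, ?_, ?_, fun x hx hx' => ?_⟩
  · rw [hf, hf, neg_neg, neg_neg]
    lia
  · rw [hf, hf, hf, neg_neg, neg_neg] at h
    exact s.none (-c) (by lia) (by lia) ⟨by lia, by lia⟩
  · exact fun h => s.swap.not_modEq (by simpa using h.neg.symm)
  · rw [hf, hg, neg_neg, neg_neg, h4]
  · rw [hf, hg, neg_neg, neg_neg, h3]
  · rw [hf, hg, s.swap.off]
    · exact fun h => hx' (by simpa using h.neg)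
    · exact fun h => hx (by simpa using h.neg)

/-- The effect of reversal on labels. -/
def revKey (n : ℕ) (k : ℤ ×ₗ ℤ) : ℤ ×ₗ ℤ := toLex (2 * n - (ofLex k).1, -(ofLex k).2)

theorem revKey_lt_iff {j l : ℤ ×ₗ ℤ} : revKey n j < revKey n l ↔ l < j := by
  simp only [Prod.Lex.lt_iff, revKey, ofLex_toLex]
  lia

theorem revKey_injective : Function.Injective (revKey n) := fun j l h => by
  simp only [revKey, toLex_inj, Prod.mk.injEq] at h
  exact ofLex_inj.1 (Prod.ext (by lia) (by lia))

theorem revKey_key (hne : pri a ≠ pri b) :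
    key n (fun x => pri (-x)) (-b) (-a) = revKey n (key n pri a b) := by
  rcases lt_or_gt_of_ne hne with h | h
  · rw [key_up h, key_down (by simpa using h), revKey]
    simp only [ofLex_toLex, neg_neg]
    congr 2
    ring
  · rw [key_down h, key_up (by simpa using h), revKey]
    simp only [ofLex_toLex, neg_neg]
    congr 2 <;> ring

theorem KeyPath.reverse (hn : 0 < n) (hp : IsPriority n pri) {k' : ℕ} (hk : k + k' = n)
    (q : KeyPath pri f g ks) : ∀ {f' g' : Bound k' n}, IsReverse f f' → IsReverse g g' →
      KeyPath (fun x => pri (-x)) f' g' (ks.map (revKey n)) := by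
  induction q with
  | nil f =>
    intro f' g' hf hg
    obtain rfl : f' = g' := ext_fun fun x => by rw [hf, hg]
    exact .nil _
  | @cons f f1 g a b ks s q ih =>
    intro f' g' hf hg
    obtain ⟨f1', hf1⟩ := exists_reverse hn hk f1
    rw [List.map_cons, ← revKey_key (s.pri_ne hp)]
    exact .cons (hf.step hf1 s) (ih hf1 hg)

theorem isPriority_neg (hp : IsPriority n pri) : IsPriority n fun x => pri (-x) :=
  ⟨fun x => hp.nonneg _, fun x => hp.lt _, fun x y => by
    rw [hp.eq_iff]
    exact ⟨fun h => by simpa using h.neg, fun h => h.neg⟩, fun l h1 h2 => by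
    obtain ⟨p, rfl⟩ := hp.surj l h1 h2
    exact ⟨-p, by rw [neg_neg]⟩⟩

theorem RankLE.exists_falling (hn : 0 < n) (hkn : k ≤ n) (hp : IsPriority n pri) (H : RankLE f g) :
    ∃ ks, KeyPath pri f g ks ∧ ks.Pairwise (· > ·) := by
  obtain ⟨ls, q, -⟩ := H.exists_rising hn hp
  obtain ⟨f', hf⟩ := exists_reverse (k' := n - k) hn (by lia) f
  obtain ⟨g', hg⟩ := exists_reverse (k' := n - k) hn (by lia) g
  obtain ⟨ks, q', hs⟩ :=
    (q.reverse hn hp (by lia) hf hg).rankLE.exists_rising hn (isPriority_neg hp)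
  have := q'.reverse hn (isPriority_neg hp) (by lia) hf.symm hg.symm
  simp only [neg_neg] at this
  refine ⟨_, this, List.pairwise_map.2 (hs.imp fun h => ?_)⟩
  exact revKey_lt_iff.2 h

theorem KeyPath.falling_unique (hn : 0 < n) (hkn : k ≤ n) (hp : IsPriority n pri)
    (q1 : KeyPath pri f g ks) (hs1 : ks.Pairwise (· > ·)) (q2 : KeyPath pri f g ls)
    (hs2 : ls.Pairwise (· > ·)) : ks = ls := by
  obtain ⟨f', hf⟩ := exists_reverse (k' := n - k) hn (by lia) f
  obtain ⟨g', hg⟩ := exists_reverse (k' := n - k) hn (by lia) g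
  refine List.map_injective_iff.2 (revKey_injective (n := n))
    ((q1.reverse hn hp (by lia) hf hg).rising_unique (isPriority_neg hp) ?_
      (q2.reverse hn hp (by lia) hf hg) ?_)
  · exact List.pairwise_map.2 (hs1.imp fun h => revKey_lt_iff.2 h)
  · exact List.pairwise_map.2 (hs2.imp fun h => revKey_lt_iff.2 h)

theorem three_swaps {x h e y : Bound k n} {p q1 q2 q3 u v : ℤ} (s1 : Swapped n x h p q1)
    (s2 : Swapped n h y p q2) (s3 : Swapped n x e p q3) (s4 : Swapped n e y u v)
    (h12 : ¬ q1 ≡ q2 [ZMOD n]) (h13 : ¬ q1 ≡ q3 [ZMOD n]) (h23 : ¬ q2 ≡ q3 [ZMOD n]) : False := by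
  have n1 := s1.not_modEq
  have n2 := s2.not_modEq
  have n3 := s3.not_modEq
  have ne : ∀ {c d : ℤ}, ¬ c ≡ d [ZMOD n] → x c ≠ x d := fun h e => h (by rw [x.inj.1 e])
  have y1 : y q1 = x p := by rw [s2.off q1 (fun h => n1 h.symm) h12, s1.right]
  have yp : y p = x q2 := by
    rw [s2.left, s1.off q2 (fun h => n2 h.symm) fun h => h12 h.symm]
  have y3 : y q3 = x q3 := by
    rw [s2.off q3 (fun h => n3 h.symm) fun h => h23 h.symm,
      s1.off q3 (fun h => n3 h.symm) fun h => h13 h.symm]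
  have t3 : q3 ≡ u [ZMOD n] ∨ q3 ≡ v [ZMOD n] := by
    by_contra hc
    push Not at hc
    have := s4.off q3 hc.1 hc.2
    rw [y3, s3.right] at this
    exact ne (fun h => n3 h.symm) this
  have tp : p ≡ u [ZMOD n] ∨ p ≡ v [ZMOD n] := by
    by_contra hc
    push Not at hc
    have := s4.off p hc.1 hc.2
    rw [yp, s3.left] at this
    exact ne h23 this
  have u1 : ¬ q1 ≡ u [ZMOD n] := fun h => by
    rcases t3 with t3 | t3
    · exact h13 (h.trans t3.symm)
    · rcases tp with tp | tp
      · exact n1 (tp.trans h.symm)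
      · exact n3 (tp.trans t3.symm)
  have v1 : ¬ q1 ≡ v [ZMOD n] := fun h => by
    rcases t3 with t3 | t3
    · rcases tp with tp | tp
      · exact n3 (tp.trans t3.symm)
      · exact n1 (tp.trans h.symm)
    · exact h13 (h.trans t3.symm)
  have := s4.off q1 u1 v1
  rw [y1, s3.off q1 (fun h => n1 h.symm) h13] at this
  exact ne n1 this

/-- An exchange of positions `a < b < a + n` whose values are related by `R`. -/
structure Exchange (R : ℤ → ℤ → Prop) (f g : Bound k n) (a b : ℤ) : Prop where
  lt : a < b
  lt_add : b < a + n
  rel : R (f a) (f b)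
  swap : Swapped n f g a b

theorem Exchange.translate {R : ℤ → ℤ → Prop} (hR : ∀ x y c, R x y → R (x + c) (y + c))
    (s : Exchange R f g a b) (r : ℤ) : Exchange R f g (a + r * n) (b + r * n) := by
  have e1 : a + r * n ≡ a [ZMOD n] := modEq_iff_exists.2 ⟨r, rfl⟩
  have e2 : b + r * n ≡ b [ZMOD n] := modEq_iff_exists.2 ⟨r, rfl⟩
  refine ⟨by linarith [s.lt], by linarith [s.lt_add], ?_, ?_, ?_, ?_, ?_⟩
  · rw [f.add_mul, f.add_mul]
    exact hR _ _ _ s.rel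
  · exact fun h => s.swap.not_modEq (e1.symm.trans (h.trans e2))
  · rw [f.add_mul, g.add_mul, s.swap.left]
  · rw [f.add_mul, g.add_mul, s.swap.right]
  · exact fun x h1 h2 => s.swap.off x (fun h => h1 (h.trans e1.symm)) fun h => h2 (h.trans e2.symm)

theorem Exchange.trichotomy (hp : IsPriority n pri) {R : ℤ → ℤ → Prop}
    (hR : ∀ x y c, R x y → R (x + c) (y + c)) (s : Exchange R f g a b) (ha : pri p ≤ pri a)
    (hb : pri p ≤ pri b) :
    (∃ q, Swapped n f g p q ∧ p < q ∧ q < p + n ∧ R (f p) (g p) ∧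
      key n pri a b = toLex (pri p, q - p)) ∨
    (pri p < pri a ∧ pri p < pri b ∧ g p = f p ∧ pri p < (ofLex (key n pri a b)).1 ∧
      (ofLex (key n pri a b)).1 < 2 * n - pri p) ∨
    (∃ q, Swapped n f g p q ∧ p - n < q ∧ q < p ∧ R (g p) (f p) ∧
      key n pri a b = toLex (2 * (n : ℤ) - pri p, q - p)) := by
  have hne : pri a ≠ pri b := fun e => s.swap.not_modEq ((hp.eq_iff _ _).1 e)
  rcases ha.eq_or_lt with ha | ha
  · left
    obtain ⟨r, rfl⟩ := modEq_iff_exists.1 ((hp.eq_iff _ _).1 ha)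
    have s' := s.translate hR r
    refine ⟨b + r * n, s'.swap, s'.lt, s'.lt_add, by rw [s'.swap.left]; exact s'.rel, ?_⟩
    rw [← key_translate hp a b r, key_up (by rw [pri_add_mul hp b]; lia)]
  · rcases hb.eq_or_lt with hb | hb
    · right; right
      obtain ⟨r, rfl⟩ := modEq_iff_exists.1 ((hp.eq_iff _ _).1 hb)
      have s' := s.translate hR r
      refine ⟨a + r * n, s'.swap.comm, by have := s'.lt_add; lia, s'.lt, by
        rw [s'.swap.right]; exact s'.rel, ?_⟩
      rw [← key_translate hp a b r, key_down (by rw [pri_add_mul hp a]; lia)]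
    · right; left
      refine ⟨ha, hb, s.swap.off p (fun e => ?_) fun e => ?_, ?_⟩
      · rw [(hp.eq_iff _ _).2 e] at ha; lia
      · rw [(hp.eq_iff _ _).2 e] at hb; lia
      · have := hp.lt a
        have := hp.lt b
        have := hp.lt p
        rcases lt_or_gt_of_ne hne with h | h
        · rw [key_up h]; simp only [ofLex_toLex]; lia
        · rw [key_down h]; simp only [ofLex_toLex]; lia

theorem not_nested (hp : IsPriority n pri) {R : ℤ → ℤ → Prop} [IsStrictOrder ℤ R]
    (hR : ∀ x y c, R x y → R (x + c) (y + c)) {x h e y : Bound k n} {a1 b1 a2 b2 a3 b3 a4 b4 : ℤ}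
    (s1 : Exchange R x h a1 b1) (s2 : Exchange R h y a2 b2) (s3 : Exchange R x e a3 b3)
    (s4 : Exchange R e y a4 b4) (h21 : key n pri a2 b2 < key n pri a1 b1)
    (h13 : key n pri a1 b1 < key n pri a3 b3) (h34 : key n pri a3 b3 < key n pri a4 b4) : False := by
  obtain ⟨p, hpm, hmin⟩ := Finset.exists_min_image ({a1, b1, a2, b2, a3, b3, a4, b4} : Finset ℤ) pri
    ⟨a1, by simp⟩
  have hm : ∀ {z : ℤ}, z ∈ ({a1, b1, a2, b2, a3, b3, a4, b4} : Finset ℤ) → pri p ≤ pri z :=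
    fun hz => hmin _ hz
  have f21 := fst_le_of_lt h21
  have f13 := fst_le_of_lt h13
  have f34 := fst_le_of_lt h34
  have hpn := hp.lt p
  have lt_of : ∀ {c d e : ℤ}, toLex (c, d) < toLex (c, e) → d < e := fun h => by
    rcases Prod.Lex.lt_iff.1 h with h | h
    · simp at h
    · simpa using h.2
  have nc : ∀ {c d : ℤ}, c < d → d < c + n → ¬ c ≡ d [ZMOD n] := fun h1 h2 h3 =>
    not_modEq_of_lt h1 h2 h3.symm
  have t1 := s1.trichotomy hp hR (p := p) (hm (by simp)) (hm (by simp))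
  have t2 := s2.trichotomy hp hR (p := p) (hm (by simp)) (hm (by simp))
  have t3 := s3.trichotomy hp hR (p := p) (hm (by simp)) (hm (by simp))
  have t4 := s4.trichotomy hp hR (p := p) (hm (by simp)) (hm (by simp))
  have irr : ∀ c, ¬ R c c := fun c => irrefl_of R c
  have tr : ∀ {c d e}, R c d → R d e → R c e := fun h1 h2 => trans_of R h1 h2
  -- an upward third label forces three upward labels
  rcases t3 with ⟨q3, w3, u3, u3', r3, k3⟩ | ⟨c3, d3, v3, m3, m3'⟩ | ⟨q3, w3, u3, u3', r3, k3⟩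
  · have g3 : (ofLex (key n pri a3 b3)).1 = pri p := by rw [k3]; rfl
    rcases t1 with ⟨q1, w1, u1, u1', r1, k1⟩ | ⟨-, -, -, m1, -⟩ | ⟨q1, -, -, -, -, k1⟩
    · have g1 : (ofLex (key n pri a1 b1)).1 = pri p := by rw [k1]; rfl
      rcases t2 with ⟨q2, w2, u2, u2', r2, k2⟩ | ⟨-, -, -, m2, -⟩ | ⟨q2, -, -, -, -, k2⟩
      · rw [k1, k2] at h21
        rw [k1, k3] at h13
        have l1 := lt_of h21
        have l2 := lt_of h13
        exact three_swaps w1 w2 w3 s4.swap (fun h => nc (c := q2) (d := q1) (by lia) (by lia) h.symm)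
          (nc (by lia) (by lia)) (nc (by lia) (by lia))
      · lia
      · rw [k2] at f21; simp only [ofLex_toLex] at f21; lia
    · lia
    · rw [k1] at f13; simp only [ofLex_toLex] at f13; lia
  · have top : R (y p) (x p) ∨ (y p = x p ∧ pri p < pri a4 ∧ pri p < pri b4) := by
      rcases t4 with ⟨q4, w4, u4, u4', r4, k4⟩ | ⟨c4, d4, v4, -, -⟩ | ⟨q4, w4, u4, u4', r4, k4⟩
      · rw [k4] at f34; simp only [ofLex_toLex] at f34; lia
      · exact Or.inr ⟨v4.trans v3, c4, d4⟩
      · rw [v3] at r4; exact Or.inl r4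
    have bot : R (x p) (y p) ∨ (y p = x p ∧ pri p < pri a1 ∧ pri p < pri b1 ∧ pri p < pri a2 ∧
        pri p < pri b2) := by
      rcases t1 with ⟨q1, w1, u1, u1', r1, k1⟩ | ⟨c1, d1, v1, m1, m1'⟩ | ⟨q1, w1, u1, u1', r1, k1⟩
      · rcases t2 with ⟨q2, w2, u2, u2', r2, k2⟩ | ⟨c2, d2, v2, m2, -⟩ | ⟨q2, -, -, -, -, k2⟩
        · exact Or.inl (tr r1 r2)
        · rw [v2]; exact Or.inl r1
        · rw [k1, k2] at f21; simp only [ofLex_toLex] at f21; lia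
      · rcases t2 with ⟨q2, w2, u2, u2', r2, k2⟩ | ⟨c2, d2, v2, m2, -⟩ | ⟨q2, -, -, -, -, k2⟩
        · rw [v1] at r2; exact Or.inl r2
        · exact Or.inr ⟨v2.trans v1, c1, d1, c2, d2⟩
        · rw [k2] at f21; simp only [ofLex_toLex] at f21; lia
      · rw [k1] at f13; simp only [ofLex_toLex] at f13; lia
    rcases top with t | t <;> rcases bot with b | b
    · exact irr _ (tr t b)
    · rw [b.1] at t; exact irr _ t
    · rw [t.1] at b; exact irr _ b
    · simp only [Finset.mem_insert, Finset.mem_singleton] at hpm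
      rcases hpm with rfl | rfl | rfl | rfl | rfl | rfl | rfl | rfl <;> lia
  · have g3 : (ofLex (key n pri a3 b3)).1 = 2 * n - pri p := by rw [k3]; rfl
    rcases t4 with ⟨q4, w4, u4, u4', r4, k4⟩ | ⟨-, -, -, -, m4⟩ | ⟨q4, w4, u4, u4', r4, k4⟩
    · rw [k4] at f34; simp only [ofLex_toLex] at f34; lia
    · lia
    · have top : R (y p) (x p) := tr r4 r3
      rcases t1 with ⟨q1, w1, u1, u1', r1, k1⟩ | ⟨c1, d1, v1, m1, m1'⟩ | ⟨q1, w1, u1, u1', r1, k1⟩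
      · rcases t2 with ⟨q2, w2, u2, u2', r2, k2⟩ | ⟨c2, d2, v2, m2, -⟩ | ⟨q2, -, -, -, -, k2⟩
        · exact irr _ (tr top (tr r1 r2))
        · rw [← v2] at r1; exact irr _ (tr top r1)
        · rw [k1, k2] at f21; simp only [ofLex_toLex] at f21; lia
      · rcases t2 with ⟨q2, w2, u2, u2', r2, k2⟩ | ⟨c2, d2, v2, m2, -⟩ | ⟨q2, -, -, -, -, k2⟩
        · rw [v1] at r2; exact irr _ (tr top r2)
        · rw [v2, v1] at top; exact irr _ top
        · rw [k2] at f21; simp only [ofLex_toLex] at f21; lia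
      · rw [k1, k3] at h13
        rw [k3, k4] at h34
        have l1 := lt_of h13
        have l2 := lt_of h34
        exact three_swaps w3 w4 w1 s2.swap (nc (by lia) (by lia))
          (fun h => nc (c := q1) (d := q3) (by lia) (by lia) h.symm)
          (fun h => nc (c := q1) (d := q4) (by lia) (by lia) h.symm)

theorem Step.exchange (s : Step f g a b) : Exchange (· < ·) f g a b :=
  ⟨s.lt, s.lt_add, s.val, s.swap⟩

theorem Step.exchange_symm (s : Step f g a b) : Exchange (· > ·) g f a b :=
  ⟨s.lt, s.lt_add, by rw [s.swap.left, s.swap.right]; exact s.val, s.swap.symm⟩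

theorem goodLabeling (hn : 0 < n) (hkn : k ≤ n) (hp : IsPriority n pri) :
    GoodLabeling (fun f : Bound k n => (affLength n f.toPerm : ℤ)) (label pri) := by
  refine ⟨strictMono_affLength, fun c => ?_, fun {f g} h => ?_, fun q1 h1 q2 h2 =>
    (keyPath_of_path hn hp q1).rising_unique hp h1 (keyPath_of_path hn hp q2) h2,
    fun {f g} h => ?_, fun q1 h1 q2 h2 =>
    (keyPath_of_path hn hp q1).falling_unique hn hkn hp h1 (keyPath_of_path hn hp q2) h2,
    fun {x h e} c1 c2 heq => ?_, fun {h e y} c1 c2 heq => ?_, fun c1 c2 heq => ?_,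
    fun c1 c2 c3 c4 hlt => ?_, fun c1 c2 c3 c4 hlt => ?_⟩
  · obtain ⟨a, b, s⟩ := (covBy_iff_step hn).1 c
    have := s.affLength_eq hn
    simp only [this]
    push_cast
    rfl
  · obtain ⟨ks, q, hs⟩ := ((le_iff_rankLE hn).1 h).exists_rising hn hp
    exact ⟨ks, q.path hn hp, hs⟩
  · obtain ⟨ks, q, hs⟩ := ((le_iff_rankLE hn).1 h).exists_falling hn hkn hp
    exact ⟨ks, q.path hn hp, hs⟩
  · obtain ⟨a, b, s⟩ := (covBy_iff_step hn).1 c1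
    obtain ⟨a', b', s'⟩ := (covBy_iff_step hn).1 c2
    rw [label_eq hp s, label_eq hp s'] at heq
    obtain ⟨r, rfl, rfl⟩ := key_eq hp (s.pri_ne hp) (s'.pri_ne hp) heq
    exact swapped_unique (s.translate r).swap s'.swap
  · obtain ⟨a, b, s⟩ := (covBy_iff_step hn).1 c1
    obtain ⟨a', b', s'⟩ := (covBy_iff_step hn).1 c2
    rw [label_eq hp s, label_eq hp s'] at heq
    obtain ⟨r, rfl, rfl⟩ := key_eq hp (s.pri_ne hp) (s'.pri_ne hp) heq
    exact swapped_unique (s.translate r).swap.symm s'.swap.symm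
  · obtain ⟨a, b, s⟩ := (covBy_iff_step hn).1 c1
    obtain ⟨a', b', s'⟩ := (covBy_iff_step hn).1 c2
    rw [label_eq hp s, label_eq hp s'] at heq
    obtain ⟨r, rfl, rfl⟩ := key_eq hp (s.pri_ne hp) (s'.pri_ne hp) heq
    have t := s.translate r
    have h1 := t.val
    have h2 := s'.val
    rw [t.swap.left, t.swap.right] at h2
    exact lt_asymm h1 h2
  · obtain ⟨a1, b1, s1⟩ := (covBy_iff_step hn).1 c1
    obtain ⟨a2, b2, s2⟩ := (covBy_iff_step hn).1 c2
    obtain ⟨a3, b3, s3⟩ := (covBy_iff_step hn).1 c3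
    obtain ⟨a4, b4, s4⟩ := (covBy_iff_step hn).1 c4
    rw [label_eq hp s1, label_eq hp s2, label_eq hp s3, label_eq hp s4] at hlt
    exact not_nested hp (fun x y c h => by simpa using h) s1.exchange s2.exchange s3.exchange
      s4.exchange hlt.1 hlt.2.1 hlt.2.2
  · obtain ⟨a1, b1, s1⟩ := (covBy_iff_step hn).1 c1
    obtain ⟨a2, b2, s2⟩ := (covBy_iff_step hn).1 c2
    obtain ⟨a3, b3, s3⟩ := (covBy_iff_step hn).1 c3
    obtain ⟨a4, b4, s4⟩ := (covBy_iff_step hn).1 c4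
    rw [label_eq hp s1, label_eq hp s2, label_eq hp s3, label_eq hp s4] at hlt
    exact not_nested hp (fun x y c h => by simpa using h) s2.exchange_symm s1.exchange_symm
      s4.exchange_symm s3.exchange_symm hlt.1 hlt.2.1 hlt.2.2

/-- `Bound k n` has a good labeling, for all `k ≤ n`. -/
theorem exists_goodLabeling (hkn : k ≤ n) :
    ∃ (grade : Bound k n → ℤ) (lab : Bound k n → Bound k n → ℤ ×ₗ ℤ), GoodLabeling grade lab := by
  rcases Nat.eq_zero_or_pos n with rfl | hn
  · have : Subsingleton (Bound k 0) := ⟨fun f g => ext_fun fun x => by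
      have h1 := f.bounded x
      have h2 := g.bounded x
      simp only [Nat.cast_zero, add_zero] at h1 h2
      lia⟩
    exact ⟨fun _ => 0, fun _ _ => toLex (0, 0), .of_subsingleton _ _⟩
  · exact ⟨_, _, goodLabeling hn hkn (isPriority_emod hn)⟩

end Bound

end BoundLabeling

section JugglingIso

variable {k n : ℕ}

theorem card_filter_orderEmb (I : Finset ℤ) (hI : I.card = k) (y : ℤ) :
    (I.filter fun x => y ≤ x).card =
      (Finset.univ.filter fun r : Fin k => y ≤ I.orderEmbOfFin hI r).card := by
  conv_lhs => rw [← Finset.image_orderEmbOfFin_univ I hI, Finset.filter_image]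
  exact Finset.card_image_of_injective _ (I.orderEmbOfFin hI).injective

theorem subsetLE_iff {I J : Finset ℤ} {hI : I.card = k} {hJ : J.card = k} :
    subsetLE I J hI hJ ↔
      ∀ y, (I.filter fun x => y ≤ x).card ≤ (J.filter fun x => y ≤ x).card := by
  constructor
  · intro h y
    rw [card_filter_orderEmb I hI, card_filter_orderEmb J hJ]
    refine Finset.card_le_card fun r hr => ?_
    simp only [Finset.mem_filter, Finset.mem_univ, true_and] at hr ⊢
    exact hr.trans (h r)
  · intro h r
    by_contra! hlt
    have h1 := h (I.orderEmbOfFin hI r)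
    rw [card_filter_orderEmb I hI, card_filter_orderEmb J hJ] at h1
    have h2 : (Finset.univ.filter fun r' : Fin k =>
        I.orderEmbOfFin hI r ≤ I.orderEmbOfFin hI r') = Finset.Ici r := by
      ext r'; simp
    have h3 : (Finset.univ.filter fun r' : Fin k =>
        I.orderEmbOfFin hI r ≤ J.orderEmbOfFin hJ r') ⊆ Finset.Ioi r := by
      intro r' hr'
      simp only [Finset.mem_filter, Finset.mem_univ, true_and, Finset.mem_Ioi] at hr' ⊢
      exact (J.orderEmbOfFin hJ).lt_iff_lt.1 (hlt.trans_le hr')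
    have h4 := Finset.card_le_card h3
    rw [h2, Fin.card_Ici] at h1
    rw [Fin.card_Ioi] at h4
    have := r.2
    lia

theorem subsetLE_iff_of_subset {I J : Finset ℤ} {hI : I.card = k} {hJ : J.card = k}
    (h1 : I ⊆ Finset.Icc 1 (n : ℤ)) (h2 : J ⊆ Finset.Icc 1 (n : ℤ)) : subsetLE I J hI hJ ↔
      ∀ y, 1 ≤ y → (I.filter fun x => y ≤ x).card ≤ (J.filter fun x => y ≤ x).card := by
  rw [subsetLE_iff]
  refine ⟨fun h y _ => h y, fun h y => ?_⟩
  rcases le_or_gt 1 y with hy | hy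
  · exact h y hy
  · rw [Finset.filter_true_of_mem fun x hx => by have := Finset.mem_Icc.1 (h1 hx); lia,
      Finset.filter_true_of_mem fun x hx => by have := Finset.mem_Icc.1 (h2 hx); lia, hI, hJ]

namespace Bound

variable {f g : Bound k n}

/-- The juggling state of `f` at time `m`. -/
noncomputable def stateAt (f : Bound k n) (m : ℤ) : Finset ℤ :=
  (Finset.Icc 1 (n : ℤ)).filter fun y => f.toPerm.symm (y + m - 1) < m

theorem symm_bounds (f : Bound k n) (y : ℤ) :
    f.toPerm.symm y ≤ y ∧ y ≤ f.toPerm.symm y + n := by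
  have h1 := f.le_apply (f.toPerm.symm y)
  have h2 := f.apply_le (f.toPerm.symm y)
  rw [Equiv.apply_symm_apply] at h1 h2
  exact ⟨h1, h2⟩

theorem symm_add_mul (f : Bound k n) (y r : ℤ) :
    f.toPerm.symm (y + r * n) = f.toPerm.symm y + r * n := by
  rw [Equiv.symm_apply_eq, f.add_mul, Equiv.apply_symm_apply]

theorem mem_stateAt {m y : ℤ} (hy : 1 ≤ y) :
    y ∈ f.stateAt m ↔ f.toPerm.symm (y + m - 1) < m := by
  have := f.symm_bounds (y + m - 1)
  simp only [stateAt, Finset.mem_filter, Finset.mem_Icc]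
  lia

theorem mem_stateAt_union {m y : ℤ} :
    y ∈ (f.stateAt m : Set ℤ) ∪ Set.Iic 0 ↔ f.toPerm.symm (y + m - 1) < m := by
  rcases le_or_gt 1 y with hy | hy
  · rw [← mem_stateAt hy]
    simp only [Set.mem_union, Finset.mem_coe, Set.mem_Iic]
    lia
  · have := f.symm_bounds (y + m - 1)
    simp only [Set.mem_union, Finset.mem_coe, Set.mem_Iic]
    lia

theorem stateAt_add_mul (f : Bound k n) (m r : ℤ) : f.stateAt (m + r * n) = f.stateAt m := by
  ext y
  simp only [stateAt, Finset.mem_filter]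
  rw [show y + (m + r * n) - 1 = (y + m - 1) + r * n by ring, f.symm_add_mul, add_lt_add_iff_right]

theorem card_filter_stateAt (f : Bound k n) (m : ℤ) {y : ℤ} (hy : 1 ≤ y) :
    (((f.stateAt m).filter fun x => y ≤ x).card : ℤ) = rk n f.toPerm (m - 1) (y + m - 1) := by
  rw [rk, Nat.cast_inj]
  symm
  refine Finset.card_bij' (fun a _ => f a - m + 1) (fun z _ => f.toPerm.symm (z + m - 1)) ?_ ?_ ?_ ?_
  · intro a ha
    simp only [Finset.mem_filter, Finset.mem_Icc] at ha ⊢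
    rw [mem_stateAt (by lia), show f a - m + 1 + m - 1 = f a by ring, Equiv.symm_apply_apply]
    lia
  · intro z hz
    simp only [Finset.mem_filter, Finset.mem_Icc] at hz ⊢
    have h1 := f.symm_bounds (z + m - 1)
    have h2 := (mem_stateAt (hy.trans hz.2)).1 hz.1
    rw [Equiv.apply_symm_apply]
    lia
  · intro a _
    simp only [show f a - m + 1 + m - 1 = f a by ring, Equiv.symm_apply_apply]
  · intro z _
    simp only [Equiv.apply_symm_apply]
    ring

theorem canFollow_stateAt (f : Bound k n) (m : ℤ) :
    CanFollow (↑(f.stateAt m) ∪ Set.Iic 0) (↑(f.stateAt (m + 1)) ∪ Set.Iic 0) := by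
  refine ⟨f m - m, ?_, ?_⟩
  · rw [Set.mem_ofPred_eq, mem_stateAt_union, show f m - m + 1 + m - 1 = f m by ring,
      Equiv.symm_apply_apply]
    exact lt_irrefl m
  · ext y
    rw [mem_stateAt_union, Set.mem_insert_iff, Set.mem_ofPred_eq, mem_stateAt_union,
      show y + (m + 1) - 1 = y + m by ring, show y + 1 + m - 1 = y + m by ring,
      Int.lt_add_one_iff, le_iff_lt_or_eq, or_comm, Equiv.symm_apply_eq]
    exact or_congr ⟨fun h => by lia, fun h => by lia⟩ Iff.rfl

theorem finRotate_val (i : Fin n) :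
    ∃ r : ℤ, ((finRotate n i : Fin n) : ℤ) = (i : ℤ) + 1 + r * n := by
  obtain _ | n := n
  · exact i.elim0
  · rcases eq_or_ne i (Fin.last n) with rfl | h
    · exact ⟨-1, by rw [finRotate_last]; simp⟩
    · exact ⟨0, by rw [coe_finRotate_of_ne_last h]; simp⟩

/-- The sequence of juggling states of a bounded affine permutation. -/
noncomputable def toJugg (hn : 0 < n) (f : Bound k n) : Jugg k n where
  state i := f.stateAt i
  subset _ := Finset.filter_subset _ _
  card i := by
    have h := f.card_filter_stateAt i le_rfl
    rw [Finset.filter_true_of_mem (s := f.stateAt i)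
      fun x hx => (Finset.mem_Icc.1 (Finset.mem_filter.1 hx).1).1,
      show 1 + (i : ℤ) - 1 = i - 1 + 1 by ring, f.isBounded.rk_diag, f.rk_zero_one hn] at h
    exact_mod_cast h
  follow i := by
    obtain ⟨r, hr⟩ := finRotate_val i
    rw [hr, stateAt_add_mul]
    exact f.canFollow_stateAt i

theorem toJugg_le_toJugg (hn : 0 < n) : toJugg hn f ≤ toJugg hn g ↔ f ≤ g := by
  rw [le_iff_rankLE hn]
  have key : toJugg hn f ≤ toJugg hn g ↔ ∀ (i : Fin n) (y : ℤ), 1 ≤ y →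
      0 ≤ gap f g (i - 1) (y + i - 1) := by
    refine forall_congr' fun i => ?_
    rw [subsetLE_iff_of_subset ((toJugg hn f).subset i) ((toJugg hn g).subset i)]
    refine forall_congr' fun y => forall_congr' fun hy => ?_
    rw [gap, sub_nonneg, ← f.card_filter_stateAt i hy, ← g.card_filter_stateAt i hy, Nat.cast_le]
    rfl
  rw [key]
  refine ⟨fun h x y => ?_, fun h i y _ => h _ _⟩
  rcases le_or_gt y (x + 1) with hy | hy
  · rw [gap_eq_zero_of_le hn f g hy]
  have hn' : (0 : ℤ) < n := by exact_mod_cast hn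
  have h1 := Int.emod_nonneg (x + 1) hn'.ne'
  have h2 := Int.emod_lt_of_pos (x + 1) hn'
  have h3 := Int.emod_add_mul_ediv (x + 1) n
  have := h ⟨((x + 1) % n).toNat, by lia⟩ (y - x) (by lia)
  rw [← gap_add f g _ _ ((x + 1) / n)] at this
  simp only [Int.toNat_of_nonneg h1] at this
  rwa [show (x + 1) % n - 1 + (x + 1) / n * n = x by linarith,
    show y - x + (x + 1) % n - 1 + (x + 1) / n * n = y by linarith] at this

end Bound

namespace Jugg

/-- The juggling state at time `m`, extended by the non-positive integers. -/
def stateAt (hn : 0 < n) (J : Jugg k n) (m : ℤ) : Set ℤ :=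
  ↑(J.state ⟨(m % n).toNat, by
    have := Int.emod_lt_of_pos m (show (0 : ℤ) < n by exact_mod_cast hn)
    have := Int.emod_nonneg m (show (n : ℤ) ≠ 0 by exact_mod_cast hn.ne')
    lia⟩) ∪ Set.Iic 0

theorem stateAt_add (hn : 0 < n) (J : Jugg k n) (m : ℤ) : J.stateAt hn (m + n) = J.stateAt hn m := by
  simp only [stateAt, Int.add_emod_right]

theorem canFollow_stateAt (hn : 0 < n) (J : Jugg k n) (m : ℤ) :
    CanFollow (J.stateAt hn m) (J.stateAt hn (m + 1)) := by
  have hn' : (0 : ℤ) < n := by exact_mod_cast hn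
  rw [stateAt, stateAt]
  convert J.follow _ using 6
  obtain ⟨r, hr⟩ := Bound.finRotate_val (⟨(m % n).toNat, by
    have := Int.emod_lt_of_pos m hn'
    have := Int.emod_nonneg m hn'.ne'
    lia⟩ : Fin n)
  rw [← Nat.cast_inj (R := ℤ)]
  have h1 := Int.emod_lt_of_pos (m + 1) hn'
  have h2 := Int.emod_nonneg (m + 1) hn'.ne'
  have h3 := Int.emod_nonneg m hn'.ne'
  have h4 := (finRotate n (⟨(m % n).toNat, by
    have := Int.emod_lt_of_pos m hn'
    lia⟩ : Fin n)).2
  rw [Int.toNat_of_nonneg h2]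
  simp only [Int.toNat_of_nonneg h3] at hr
  rw [show (m + 1) % (n : ℤ) = (m % n + 1 + r * n) % n by simp, ← hr]
  exact Int.emod_eq_of_lt (by positivity) (by exact_mod_cast h4)

/-- The throw at time `m`. -/
noncomputable def throw (hn : 0 < n) (J : Jugg k n) (m : ℤ) : ℤ :=
  (J.canFollow_stateAt hn m).choose

theorem throw_add_one_notMem (hn : 0 < n) (J : Jugg k n) (m : ℤ) :
    J.throw hn m + 1 ∉ J.stateAt hn m :=
  (J.canFollow_stateAt hn m).choose_spec.1

theorem mem_stateAt_succ (hn : 0 < n) (J : Jugg k n) (m y : ℤ) :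
    y ∈ J.stateAt hn (m + 1) ↔ y = J.throw hn m ∨ y + 1 ∈ J.stateAt hn m := by
  rw [(J.canFollow_stateAt hn m).choose_spec.2, Set.mem_insert_iff]
  rfl

theorem throw_add (hn : 0 < n) (J : Jugg k n) (m : ℤ) : J.throw hn (m + n) = J.throw hn m := by
  have h1 := J.mem_stateAt_succ hn (m + n) (J.throw hn (m + n))
  have h2 := J.throw_add_one_notMem hn (m + n)
  rw [stateAt_add] at h2
  rw [stateAt_add, add_right_comm, stateAt_add, mem_stateAt_succ] at h1
  have := h1.2 (Or.inl rfl)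
  tauto

theorem mem_stateAt_of_nonpos (hn : 0 < n) (J : Jugg k n) (m : ℤ) {y : ℤ} (hy : y ≤ 0) :
    y ∈ J.stateAt hn m := Or.inr hy

theorem notMem_stateAt_of_lt (hn : 0 < n) (J : Jugg k n) (m : ℤ) {y : ℤ} (hy : n < y) :
    y ∉ J.stateAt hn m := by
  rintro (h | h)
  · have := Finset.mem_Icc.1 (J.subset _ h)
    lia
  · have : y ≤ 0 := h
    lia

theorem throw_bounds (hn : 0 < n) (J : Jugg k n) (m : ℤ) :
    0 ≤ J.throw hn m ∧ J.throw hn m ≤ n := by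
  constructor
  · by_contra! h
    exact J.throw_add_one_notMem hn m (J.mem_stateAt_of_nonpos hn m (by lia))
  · by_contra! h
    exact J.notMem_stateAt_of_lt hn (m + 1) h ((J.mem_stateAt_succ hn m _).2 (Or.inl rfl))

theorem sub_mem_stateAt (hn : 0 < n) (J : Jugg k n) {m y : ℤ} (h : y ∈ J.stateAt hn m) (j : ℕ) :
    y - j ∈ J.stateAt hn (m + j) := by
  induction j with
  | zero => simpa using h
  | succ j ih =>
    push_cast
    rw [← add_assoc, mem_stateAt_succ]
    right
    rwa [show y - (j + 1 : ℤ) + 1 = y - j by ring]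

theorem throw_inj (hn : 0 < n) (J : Jugg k n) {a b : ℤ} (hab : a < b) :
    a + J.throw hn a ≠ b + J.throw hn b := by
  intro h
  obtain ⟨j, rfl⟩ : ∃ j : ℕ, b = a + 1 + j := ⟨(b - a - 1).toNat, by lia⟩
  have := J.sub_mem_stateAt hn ((J.mem_stateAt_succ hn a _).2 (Or.inl rfl)) j
  refine J.throw_add_one_notMem hn (a + 1 + j) ?_
  rwa [show J.throw hn (a + 1 + j) + 1 = J.throw hn a - j by linarith]

theorem exists_throw (hn : 0 < n) (J : Jugg k n) (y : ℤ) : ∃ m, m + J.throw hn m = y := by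
  by_contra! h
  have key : ∀ j : ℕ, n + 1 - (j : ℤ) ∉ J.stateAt hn (y - n + j) := by
    intro j
    induction j with
    | zero => exact J.notMem_stateAt_of_lt hn _ (by push_cast; lia)
    | succ j ih =>
      push_cast
      rw [← add_assoc, mem_stateAt_succ, show (n : ℤ) + 1 - (j + 1) + 1 = n + 1 - j by ring]
      rintro (h1 | h1)
      · exact h (y - n + j) (by rw [← h1]; ring)
      · exact ih h1
  exact key (n + 1) (J.mem_stateAt_of_nonpos hn _ (by push_cast; lia))

/-- The bounded affine permutation with the given juggling states. -/
noncomputable def perm (hn : 0 < n) (J : Jugg k n) : Equiv.Perm ℤ :=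
  Equiv.ofBijective (fun m => m + J.throw hn m)
    ⟨fun a b h => by
      rcases lt_trichotomy a b with hab | hab | hab
      · exact absurd h (J.throw_inj hn hab)
      · exact hab
      · exact absurd h.symm (J.throw_inj hn hab), J.exists_throw hn⟩

theorem perm_apply (hn : 0 < n) (J : Jugg k n) (m : ℤ) : J.perm hn m = m + J.throw hn m := rfl

theorem perm_isBounded (hn : 0 < n) (J : Jugg k n) : IsBounded n (J.perm hn) := by
  refine ⟨fun m => ?_, fun m => ?_, fun m => ?_⟩ <;> have := J.throw_bounds hn m <;>
    simp only [perm_apply, throw_add] <;> lia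

theorem mem_stateAt_iff (hn : 0 < n) (J : Jugg k n) (m y : ℤ) :
    y ∈ J.stateAt hn m ↔ (J.perm hn).symm (y + m - 1) < m := by
  set a := (J.perm hn).symm (y + m - 1) with ha
  have e : a + J.throw hn a = y + m - 1 := by
    rw [← perm_apply, ha, Equiv.apply_symm_apply]
  constructor
  · intro h
    by_contra! hm
    obtain ⟨j, hj⟩ : ∃ j : ℕ, a = m + j := ⟨(a - m).toNat, by lia⟩
    have := J.sub_mem_stateAt hn h j
    rw [← hj] at this
    exact J.throw_add_one_notMem hn a (by rwa [show J.throw hn a + 1 = y - j by linarith])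
  · intro h
    obtain ⟨j, hj⟩ : ∃ j : ℕ, m = a + 1 + j := ⟨(m - a - 1).toNat, by lia⟩
    have := J.sub_mem_stateAt hn ((J.mem_stateAt_succ hn a _).2 (Or.inl rfl)) j
    rwa [← hj, show J.throw hn a - j = y by linarith] at this

theorem state_eq (hn : 0 < n) (J : Jugg k n) (i : Fin n) :
    J.state i = (Finset.Icc 1 (n : ℤ)).filter fun y => (J.perm hn).symm (y + i - 1) < i := by
  ext y
  rw [Finset.mem_filter, ← mem_stateAt_iff]
  have e : J.stateAt hn i = ↑(J.state i) ∪ Set.Iic 0 := by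
    rw [stateAt]
    congr 3
    ext
    simp [Int.emod_eq_of_lt]
  rw [e]
  constructor
  · intro h
    exact ⟨J.subset _ h, Or.inl h⟩
  · rintro ⟨h1, h2 | h2⟩
    · exact h2
    · have h3 : y ≤ 0 := h2
      have := Finset.mem_Icc.1 h1
      lia

theorem rk_perm (hn : 0 < n) (J : Jugg k n) : rk n (J.perm hn) 0 1 = k := by
  have hb := J.perm_isBounded hn
  set i : Fin n := ⟨0, hn⟩ with hi
  have h := hb.rk_diag (-1)
  rw [← h]
  refine Eq.trans ?_ (congrArg Nat.cast (J.card i))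
  rw [J.state_eq hn i, rk, Nat.cast_inj]
  refine Finset.card_bij' (fun a _ => J.perm hn a + 1) (fun z _ => (J.perm hn).symm (z - 1))
    ?_ ?_ ?_ ?_
  · intro a ha
    have := hb.le' a
    simp only [Finset.mem_filter, Finset.mem_Icc, hi, Nat.cast_zero, add_zero] at ha ⊢
    rw [add_sub_cancel_right, Equiv.symm_apply_apply]
    lia
  · intro z hz
    simp only [Finset.mem_filter, Finset.mem_Icc, hi, Nat.cast_zero, add_zero] at hz ⊢
    have h1 := hb.le' ((J.perm hn).symm (z - 1))
    rw [Equiv.apply_symm_apply] at h1 ⊢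
    lia
  · intro a _
    simp
  · intro z _
    simp

theorem exists_toJugg_eq (hn : 0 < n) (J : Jugg k n) : ∃ f : Bound k n, f.toJugg hn = J :=
  ⟨Bound.ofIsBounded hn (J.perm hn) (J.perm_isBounded hn) (J.rk_perm hn),
    Jugg.ext (funext fun i => (J.state_eq hn i).symm)⟩

end Jugg

/-- Juggling sequences and bounded affine permutations form isomorphic posets. -/
noncomputable def juggIso (hn : 0 < n) : Jugg k n ≃o Bound k n :=
  (RelIso.ofSurjective (OrderEmbedding.ofMapLEIff (Bound.toJugg hn)
    fun _ _ => Bound.toJugg_le_toJugg hn) fun J => J.exists_toJugg_eq hn).symm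

theorem Jugg.eulerian_shellable (hkn : k ≤ n) :
    IsEulerian (Jugg k n) ∧ IsELShellable (Jugg k n) ∧
      IsEulerian (Jugg k n)ᵒᵈ ∧ IsELShellable (Jugg k n)ᵒᵈ := by
  rcases Nat.eq_zero_or_pos n with rfl | hn
  · have : Subsingleton (Jugg k 0) := ⟨fun _ _ => Jugg.ext (funext fun i => i.elim0)⟩
    exact GoodLabeling.eulerian_shellable
      (.of_subsingleton (fun _ => 0) (fun _ _ => (0 : ℤ)))
  · obtain ⟨_, _, G⟩ := Bound.exists_goodLabeling hkn
    have : Finite (Jugg k n) := .of_equiv _ (juggIso hn).symm.toEquiv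
    exact (G.ofOrderIso (juggIso hn)).eulerian_shellable

end JugglingIso

section SymmetricGroupLemmas

variable {k n : ℕ} {u v w x z : Equiv.Perm (Fin n)} {a b : Fin n}

/-- The set of inversions of a permutation. -/
def inversions (w : Equiv.Perm (Fin n)) : Finset (Fin n × Fin n) :=
  Finset.univ.filter fun p => p.1 < p.2 ∧ w p.2 < w p.1

theorem mem_inversions {p : Fin n × Fin n} : p ∈ inversions w ↔ p.1 < p.2 ∧ w p.2 < w p.1 := by
  simp [inversions]

theorem permLength_mul_of_forall
    (h : ∀ c d, c < d → z d < z c → x (z d) < x (z c)) :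
    permLength (x * z) = permLength x + permLength z := by
  have e : inversions (x * z) = (inversions x).image (fun p => (z.symm p.1, z.symm p.2)) ∪
      inversions z := by
    ext ⟨c, d⟩
    simp only [Finset.mem_union, Finset.mem_image, mem_inversions, Prod.exists, Prod.mk.injEq,
      Equiv.Perm.mul_apply]
    constructor
    · rintro ⟨h1, h2⟩
      rcases lt_trichotomy (z c) (z d) with h3 | h3 | h3
      · exact Or.inl ⟨z c, z d, ⟨h3, h2⟩, by simp, by simp⟩
      · exact absurd (z.injective h3) h1.ne
      · exact Or.inr ⟨h1, h3⟩
    · rintro (⟨c', d', ⟨h1, h2⟩, rfl, rfl⟩ | ⟨h1, h2⟩)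
      · simp only [Equiv.apply_symm_apply]
        refine ⟨?_, h2⟩
        by_contra! h3
        have h4 := lt_of_le_of_ne h3 fun e => h1.ne (z.symm.injective e.symm)
        have := h _ _ h4 (by simpa using h1)
        simp only [Equiv.apply_symm_apply] at this
        exact lt_asymm this h2
      · exact ⟨h1, h c d h1 h2⟩
  have dj : Disjoint ((inversions x).image (fun p => (z.symm p.1, z.symm p.2)))
      (inversions z) := by
    rw [Finset.disjoint_left]
    rintro ⟨c, d⟩ h1 h2
    simp only [Finset.mem_image, mem_inversions, Prod.exists, Prod.mk.injEq] at h1 h2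
    obtain ⟨c', d', ⟨h1, -⟩, rfl, rfl⟩ := h1
    simp only [Equiv.apply_symm_apply] at h2
    exact lt_asymm h1 h2.2
  change (inversions (x * z)).card = (inversions x).card + (inversions z).card
  rw [e, Finset.card_union_of_disjoint dj, Finset.card_image_of_injective]
  rintro ⟨c, d⟩ ⟨c', d'⟩ h
  simpa using h

/-- The action of a transposition on pairs of positions, corrected so that it preserves increasing
pairs. -/
def swapPair (a b : Fin n) (p : Fin n × Fin n) : Fin n × Fin n :=
  if Equiv.swap a b p.1 < Equiv.swap a b p.2 then (Equiv.swap a b p.1, Equiv.swap a b p.2) else p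

theorem swapPair_swapPair {p : Fin n × Fin n} (hp : p.1 < p.2) :
    swapPair a b (swapPair a b p) = p := by
  unfold swapPair
  split_ifs <;> simp_all

theorem swapPair_mem_inversions (hab : a < b) (h : u a < u b) {p : Fin n × Fin n}
    (hp : p ∈ inversions u) :
    swapPair a b p ∈ (inversions (u * Equiv.swap a b)).erase (a, b) := by
  obtain ⟨i, j⟩ := p
  rw [mem_inversions] at hp
  rw [Finset.mem_erase, mem_inversions]
  unfold swapPair
  simp only [Equiv.Perm.mul_apply] at hp ⊢
  split_ifs with h1
  · simp only [Equiv.swap_apply_self]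
    refine ⟨fun e => ?_, h1, hp.2⟩
    rw [Prod.mk.injEq] at e
    rw [e.1, e.2] at h1
    have e1 : i = b := by rw [← Equiv.swap_apply_self a b i, e.1, Equiv.swap_apply_left]
    have e2 : j = a := by rw [← Equiv.swap_apply_self a b j, e.2, Equiv.swap_apply_right]
    subst e1 e2
    exact lt_asymm hab hp.1
  · refine ⟨fun e => ?_, hp.1, ?_⟩
    · rw [Prod.mk.injEq] at e
      rw [e.1, e.2] at hp
      exact lt_asymm h hp.2
    · simp only [Equiv.swap_apply_def] at h1 ⊢
      grind

theorem permLength_lt_swap (hab : a < b) (h : u a < u b) :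
    permLength u < permLength (u * Equiv.swap a b) := by
  have hm : (a, b) ∈ inversions (u * Equiv.swap a b) := by
    rw [mem_inversions]
    simpa using ⟨hab, h⟩
  change (inversions u).card < (inversions (u * Equiv.swap a b)).card
  rw [← Finset.card_erase_add_one hm, Nat.lt_succ_iff]
  refine Finset.card_le_card_of_injOn _ (fun p hp => swapPair_mem_inversions hab h hp) ?_
  intro p hp q hq e
  change swapPair a b p = swapPair a b q at e
  rw [← swapPair_swapPair (a := a) (b := b) (mem_inversions.1 hp).1, e,
    swapPair_swapPair (mem_inversions.1 hq).1]

theorem permLength_swap_eq (hab : a < b) (h : u a < u b)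
    (hc : ∀ e, a < e → e < b → ¬ (u a < u e ∧ u e < u b)) :
    permLength (u * Equiv.swap a b) = permLength u + 1 := by
  have hm : (a, b) ∈ inversions (u * Equiv.swap a b) := by
    rw [mem_inversions]
    simpa using ⟨hab, h⟩
  refine le_antisymm ?_ (permLength_lt_swap hab h)
  change (inversions (u * Equiv.swap a b)).card ≤ (inversions u).card + 1
  rw [← Finset.card_erase_add_one hm, add_le_add_iff_right]
  refine Finset.card_le_card_of_injOn (swapPair a b) ?_ ?_
  · rintro ⟨i, j⟩ hp
    simp only [Finset.coe_erase, Set.mem_sdiff, Finset.mem_coe, mem_inversions,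
      Set.mem_singleton_iff, Prod.mk.injEq, Equiv.Perm.mul_apply] at hp ⊢
    unfold swapPair
    obtain ⟨⟨h1, h2⟩, h3⟩ := hp
    split_ifs with h4
    · exact ⟨h4, h2⟩
    · refine ⟨h1, ?_⟩
      have i1 : u j = u a → j = a := fun e => u.injective e
      have i2 : u i = u b → i = b := fun e => u.injective e
      simp only [Equiv.swap_apply_def] at h2 h4 ⊢
      grind
  · intro p hp q hq e
    have hp := mem_inversions.1 (Finset.mem_erase.1 hp).2
    have hq := mem_inversions.1 (Finset.mem_erase.1 hq).2
    rw [← swapPair_swapPair (a := a) (b := b) hp.1, e, swapPair_swapPair hq.1]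

theorem lt_of_permLength_lt_swap (hab : a < b)
    (h : permLength u < permLength (u * Equiv.swap a b)) : u a < u b := by
  by_contra! h1
  have h2 : u b < u a := lt_of_le_of_ne h1 fun e => hab.ne (u.injective e.symm)
  have := permLength_lt_swap (u := u * Equiv.swap a b) hab (by simpa using h2)
  rw [mul_assoc, Equiv.swap_mul_self, mul_one] at this
  exact lt_asymm h this

theorem bruhatLE_swap (hab : a < b) (h : u a < u b) : bruhatLE u (u * Equiv.swap a b) :=
  .single ⟨a, b, hab.ne, rfl, permLength_lt_swap hab h⟩

theorem bruhatLE_swap_of_gt (hab : a < b) (h : u b < u a) : bruhatLE (u * Equiv.swap a b) u := by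
  have := bruhatLE_swap (u := u * Equiv.swap a b) hab (by simpa using h)
  rwa [mul_assoc, Equiv.swap_mul_self, mul_one] at this

/-- The generating relation of Bruhat order, with an increasing pair of positions. -/
theorem exists_swap_of_reflection
    (h : ∃ i j : Fin n, i ≠ j ∧ w = u * Equiv.swap i j ∧ permLength u < permLength w) :
    ∃ a b, a < b ∧ u a < u b ∧ w = u * Equiv.swap a b := by
  obtain ⟨i, j, hij, rfl, hl⟩ := h
  rcases lt_or_gt_of_ne hij with h | h
  · exact ⟨i, j, h, lt_of_permLength_lt_swap h hl, rfl⟩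
  · rw [Equiv.swap_comm] at hl ⊢
    exact ⟨j, i, h, lt_of_permLength_lt_swap h hl, rfl⟩

theorem bruhatLE.permLength_lt (h : bruhatLE u w) : u = w ∨ permLength u < permLength w := by
  induction h with
  | refl => exact Or.inl rfl
  | tail _ hs ih =>
    obtain ⟨i, j, _, _, hl⟩ := hs
    rcases ih with rfl | ih
    · exact Or.inr hl
    · exact Or.inr (ih.trans hl)

theorem bruhatCovers_swap (hab : a < b) (h : u a < u b)
    (hc : ∀ e, a < e → e < b → ¬ (u a < u e ∧ u e < u b)) :
    bruhatCovers u (u * Equiv.swap a b) := by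
  have hl := permLength_swap_eq hab h hc
  refine ⟨bruhatLE_swap hab h, fun e => ?_, fun v h1 h2 => ?_⟩
  · rw [← e] at hl
    lia
  · rcases h1.permLength_lt with e1 | e1
    · exact Or.inl e1.symm
    · rcases h2.permLength_lt with e2 | e2
      · exact Or.inr e2
      · lia

theorem bruhatCovers.exists_swap (h : bruhatCovers u w) :
    ∃ a b, a < b ∧ u a < u b ∧ w = u * Equiv.swap a b ∧
      ∀ e, a < e → e < b → ¬ (u a < u e ∧ u e < u b) := by
  obtain ⟨h1, h2, h3⟩ := h
  rcases Relation.ReflTransGen.cases_head h1 with e | ⟨v, s, hv⟩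
  · exact absurd e h2
  have hl : permLength u < permLength v := by
    obtain ⟨_, _, _, _, hl⟩ := s
    exact hl
  obtain rfl : v = w := (h3 v (.single s) hv).resolve_left fun e => by
    rw [e] at hl
    exact lt_irrefl _ hl
  obtain ⟨a, b, hab, hu, rfl⟩ := exists_swap_of_reflection s
  refine ⟨a, b, hab, hu, rfl, fun e h4 h5 h6 => ?_⟩
  have s1 := permLength_lt_swap h4 h6.1
  have b1 := bruhatLE_swap h4 h6.1
  set u1 := u * Equiv.swap a e with hu1
  have v1 : u1 e < u1 b := by
    simp only [hu1, Equiv.Perm.mul_apply, Equiv.swap_apply_right,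
      Equiv.swap_apply_of_ne_of_ne hab.ne' h5.ne', hu]
  have s2 := permLength_lt_swap h5 v1
  have b2 := bruhatLE_swap h5 v1
  set u2 := u1 * Equiv.swap e b with hu2
  have v2 : u2 a < u2 e := by
    simp only [hu2, hu1, Equiv.Perm.mul_apply, Equiv.swap_apply_left,
      Equiv.swap_apply_of_ne_of_ne hab.ne' h5.ne', Equiv.swap_apply_of_ne_of_ne h4.ne hab.ne, h6.2]
  have s3 := permLength_lt_swap h4 v2
  have b3 := bruhatLE_swap h4 v2
  have e3 : u2 * Equiv.swap a e = u * Equiv.swap a b := by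
    rw [hu2, hu1, mul_assoc, mul_assoc, ← mul_assoc (Equiv.swap a e), Equiv.swap_comm a e,
      Equiv.swap_comm e b, Equiv.swap_mul_swap_mul_swap h5.ne' hab.ne']
  rw [e3] at s3 b3
  rcases h3 u1 b1 (b2.trans b3) with e | e
  · rw [e] at s1
    exact lt_irrefl _ s1
  · rw [← e] at s3
    exact lt_asymm s2 s3

/-- The number of positions before `m` whose value is at least `y`. -/
def colRank (u : Equiv.Perm (Fin n)) (m : ℕ) (y : ℤ) : ℕ :=
  (Finset.univ.filter fun e : Fin n => (e : ℕ) < m ∧ y ≤ (u e : ℤ)).card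

theorem bruhatLE.colRank_le (h : bruhatLE u w) (m : ℕ) (y : ℤ) :
    colRank u m y ≤ colRank w m y := by
  induction h with
  | refl => exact le_rfl
  | @tail v w _ hs ih =>
    refine ih.trans ?_
    obtain ⟨a, b, hab, hu, rfl⟩ := exists_swap_of_reflection hs
    refine Finset.card_le_card_of_injOn
      (fun e => if (Equiv.swap a b e : ℕ) < m then Equiv.swap a b e else e) ?_ ?_
    · intro e he
      rw [Finset.mem_coe, Finset.mem_filter] at he ⊢
      simp only [Finset.mem_univ, true_and, Equiv.Perm.mul_apply] at he ⊢
      split_ifs with h1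
      · simpa using ⟨h1, he.2⟩
      · refine ⟨he.1, ?_⟩
        simp only [Equiv.swap_apply_def] at h1 ⊢
        have : ((v a : ℕ) : ℤ) < (v b : ℕ) := by exact_mod_cast hu
        have : (a : ℕ) < b := hab
        split_ifs at h1 ⊢ with h2 h3
        · subst h2
          lia
        · subst h3
          lia
        · exact he.2
    · intro e he e' he' h
      simp only [Finset.coe_filter, Finset.mem_univ, true_and, Set.mem_ofPred_eq] at he he' h
      split_ifs at h with h1 h2 h2
      · simpa using h
      · rw [← h, Equiv.swap_apply_self] at h2
        exact absurd he.1 h2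
      · rw [h, Equiv.swap_apply_self] at h1
        exact absurd he'.1 h1
      · exact h

theorem sigma_mul (hz : InParabolic k z) : sigma k (w * z) = sigma k w := by
  ext y
  simp only [sigma, Finset.mem_image, Finset.mem_filter, Finset.mem_univ, true_and,
    Equiv.Perm.mul_apply]
  constructor
  · rintro ⟨i, hi, rfl⟩
    exact ⟨z i, (hz i).2 hi, rfl⟩
  · rintro ⟨i, hi, rfl⟩
    exact ⟨z.symm i, (hz _).1 (by simpa using hi), by simp⟩

theorem inParabolic_swap (h : (a : ℕ) < k ↔ (b : ℕ) < k) : InParabolic k (Equiv.swap a b) := by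
  intro i
  rw [Equiv.swap_apply_def]
  split_ifs with h1 h2
  · rw [h1, h]
  · rw [h2, h]
  · rfl

theorem sigma_swap_ne (ha : (a : ℕ) < k) (hb : k ≤ b) :
    sigma k u ≠ sigma k (u * Equiv.swap a b) := by
  intro h
  have h1 : u b ∈ sigma k (u * Equiv.swap a b) := by
    simp only [sigma, Finset.mem_image, Finset.mem_filter, Finset.mem_univ, true_and]
    exact ⟨a, ha, by simp⟩
  rw [← h] at h1
  simp only [sigma, Finset.mem_image, Finset.mem_filter, Finset.mem_univ, true_and,
    EmbeddingLike.apply_eq_iff_eq, exists_eq_right] at h1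
  lia

/-- Positions in the same block of the parabolic subgroup `S_k × S_{n-k}`. -/
def SameBlock (k : ℕ) (c d : Fin n) : Prop := (c : ℕ) < k ↔ (d : ℕ) < k

/-- A criterion for `k`-Bruhat order: `u` is below `w` in the first block, above `w` in the second,
and inside each block every inversion of `w` is one of `u`. -/
structure IsKPair (k : ℕ) (u w : Equiv.Perm (Fin n)) : Prop where
  le : ∀ a : Fin n, (a : ℕ) < k → u a ≤ w a
  ge : ∀ a : Fin n, k ≤ (a : ℕ) → w a ≤ u a
  inv : ∀ c d : Fin n, SameBlock k c d → c < d → w d < w c → u d < u c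

theorem IsKPair.refl (u : Equiv.Perm (Fin n)) : IsKPair k u u :=
  ⟨fun _ _ => le_rfl, fun _ _ => le_rfl, fun _ _ _ _ h => h⟩

theorem IsKPair.swap_top (h : IsKPair k u w) (ha : (a : ℕ) < k) (hb : k ≤ b) (hw : w a < w b)
    (hc : ∀ e, a < e → e < b → ¬ (w a < w e ∧ w e < w b)) :
    IsKPair k u (w * Equiv.swap a b) := by
  have hab : a < b := ha.trans_le hb
  have la := h.le a ha
  have gb := h.ge b hb
  refine ⟨fun e he => ?_, fun e he => ?_, fun c d hs hcd hi => ?_⟩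
  · have := h.le e he
    simp only [Equiv.Perm.mul_apply, Equiv.swap_apply_def]
    split_ifs with h1 h2
    · subst h1; exact la.trans hw.le
    · subst h2; lia
    · exact this
  · have := h.ge e he
    simp only [Equiv.Perm.mul_apply, Equiv.swap_apply_def]
    split_ifs with h1 h2
    · subst h1; lia
    · subst h2; exact hw.le.trans gb
    · exact this
  · have h0 := h.inv c d hs hcd
    have hc1 := hc d
    have hc2 := hc c
    have hne : w c ≠ w b ∨ c = b := by
      by_cases e : c = b
      · exact Or.inr e
      · exact Or.inl fun e' => e (w.injective e')
    have hne' : w d ≠ w a ∨ d = a := by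
      by_cases e : d = a
      · exact Or.inr e
      · exact Or.inl fun e' => e (w.injective e')
    unfold SameBlock at hs
    simp only [Equiv.Perm.mul_apply, Equiv.swap_apply_def] at hi
    split_ifs at hi with h1 h2 h3 h4 h5 h6 h7 h8 <;> subst_vars <;> lia

theorem kBruhatLE.isKPair (h : kBruhatLE k u w) : IsKPair k u w := by
  induction h with
  | refl => exact .refl u
  | tail _ hs ih =>
    obtain ⟨hc, hne⟩ := hs
    obtain ⟨a, b, hab, hv, rfl, hn⟩ := hc.exists_swap
    have hab' : (a : ℕ) < b := hab
    by_cases hb : (b : ℕ) < k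
    · exact absurd (sigma_mul (inParabolic_swap (by lia))).symm hne
    · by_cases ha : (a : ℕ) < k
      · exact ih.swap_top ha (by lia) hv hn
      · exact absurd (sigma_mul (inParabolic_swap (by lia))).symm hne

theorem IsKPair.swap_bot (h : IsKPair k u w) {c d : Fin n} (hcd : c < d) (hu : u c < u d)
    (h1 : (c : ℕ) < k → u d ≤ w c) (h2 : k ≤ (d : ℕ) → w d ≤ u c)
    (h3 : ∀ e, SameBlock k c e → e < c → u c < u e → u e < u d → w e < w c)
    (h4 : ∀ e, SameBlock k d e → d < e → u c < u e → u e < u d → w d < w e)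
    (h5 : SameBlock k c d → w c < w d) : IsKPair k (u * Equiv.swap c d) w := by
  refine ⟨fun e he => ?_, fun e he => ?_, fun e e' hs hlt hi => ?_⟩
  · have := h.le e he
    simp only [Equiv.Perm.mul_apply, Equiv.swap_apply_def]
    split_ifs with e1 e2
    · subst e1; exact h1 he
    · subst e2; exact hu.le.trans this
    · exact this
  · have := h.ge e he
    simp only [Equiv.Perm.mul_apply, Equiv.swap_apply_def]
    split_ifs with e1 e2
    · subst e1; exact this.trans hu.le
    · subst e2; exact h2 he
    · exact this
  · have h0 := h.inv e e' hs hlt hi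
    have a3 := h3 e
    have a4 := h4 e'
    have i1 : u e = u d → e = d := fun x => u.injective x
    have i2 : u e' = u c → e' = c := fun x => u.injective x
    unfold SameBlock at *
    simp only [Equiv.Perm.mul_apply, Equiv.swap_apply_def]
    split_ifs <;> subst_vars <;> lia

theorem IsKPair.swap_top_down (h : IsKPair k u w) {c d : Fin n} (hcd : c < d) (hw : w d < w c)
    (h1 : (c : ℕ) < k → u c ≤ w d) (h2 : k ≤ (d : ℕ) → w c ≤ u d)
    (h3 : ∀ e, SameBlock k c e → e < c → w d < w e → w e < w c → u c < u e)
    (h4 : ∀ e, SameBlock k d e → d < e → w d < w e → w e < w c → u e < u d) :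
    IsKPair k u (w * Equiv.swap c d) := by
  refine ⟨fun e he => ?_, fun e he => ?_, fun e e' hs hlt hi => ?_⟩
  · have := h.le e he
    simp only [Equiv.Perm.mul_apply, Equiv.swap_apply_def]
    split_ifs with e1 e2
    · subst e1; exact h1 he
    · subst e2; exact this.trans hw.le
    · exact this
  · have := h.ge e he
    simp only [Equiv.Perm.mul_apply, Equiv.swap_apply_def]
    split_ifs with e1 e2
    · subst e1; exact hw.le.trans this
    · subst e2; exact h2 he
    · exact this
  · have h0 := h.inv e e' hs hlt
    have a3 := h3 e
    have a4 := h4 e'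
    have i1 : w e = w c → e = c := fun x => w.injective x
    have i2 : w e' = w d → e' = d := fun x => w.injective x
    unfold SameBlock at *
    simp only [Equiv.Perm.mul_apply, Equiv.swap_apply_def] at hi
    split_ifs at hi <;> subst_vars <;> lia

theorem IsKPair.exists_lt (h : IsKPair k u w) (hne : u ≠ w) :
    ∃ a : Fin n, (a : ℕ) < k ∧ u a < w a := by
  by_contra! hall
  have hle : ∀ e ∈ (Finset.univ : Finset (Fin n)), (w e : ℕ) ≤ u e := fun e _ => by
    by_cases he : (e : ℕ) < k
    · exact hall e he
    · exact h.ge e (by lia)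
  have hs : ∑ e, (w e : ℕ) = ∑ e, (u e : ℕ) := by
    rw [Equiv.sum_comp w fun i : Fin n => (i : ℕ), Equiv.sum_comp u fun i : Fin n => (i : ℕ)]
  have := (Finset.sum_eq_sum_iff_of_le hle).1 hs
  exact hne (Equiv.ext fun e => Fin.ext (this e (Finset.mem_univ e)).symm)

/-- A pair of positions in different blocks along which `u` can move up towards `w`. -/
def Admissible (k : ℕ) (u w : Equiv.Perm (Fin n)) (a b : Fin n) : Prop :=
  (a : ℕ) < k ∧ k ≤ (b : ℕ) ∧ u a < u b ∧ u b ≤ w a ∧ w b ≤ u a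

theorem IsKPair.exists_admissible (h : IsKPair k u w) (hne : u ≠ w) :
    ∃ a b, Admissible k u w a b := by
  obtain ⟨a0, ha0⟩ := h.exists_lt hne
  obtain ⟨a, ha, hmax⟩ := Finset.exists_max_image
    (Finset.univ.filter fun a : Fin n => (a : ℕ) < k ∧ u a < w a) u ⟨a0, by simpa using ha0⟩
  simp only [Finset.mem_filter, Finset.mem_univ, true_and] at ha hmax
  refine ⟨a, ?_⟩
  by_contra! hno
  have hno' : ∀ b : Fin n, k ≤ (b : ℕ) → u a < u b → u b ≤ w a → u a < w b := fun b h1 h2 h3 => by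
    by_contra! h4
    exact hno b ⟨ha.1, h1, h2, h3, h4⟩
  have hsub : (Finset.Ioc (u a) (w a)).image (fun y => w (u.symm y)) ⊆
      Finset.Ioc (u a) (w a) := by
    intro z hz
    obtain ⟨y, hy, rfl⟩ := Finset.mem_image.1 hz
    obtain ⟨e, rfl⟩ := u.surjective y
    rw [Finset.mem_Ioc] at hy
    rw [Equiv.symm_apply_apply, Finset.mem_Ioc]
    by_cases he : (e : ℕ) < k
    · have h1 := h.le e he
      have h2 := hmax e
      lia
    · have h1 := h.ge e (by lia)
      have h2 := hno' e (by lia) hy.1 hy.2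
      exact ⟨h2, h1.trans hy.2⟩
  have heq := Finset.eq_of_subset_of_card_le hsub (by
    rw [Finset.card_image_of_injective _ fun x y e => u.symm.injective (w.injective e)])
  have hm : w a ∈ Finset.Ioc (u a) (w a) := Finset.mem_Ioc.2 ⟨ha.2, le_rfl⟩
  rw [← heq] at hm
  obtain ⟨y, hy, e⟩ := Finset.mem_image.1 hm
  have := w.injective e
  rw [← this, Equiv.apply_symm_apply] at hy
  exact lt_irrefl _ (Finset.mem_Ioc.1 hy).1

theorem IsKPair.exists_cover (h : IsKPair k u w) (hne : u ≠ w) :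
    ∃ v, bruhatCovers u v ∧ sigma k u ≠ sigma k v ∧ permLength u < permLength v ∧
      IsKPair k v w := by
  classical
  obtain ⟨a0, b0, h0⟩ := h.exists_admissible hne
  obtain ⟨⟨a, b⟩, hab, hmin⟩ := Finset.exists_min_image
    (Finset.univ.filter fun p : Fin n × Fin n => Admissible k u w p.1 p.2)
    (fun p => (u p.2 : ℤ) - (u p.1 : ℤ)) ⟨(a0, b0), by simpa using h0⟩
  simp only [Finset.mem_filter, Finset.mem_univ, true_and, Prod.forall] at hab hmin
  obtain ⟨ha, hb, hu, hba, hwb⟩ := hab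
  have hlt : a < b := ha.trans_le hb
  have left : ∀ e : Fin n, (e : ℕ) < k → u a < u e → u e < u b → w e < u b := by
    intro e he h1 h2
    by_contra! h3
    have := hmin e b ⟨he, hb, h2, h3, hwb.trans h1.le⟩
    rw [Fin.lt_def] at h1
    omega
  have right : ∀ e : Fin n, k ≤ (e : ℕ) → u a < u e → u e < u b → u a < w e := by
    intro e he h1 h2
    by_contra! h3
    have := hmin a e ⟨ha, he, h1, h2.le.trans hba, h3⟩
    rw [Fin.lt_def] at h2
    omega
  refine ⟨u * Equiv.swap a b, bruhatCovers_swap hlt hu fun e h1 h2 h3 => ?_, sigma_swap_ne ha hb,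
    permLength_lt_swap hlt hu, h.swap_bot hlt hu (fun _ => hba) (fun _ => hwb) ?_ ?_ ?_⟩
  · by_cases he : (e : ℕ) < k
    · have a1 := left e he h3.1 h3.2
      have a2 := h.inv a e (by unfold SameBlock; lia) h1 (by lia)
      exact lt_asymm a2 h3.1
    · have a1 := right e (by lia) h3.1 h3.2
      have a2 := h.inv e b (by unfold SameBlock; lia) h2 (by lia)
      exact lt_asymm a2 h3.2
  · intro e hs h1 h2 h3
    have := left e (by unfold SameBlock at hs; lia) h2 h3
    lia
  · intro e hs h1 h2 h3
    have := right e (by unfold SameBlock at hs; lia) h2 h3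
    lia
  · intro hs
    unfold SameBlock at hs
    lia

theorem permLength_le (u : Equiv.Perm (Fin n)) : permLength u ≤ n * n := by
  refine (Finset.card_filter_le _ _).trans ?_
  simp

theorem IsKPair.kBruhatLE (h : IsKPair k u w) : kBruhatLE k u w := by
  induction hm : n * n - permLength u using Nat.strong_induction_on generalizing u with
  | _ m ih =>
    by_cases hne : u = w
    · rw [hne]
      exact .refl
    · obtain ⟨v, hc, hs, hl, hv⟩ := h.exists_cover hne
      have := permLength_le v
      exact .head ⟨hc, hs⟩ (ih _ (by lia) hv rfl)

theorem kBruhatLE.bruhatLE (h : kBruhatLE k u w) : bruhatLE u w := by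
  induction h with
  | refl => exact .refl
  | tail _ hs ih => exact ih.trans hs.1.1

end SymmetricGroupLemmas

section Representation

variable {k n : ℕ} {u v w z u' w' : Equiv.Perm (Fin n)} {f g : Bound k n}

/-- The pair `u, w` represents the bounded affine permutation `u t w⁻¹`, where `t` translates the
first `k` positions by `n`. -/
def Represents (f : Bound k n) (u w : Equiv.Perm (Fin n)) : Prop :=
  ∀ a : Fin n, f (w a : ℕ) = (u a : ℕ) + if (a : ℕ) < k then (n : ℤ) else 0

theorem Represents.apply_of_lt (h : Represents f u w) {a : Fin n} (ha : (a : ℕ) < k) :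
    f (w a : ℕ) = (u a : ℕ) + n := by
  rw [h, if_pos ha]

theorem Represents.apply_of_le (h : Represents f u w) {a : Fin n} (ha : k ≤ (a : ℕ)) :
    f (w a : ℕ) = (u a : ℕ) := by
  rw [h, if_neg ha.not_gt, add_zero]

theorem exists_eq_apply_add (w : Equiv.Perm (Fin n)) (hn : 0 < n) (x : ℤ) :
    ∃ (e : Fin n) (q : ℤ), x = (w e : ℕ) + q * n := by
  have hn' : (0 : ℤ) < n := by exact_mod_cast hn
  have h1 := Int.emod_nonneg x hn'.ne'
  have h2 := Int.emod_lt_of_pos x hn'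
  have h3 := Int.emod_add_mul_ediv x n
  refine ⟨w.symm ⟨(x % n).toNat, by lia⟩, x / n, ?_⟩
  rw [Equiv.apply_symm_apply]
  simp only [Int.toNat_of_nonneg h1]
  linarith

theorem exists_eq_apply (w : Equiv.Perm (Fin n)) {x : ℤ} (h0 : 0 ≤ x) (h1 : x < n) :
    ∃ e : Fin n, x = (w e : ℕ) :=
  ⟨w.symm ⟨x.toNat, by lia⟩, by simp [h0]⟩

theorem Represents.unique (hn : 0 < n) (hf : Represents f u w) (hg : Represents g u w) : f = g := by
  refine Bound.ext_fun fun x => ?_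
  obtain ⟨e, q, rfl⟩ := exists_eq_apply_add w hn x
  rw [f.add_mul, g.add_mul, hf, hg]

theorem Represents.mul (h : Represents f u w) (hz : InParabolic k z) :
    Represents f (u * z) (w * z) := by
  intro a
  have := h (z a)
  simp only [hz a] at this
  exact this

theorem exists_perm_of_pair (hn : 0 < n) (k : ℕ) (u w : Equiv.Perm (Fin n)) :
    ∃ f : Equiv.Perm ℤ, ∀ (a : Fin n) (q : ℤ),
      f ((w a : ℕ) + q * n) = (u a : ℕ) + (if (a : ℕ) < k then (n : ℤ) else 0) + q * n := by
  have : NeZero n := ⟨hn.ne'⟩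
  let e := (Int.divModEquiv n).trans (Equiv.prodComm _ _)
  let s : Fin n × ℤ ≃ Fin n × ℤ := Equiv.prodShear (w.symm.trans u) fun p =>
    Equiv.addRight (if (w.symm p : ℕ) < k then (1 : ℤ) else 0)
  have he : ∀ (p : Fin n) (q : ℤ), e.symm (p, q) = q * n + (p : ℕ) := fun p q => rfl
  have hs : ∀ (a : Fin n) (q : ℤ), s (w a, q) = (u a, q + if (a : ℕ) < k then (1 : ℤ) else 0) := by
    intro a q
    simp [s, Equiv.prodShear]
  refine ⟨(e.trans s).trans e.symm, fun a q => ?_⟩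
  rw [add_comm, ← he, Equiv.trans_apply, Equiv.trans_apply, Equiv.apply_symm_apply, hs, he]
  split_ifs <;> ring

theorem IsKPair.exists_represents (hn : 0 < n) (hkn : k ≤ n) (h : IsKPair k u w) :
    ∃ f : Bound k n, Represents f u w := by
  obtain ⟨F, hF⟩ := exists_perm_of_pair hn k u w
  have hF0 : ∀ a : Fin n, F (w a : ℕ) = (u a : ℕ) + if (a : ℕ) < k then (n : ℤ) else 0 := by
    intro a
    simpa using hF a 0
  have bd : IsBounded n F := by
    refine ⟨fun x => ?_, fun x => ?_, fun x => ?_⟩ <;>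
      obtain ⟨e, q, rfl⟩ := exists_eq_apply_add w hn x
    · rw [show ((w e : ℕ) : ℤ) + q * n + n = (w e : ℕ) + (q + 1) * n by ring, hF, hF]
      ring
    all_goals
      have h1 := h.le e
      have h2 := h.ge e
      rw [Fin.le_def] at h1 h2
      have := (w e).2
      have := (u e).2
      rw [hF]
      split_ifs with he
      · have := h1 he
        lia
      · have := h2 (by lia)
        lia
  refine ⟨Bound.ofIsBounded hn F bd ?_, hF0⟩
  have hd := bd.rk_diag (-1)
  have hneg : ∀ a : Fin n, F ((w a : ℕ) - n) = (u a : ℕ) + (if (a : ℕ) < k then (n : ℤ) else 0) - n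
      := fun a => by
    have := hF a (-1)
    rwa [neg_one_mul, ← sub_eq_add_neg, ← sub_eq_add_neg] at this
  rw [← hd, rk, ← Nat.min_eq_right hkn, ← Fin.card_filter_val_lt, Nat.cast_inj]
  symm
  refine Finset.card_bij (fun a _ => ((w a : ℕ) : ℤ) - n) ?_ ?_ ?_
  · intro a ha
    simp only [Finset.mem_filter, Finset.mem_univ, true_and, Finset.mem_Icc] at ha ⊢
    have := (w a).2
    rw [hneg, if_pos ha]
    lia
  · intro a _ b _ hab
    exact w.injective (Fin.ext (by lia))
  · intro p hp
    simp only [Finset.mem_filter, Finset.mem_Icc] at hp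
    obtain ⟨e, he⟩ := exists_eq_apply w (x := p + n) (by lia) (by lia)
    have hp' : p = (w e : ℕ) - n := by lia
    have := (u e).2
    rw [hp', hneg] at hp
    refine ⟨e, ?_, hp'.symm⟩
    simp only [Finset.mem_filter, Finset.mem_univ, true_and]
    by_contra hk
    rw [if_neg hk] at hp
    omega

/-- Two pairs representing the same element differ by an element of the parabolic subgroup. -/
theorem Represents.exists_mul (h : Represents f u w) (h' : Represents f u' w') :
    ∃ z, InParabolic k z ∧ u' = u * z ∧ w' = w * z := by
  have key : ∀ a, (((w⁻¹ * w') a : Fin n) : ℕ) < k ↔ (a : ℕ) < k := by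
    intro a
    have h1 := h ((w⁻¹ * w') a)
    rw [show w ((w⁻¹ * w') a) = w' a by simp, h'] at h1
    have := (u' a).2
    have := (u ((w⁻¹ * w') a)).2
    split_ifs at h1 <;> lia
  refine ⟨w⁻¹ * w', key, Equiv.ext fun a => ?_, by simp⟩
  have h1 := h ((w⁻¹ * w') a)
  rw [show w ((w⁻¹ * w') a) = w' a by simp, h'] at h1
  simp only [key] at h1
  exact Fin.ext (by simpa using h1)

theorem card_filter_le_apply (hn : 0 < n) (f : Bound k n) :
    (Finset.univ.filter fun i : Fin n => (n : ℤ) ≤ f (i : ℕ)).card = k := by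
  have h := f.isBounded.rk_diag (n - 1)
  rw [f.rk_zero_one hn, rk, Nat.cast_inj] at h
  refine Eq.trans ?_ h
  refine Finset.card_bij (fun a _ => ((a : ℕ) : ℤ)) ?_ ?_ ?_
  · intro a ha
    simp only [Finset.mem_filter, Finset.mem_univ, true_and, Finset.mem_Icc] at ha ⊢
    have := a.2
    refine ⟨by omega, by simpa using ha⟩
  · intro a _ b _ hab
    exact Fin.ext (by exact_mod_cast hab)
  · intro p hp
    simp only [Finset.mem_filter, Finset.mem_Icc] at hp
    refine ⟨⟨p.toNat, by lia⟩, ?_, by simp only; lia⟩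
    simp only [Finset.mem_filter, Finset.mem_univ, true_and]
    rw [Int.toNat_of_nonneg (by lia)]
    lia

theorem mem_iff_lt_of_lower {s : Finset (Fin n)} (hs : s.card = k)
    (hl : ∀ a b, a < b → b ∈ s → a ∈ s) (a : Fin n) : a ∈ s ↔ (a : ℕ) < k := by
  constructor
  · intro ha
    have hsub : Finset.Iic a ⊆ s := fun b hb => by
      rcases (Finset.mem_Iic.1 hb).eq_or_lt with e | hlt
      · exact e ▸ ha
      · exact hl b a hlt ha
    have := Finset.card_le_card hsub
    rw [Fin.card_Iic] at this
    lia
  · intro ha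
    by_contra hna
    have hsub : s ⊆ Finset.Iio a := fun b hb => by
      rw [Finset.mem_Iio]
      by_contra! hge
      rcases hge.eq_or_lt with e | hlt
      · exact hna (e ▸ hb)
      · exact hna (hl a b hlt hb)
    have := Finset.card_le_card hsub
    rw [Fin.card_Iio] at this
    lia

/-- Every bounded affine permutation is represented by a pair whose second entry is increasing on
both blocks. -/
theorem exists_represents_increasing (hn : 0 < n) (f : Bound k n) :
    ∃ u w : Equiv.Perm (Fin n), Represents f u w ∧ IsKPair k u w ∧
      ∀ c d, SameBlock k c d → c < d → w c < w d := by
  have hn' : (0 : ℤ) < n := by exact_mod_cast hn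
  let key : Fin n → ℕ ×ₗ Fin n := fun i => toLex (if (n : ℤ) ≤ f (i : ℕ) then 0 else 1, i)
  set w : Equiv.Perm (Fin n) := Tuple.sort key
  have mono : ∀ c d, c < d → key (w c) < key (w d) := fun c d hcd =>
    lt_of_le_of_ne (Tuple.monotone_sort key hcd.le) fun e => by
      have e2 := (Prod.mk.injEq _ _ _ _ ▸ toLex_inj.1 e).2
      exact hcd.ne (w.injective e2)
  clear_value w
  have blk : ∀ a : Fin n, (n : ℤ) ≤ f (w a : ℕ) ↔ (a : ℕ) < k := by
    have hc := card_filter_le_apply hn f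
    intro a
    rw [← mem_iff_lt_of_lower (s := Finset.univ.filter fun a : Fin n => (n : ℤ) ≤ f (w a : ℕ))]
    · simp
    · refine Eq.trans ?_ hc
      refine Finset.card_bij (fun a _ => w a) (fun a ha => by simpa using ha)
        (fun a _ b _ h => w.injective h) fun b hb => ⟨w.symm b, by simpa using hb, by simp⟩
    · intro a b hab hb
      simp only [Finset.mem_filter, Finset.mem_univ, true_and] at hb ⊢
      by_contra hna
      have := mono a b hab
      simp only [key, if_pos hb, if_neg hna, Prod.Lex.toLex_lt_toLex] at this
      lia
  have inc : ∀ c d, SameBlock k c d → c < d → w c < w d := by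
    intro c d hs hcd
    have := mono c d hcd
    unfold SameBlock at hs
    rw [← blk, ← blk] at hs
    simp only [key, hs, Prod.Lex.toLex_lt_toLex, lt_irrefl, false_or, true_and] at this
    exact this
  let U : Fin n → Fin n := fun a => ⟨(f (w a : ℕ) % n).toNat, by
    have := Int.emod_lt_of_pos (f (w a : ℕ)) hn'
    have := Int.emod_nonneg (f (w a : ℕ)) hn'.ne'
    lia⟩
  have hU : ∀ a, ((U a : ℕ) : ℤ) = f (w a : ℕ) % n := fun a =>
    Int.toNat_of_nonneg (Int.emod_nonneg _ hn'.ne')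
  have injU : Function.Injective U := by
    intro a b hab
    have h1 : f (w a : ℕ) % n = f (w b : ℕ) % n := by rw [← hU, ← hU, hab]
    have h2 : ((w a : ℕ) : ℤ) ≡ (w b : ℕ) [ZMOD n] := f.affine.modEq_iff.1 h1
    have h3 : ((w a : ℕ) : ℤ) % n = (w b : ℕ) % n := h2
    rw [Int.emod_eq_of_lt (by lia) (by exact_mod_cast (w a).2),
      Int.emod_eq_of_lt (by lia) (by exact_mod_cast (w b).2)] at h3
    exact w.injective (Fin.ext (by exact_mod_cast h3))
  let u : Equiv.Perm (Fin n) := Equiv.ofBijective U (Finite.injective_iff_bijective.1 injU)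
  have rep : Represents f u w := by
    intro a
    change _ = ((U a : ℕ) : ℤ) + _
    have h1 := f.le_apply (w a : ℕ)
    have h2 := f.apply_le (w a : ℕ)
    have h3 := (w a).2
    rw [hU]
    split_ifs with ha
    · have h4 := (blk a).2 ha
      rw [← Int.sub_emod_right, Int.emod_eq_of_lt (by omega) (by omega)]
      ring
    · have h4 := mt (blk a).1 ha
      rw [Int.emod_eq_of_lt (by omega) (by omega), add_zero]
  refine ⟨u, w, rep, ⟨fun a ha => ?_, fun a ha => ?_, fun c d hs hcd h => ?_⟩, inc⟩
  · have h1 := f.apply_le (w a : ℕ)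
    rw [rep.apply_of_lt ha] at h1
    rw [Fin.le_def]
    omega
  · have h1 := f.le_apply (w a : ℕ)
    rw [rep.apply_of_le ha] at h1
    rw [Fin.le_def]
    omega
  · exact absurd h (inc c d hs hcd).not_gt

theorem KInterval.rel_of_increasing {K K' : KInterval k n}
    (h : Represents f K.bot K.top) (h' : Represents f K'.bot K'.top)
    (inc : ∀ c d, SameBlock k c d → c < d → K.top c < K.top d) : K.Rel K' := by
  obtain ⟨z, hz, hu, hw⟩ := h.exists_mul h'
  have blk : ∀ c d, c < d → z d < z c → SameBlock k c d ∧ SameBlock k (z c) (z d) := by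
    intro c d h1 h2
    have := hz c
    have := hz d
    unfold SameBlock
    lia
  have top : ∀ c d, c < d → z d < z c → K.top (z d) < K.top (z c) := by
    intro c d h1 h2
    have := (blk c d h1 h2).2
    unfold SameBlock at this
    exact inc _ _ this.symm h2
  refine ⟨z, hz, hu, ?_, hw, ?_⟩
  · rw [hu]
    refine permLength_mul_of_forall fun c d h1 h2 => ?_
    have := K'.le.isKPair.inv c d (blk c d h1 h2).1 h1 (by rw [hw]; exact top c d h1 h2)
    rwa [hu] at this
  · rw [hw]
    exact permLength_mul_of_forall top

end Representation

section QIso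

variable {k n : ℕ} {u w u' w' : Equiv.Perm (Fin n)} {f g : Bound k n}

/-- The number of positions from `m` on whose value is less than `y`. -/
def lowRank (u : Equiv.Perm (Fin n)) (m : ℕ) (y : ℤ) : ℕ :=
  (Finset.univ.filter fun e : Fin n => m ≤ (e : ℕ) ∧ ((u e : ℕ) : ℤ) < y).card

theorem card_filter_apply (u : Equiv.Perm (Fin n)) (p : Fin n → Prop) [DecidablePred p] :
    (Finset.univ.filter fun e => p (u e)).card = (Finset.univ.filter p).card :=
  Finset.card_bij (fun a _ => u a) (fun a ha => by simpa using ha)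
    (fun a _ b _ h => u.injective h) fun b hb => ⟨u.symm b, by simpa using hb, by simp⟩

theorem lowRank_add (u : Equiv.Perm (Fin n)) (m : ℕ) (y : ℤ) :
    lowRank u m y + (Finset.univ.filter fun e : Fin n => (e : ℕ) < m).card =
      (Finset.univ.filter fun e : Fin n => ((e : ℕ) : ℤ) < y).card + colRank u m y := by
  rw [← card_filter_apply u fun e => ((e : ℕ) : ℤ) < y,
    ← Finset.card_filter_add_card_filter_not (s := Finset.univ.filter fun e : Fin n => (e : ℕ) < m)
      (fun e => ((u e : ℕ) : ℤ) < y),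
    ← Finset.card_filter_add_card_filter_not
      (s := Finset.univ.filter fun e : Fin n => ((u e : ℕ) : ℤ) < y) (fun e => m ≤ (e : ℕ)),
    lowRank, colRank]
  simp only [Finset.filter_filter, not_lt, not_le]
  rw [add_assoc]
  simp only [and_comm]

theorem bruhatLE.lowRank_le (h : bruhatLE u w) (m : ℕ) (y : ℤ) :
    lowRank u m y ≤ lowRank w m y := by
  have h1 := lowRank_add u m y
  have h2 := lowRank_add w m y
  have h3 := h.colRank_le m y
  lia

/-- Comparison of the positions in the first block with small `w` and large `u`. -/
theorem IsKPair.card_first_le (h : IsKPair k u w) (hu : bruhatLE u u') (hw : bruhatLE w' w)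
    (x y : ℤ) :
    (Finset.univ.filter fun e : Fin n =>
      (e : ℕ) < k ∧ ((w e : ℕ) : ℤ) ≤ x ∧ y ≤ ((u e : ℕ) : ℤ)).card ≤
    (Finset.univ.filter fun e : Fin n =>
      (e : ℕ) < k ∧ ((w' e : ℕ) : ℤ) ≤ x ∧ y ≤ ((u' e : ℕ) : ℤ)).card := by
  set B := Finset.univ.filter fun e : Fin n =>
    (e : ℕ) < k ∧ ((w e : ℕ) : ℤ) ≤ x ∧ y ≤ ((u e : ℕ) : ℤ) with hB
  set B' := Finset.univ.filter fun e : Fin n =>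
    (e : ℕ) < k ∧ ((w' e : ℕ) : ℤ) ≤ x ∧ y ≤ ((u' e : ℕ) : ℤ) with hB'
  rcases B.eq_empty_or_nonempty with e | hne
  · simp [e]
  obtain ⟨b, hb, hmax⟩ := Finset.exists_max_image B id hne
  have hb' := hb
  simp only [hB, Finset.mem_filter, Finset.mem_univ, true_and, id] at hb' hmax
  have e1 : B.card + colRank w (b + 1) (x + 1) ≤ colRank u (b + 1) y := by
    rw [colRank, colRank, ← Finset.card_union_of_disjoint]
    · refine Finset.card_le_card fun e he => ?_
      simp only [hB, Finset.mem_union, Finset.mem_filter, Finset.mem_univ, true_and] at he ⊢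
      rcases he with he | he
      · have := hmax e he
        exact ⟨by omega, he.2.2⟩
      · refine ⟨he.1, ?_⟩
        have hlt : e < b := lt_of_le_of_ne (Nat.lt_succ_iff.1 he.1) (by rintro rfl; omega)
        have := h.inv e b (by unfold SameBlock; omega) hlt (by rw [Fin.lt_def]; omega)
        rw [Fin.lt_def] at this
        omega
    · rw [Finset.disjoint_left]
      intro e he he'
      simp only [hB, Finset.mem_filter, Finset.mem_univ, true_and] at he he'
      omega
  have e2 : colRank u' (b + 1) y ≤ B'.card + colRank w' (b + 1) (x + 1) := by
    rw [colRank, colRank]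
    refine le_trans (Finset.card_le_card fun e he => ?_) (Finset.card_union_le _ _)
    simp only [hB', Finset.mem_union, Finset.mem_filter, Finset.mem_univ, true_and] at he ⊢
    omega
  have e3 := hu.colRank_le (b + 1) y
  have e4 := hw.colRank_le (b + 1) (x + 1)
  omega

/-- Comparison of the positions in the second block with large `w` and small `u`. -/
theorem IsKPair.card_second_le (h : IsKPair k u w) (hu : bruhatLE u u') (hw : bruhatLE w' w)
    (x y : ℤ) :
    (Finset.univ.filter fun e : Fin n =>
      k ≤ (e : ℕ) ∧ x < ((w e : ℕ) : ℤ) ∧ ((u e : ℕ) : ℤ) < y).card ≤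
    (Finset.univ.filter fun e : Fin n =>
      k ≤ (e : ℕ) ∧ x < ((w' e : ℕ) : ℤ) ∧ ((u' e : ℕ) : ℤ) < y).card := by
  set B := Finset.univ.filter fun e : Fin n =>
    k ≤ (e : ℕ) ∧ x < ((w e : ℕ) : ℤ) ∧ ((u e : ℕ) : ℤ) < y with hB
  set B' := Finset.univ.filter fun e : Fin n =>
    k ≤ (e : ℕ) ∧ x < ((w' e : ℕ) : ℤ) ∧ ((u' e : ℕ) : ℤ) < y with hB'
  rcases B.eq_empty_or_nonempty with e | hne
  · simp [e]
  obtain ⟨b, hb, hmin⟩ := Finset.exists_min_image B id hne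
  have hb' := hb
  simp only [hB, Finset.mem_filter, Finset.mem_univ, true_and, id] at hb' hmin
  have e1 : B.card + lowRank w b (x + 1) ≤ lowRank u b y := by
    rw [lowRank, lowRank, ← Finset.card_union_of_disjoint]
    · refine Finset.card_le_card fun e he => ?_
      simp only [hB, Finset.mem_union, Finset.mem_filter, Finset.mem_univ, true_and] at he ⊢
      rcases he with he | he
      · have := hmin e he
        exact ⟨this, he.2.2⟩
      · refine ⟨he.1, ?_⟩
        have hlt : b < e := lt_of_le_of_ne he.1 (by rintro rfl; omega)
        have := h.inv b e (by unfold SameBlock; omega) hlt (by rw [Fin.lt_def]; omega)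
        rw [Fin.lt_def] at this
        omega
    · rw [Finset.disjoint_left]
      intro e he he'
      simp only [hB, Finset.mem_filter, Finset.mem_univ, true_and] at he he'
      omega
  have e2 : lowRank u' b y ≤ B'.card + lowRank w' b (x + 1) := by
    rw [lowRank, lowRank]
    refine le_trans (Finset.card_le_card fun e he => ?_) (Finset.card_union_le _ _)
    simp only [hB', Finset.mem_union, Finset.mem_filter, Finset.mem_univ, true_and] at he ⊢
    omega
  have e3 := hu.lowRank_le b y
  have e4 := hw.lowRank_le b (x + 1)
  omega

theorem Represents.rk_eq (hf : Represents f u w) {x y : ℤ} (hx : x < n) (hy : n ≤ y) : rk n f.toPerm x y = (Finset.univ.filter fun e : Fin n =>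
      (e : ℕ) < k ∧ ((w e : ℕ) : ℤ) ≤ x ∧ y - n ≤ ((u e : ℕ) : ℤ)).card := by
  rw [rk, Nat.cast_inj]
  symm
  refine Finset.card_bij (fun e _ => ((w e : ℕ) : ℤ)) ?_ ?_ ?_
  · intro e he
    simp only [Finset.mem_filter, Finset.mem_univ, true_and, Finset.mem_Icc] at he ⊢
    have h1 := hf.apply_of_lt he.1
    have h2 := f.apply_le (w e : ℕ)
    omega
  · intro a _ b _ hab
    exact w.injective (Fin.ext (by exact_mod_cast hab))
  · intro p hp
    simp only [Finset.mem_filter, Finset.mem_Icc] at hp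
    obtain ⟨e, he⟩ := exists_eq_apply w (x := p) (by omega) (by omega)
    refine ⟨e, ?_, he.symm⟩
    simp only [Finset.mem_filter, Finset.mem_univ, true_and]
    have h1 := hf e
    have h2 := (u e).2
    rw [← he] at h1 ⊢
    split_ifs at h1 <;> omega

/-- The rank in terms of the complementary quadrant. -/
theorem IsBounded.rk_eq_card_compl {F : Equiv.Perm ℤ} (hF : IsBounded n F) {x y : ℤ} (h : x < y) :
    rk n F x y = rk n F 0 1 + x + 1 - y +
      ((Finset.Icc (x + 1) (y - 1)).filter fun a => F a < y).card := by
  obtain ⟨m, hm⟩ : ∃ m : ℕ, x = y - 1 - m := ⟨(y - 1 - x).toNat, by lia⟩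
  subst hm
  induction m with
  | zero =>
    have := hF.rk_diag (y - 1)
    rw [sub_add_cancel] at this
    simp [this]
    ring
  | succ m ih =>
    have h1 := hF.rk_pred (y - 1 - m) y
    have ih := ih (by lia)
    have h3 : Finset.Icc (y - 1 - (m + 1 : ℕ) + 1) (y - 1) =
        insert (y - 1 - (m : ℤ)) (Finset.Icc (y - 1 - m + 1) (y - 1)) := by
      ext z
      simp only [Finset.mem_Icc, Finset.mem_insert]
      lia
    rw [h3, Finset.filter_insert]
    rw [show y - 1 - ((m + 1 : ℕ) : ℤ) = y - 1 - m - 1 by push_cast; ring]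
    by_cases hc : F (y - 1 - m) < y
    · rw [if_pos hc, Finset.card_insert_of_notMem (by simp)]
      rw [if_neg (by lia)] at h1
      push_cast
      lia
    · rw [if_neg hc]
      rw [if_pos (by lia)] at h1
      lia

theorem Represents.card_compl_eq (hf : Represents f u w) {x y : ℤ} (h0 : 0 ≤ x)
    (hy : y ≤ n) : ((Finset.Icc (x + 1) (y - 1)).filter fun a => f a < y).card =
      (Finset.univ.filter fun e : Fin n =>
        k ≤ (e : ℕ) ∧ x < ((w e : ℕ) : ℤ) ∧ ((u e : ℕ) : ℤ) < y).card := by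
  symm
  refine Finset.card_bij (fun e _ => ((w e : ℕ) : ℤ)) ?_ ?_ ?_
  · intro e he
    simp only [Finset.mem_filter, Finset.mem_univ, true_and, Finset.mem_Icc] at he ⊢
    have h1 := hf.apply_of_le he.1
    have h2 := f.le_apply (w e : ℕ)
    omega
  · intro a _ b _ hab
    exact w.injective (Fin.ext (by exact_mod_cast hab))
  · intro p hp
    simp only [Finset.mem_filter, Finset.mem_Icc] at hp
    obtain ⟨e, he⟩ := exists_eq_apply w (x := p) (by omega) (by omega)
    refine ⟨e, ?_, he.symm⟩
    simp only [Finset.mem_filter, Finset.mem_univ, true_and]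
    have h1 := hf e
    have h2 := (u e).2
    rw [← he] at h1 ⊢
    split_ifs at h1 <;> omega

theorem Represents.le_of_bruhatLE (hn : 0 < n) (hf : Represents f u w) (hg : Represents g u' w')
    (h : IsKPair k u w) (hu : bruhatLE u u') (hw : bruhatLE w' w) : f ≤ g := by
  have hn' : (0 : ℤ) < n := by exact_mod_cast hn
  rw [Bound.le_iff_rankLE hn]
  intro x y
  have h1 := Int.emod_nonneg x hn'.ne'
  have h2 := Int.emod_lt_of_pos x hn'
  have h3 := Int.emod_add_mul_ediv x n
  obtain ⟨y0, hy0⟩ : ∃ y0, y = y0 + x / n * n := ⟨y - x / n * n, by ring⟩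
  rw [show x = x % n + x / n * n by linarith, hy0, Bound.gap_add]
  generalize x % n = x0 at h1 h2
  rcases le_or_gt y0 (x0 + 1) with h4 | h4
  · rw [Bound.gap_eq_zero_of_le hn f g h4]
  rw [Bound.gap, sub_nonneg]
  rcases le_or_gt (n : ℤ) y0 with h5 | h5
  · rw [hf.rk_eq h2 h5, hg.rk_eq h2 h5, Nat.cast_le]
    exact h.card_first_le hu hw _ _
  · rw [f.isBounded.rk_eq_card_compl (by lia), g.isBounded.rk_eq_card_compl (by lia),
      hf.card_compl_eq h1 h5.le, hg.card_compl_eq h1 h5.le, f.rk_zero_one hn, g.rk_zero_one hn,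
      add_le_add_iff_left, Nat.cast_le]
    exact h.card_second_le hu hw _ _

theorem swap_val_cases {c d e : Fin n} (p : Fin n → Prop) (hc : e = c → p d) (hd : e = d → p c)
    (ho : e ≠ c → e ≠ d → p e) : p (Equiv.swap c d e) := by
  rw [Equiv.swap_apply_def]
  split_ifs with h1 h2
  · exact hc h1
  · exact hd h2
  · exact ho h1 h2

theorem not_modEq_apply {w : Equiv.Perm (Fin n)} {c e : Fin n} (h : e ≠ c) (q : ℤ) :
    ¬ ((w e : ℕ) : ℤ) ≡ (w c : ℕ) + q * n [ZMOD n] := by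
  intro hm
  have h3 : ((w e : ℕ) : ℤ) % n = ((w c : ℕ) + q * n) % n := hm
  rw [Int.add_mul_emod_self_right, Int.emod_eq_of_lt (by lia) (by exact_mod_cast (w e).2),
    Int.emod_eq_of_lt (by lia) (by exact_mod_cast (w c).2)] at h3
  exact h (w.injective (Fin.ext (by exact_mod_cast h3)))

/-- If the values at positions `w c` and `w d` of `f` are exchanged in `g`, and the translations of
`c` and `d` fit, then the exchange can be performed on `u`. -/
theorem Represents.swap_bot (hf : Represents f u w) {c d : Fin n} {q : ℤ}
    (hs : Bound.Step f g (w c : ℕ) ((w d : ℕ) + q * n))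
    (hq : (if (d : ℕ) < k then (n : ℤ) else 0) + q * n = if (c : ℕ) < k then (n : ℤ) else 0) :
    Represents g (u * Equiv.swap c d) w := by
  intro e
  have l := hs.swap.left
  have r := hs.swap.right
  rw [f.add_mul, hf] at l
  rw [g.add_mul, hf] at r
  refine swap_val_cases (p := fun x => g (w e : ℕ) = (u x : ℕ) + _) ?_ ?_ ?_
  · rintro rfl
    rw [l]
    lia
  · rintro rfl
    lia
  · intro h1 h2
    rw [hs.swap.off _ (by simpa using not_modEq_apply h1 0) (not_modEq_apply h2 q), hf]

theorem Represents.swap_top (hf : Represents f u w) {c d : Fin n}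
    (hs : Bound.Step f g (w c : ℕ) (w d : ℕ)) :
    Represents g u (w * Equiv.swap c d) := by
  intro e
  have l := hs.swap.left
  have r := hs.swap.right
  rw [hf] at l
  rw [hf] at r
  refine swap_val_cases (p := fun x => g (w x : ℕ) = (u e : ℕ) + _) ?_ ?_ ?_
  · rintro rfl
    exact r
  · rintro rfl
    exact l
  · intro h1 h2
    rw [hs.swap.off _ (by simpa using not_modEq_apply h1 0) (by simpa using not_modEq_apply h2 0),
      hf]

/-- Going up one step among bounded affine permutations shrinks Bruhat intervals. -/
theorem Represents.exists_of_step (hn : 0 < n) (hf : Represents f u w) (h : IsKPair k u w)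
    {a b : ℤ} (s : Bound.Step f g a b) : ∃ u' w', Represents g u' w' ∧ IsKPair k u' w' ∧
      bruhatLE u u' ∧ bruhatLE w' w := by
  obtain ⟨c, q0, rfl⟩ := exists_eq_apply_add w hn a
  replace s := s.translate (-q0)
  rw [show ((w c : ℕ) : ℤ) + q0 * n + -q0 * n = (w c : ℕ) by ring] at s
  obtain ⟨d, q, hq⟩ := exists_eq_apply_add w hn (b + -q0 * n)
  rw [hq] at s
  clear hq
  have hn' : (0 : ℤ) < n := by exact_mod_cast hn
  have hc := (w c).2
  have hd := (w d).2
  have s1 := s.lt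
  have s2 := s.lt_add
  obtain ⟨s3, s4, -⟩ := Bound.swapped_bounds s.swap s.val
  have hval := s.val
  have hnone := s.none
  rw [f.add_mul] at hval s4 hnone
  have q0 : 0 ≤ q := by by_contra! hq; nlinarith
  have q1 : q ≤ 1 := by by_contra! hq; nlinarith
  have fc := hf c
  have fd := hf d
  have uc := (u c).2
  have ud := (u d).2
  obtain rfl | rfl : q = 0 ∨ q = 1 := by lia
  · simp only [zero_mul, add_zero] at s1 s2 s3 s4 hval s hnone
    have hb : ∀ e, w c < w e → w e < w d →
        ¬ (f (w c : ℕ) < f (w e : ℕ) ∧ f (w e : ℕ) < f (w d : ℕ)) := fun e h1 h2 =>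
      hnone _ (by exact_mod_cast h1) (by exact_mod_cast h2)
    have hw : w c < w d := by exact_mod_cast s1
    have hcd : c ≠ d := by rintro rfl; exact lt_irrefl _ hw
    by_cases hblk : SameBlock k c d ∧ c < d
    · obtain ⟨hblk, hlt⟩ := hblk
      have hu : u c < u d := by
        unfold SameBlock at hblk
        simp only [hblk] at fc
        rw [Fin.lt_def]
        omega
      refine ⟨_, _, hf.swap_bot (d := d) (q := 0) (by simpa using s) ?_,
        h.swap_bot hlt hu ?_ ?_ ?_ ?_ fun _ => hw, bruhatLE_swap hlt hu, .refl⟩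
      · unfold SameBlock at hblk
        simp [hblk]
      · intro hk
        unfold SameBlock at hblk
        rw [if_pos (hblk.1 hk)] at fd
        rw [Fin.le_def]
        omega
      · intro hk
        unfold SameBlock at hblk
        rw [if_neg (by omega)] at fc
        rw [Fin.le_def]
        omega
      · intro e hs h1 h2 h3
        by_contra! h4
        have h5 := h.inv e d (by unfold SameBlock at *; omega) (h1.trans hlt)
        have h6 := hb e (lt_of_le_of_ne h4 fun x => h1.ne (w.injective x).symm)
        have h7 : w e ≠ w d := fun x => (h1.trans hlt).ne (w.injective x)
        have fe := hf e
        unfold SameBlock at *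
        simp only [hs] at fc
        simp only [← hblk, hs] at fd
        omega
      · intro e hs h1 h2 h3
        by_contra! h4
        have h5 := h.inv c e (by unfold SameBlock at *; omega) (hlt.trans h1)
        have h6 := hb e
        have h7 : w e ≠ w d := fun x => h1.ne (w.injective x).symm
        have h8 : w e ≠ w c := fun x => (hlt.trans h1).ne (w.injective x).symm
        have fe := hf e
        unfold SameBlock at *
        simp only [hblk, hs] at fc
        simp only [hs] at fd
        omega
    · have hblk' : SameBlock k d c ∨ ((d : ℕ) < k ∧ k ≤ (c : ℕ)) := by
        unfold SameBlock
        by_cases h1 : (c : ℕ) < k <;> by_cases h2 : (d : ℕ) < k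
        · exact Or.inl ⟨fun _ => h1, fun _ => h2⟩
        · rw [if_pos h1] at fc
          rw [if_neg h2] at fd
          omega
        · exact Or.inr ⟨h2, by omega⟩
        · exact Or.inl ⟨fun h => absurd h h2, fun h => absurd h h1⟩
      have hlt : d < c := by
        rcases hblk' with hx | hx
        · exact lt_of_le_of_ne (not_lt.1 fun x => hblk ⟨hx.symm, x⟩) hcd.symm
        · exact hx.1.trans_le hx.2
      have rep := hf.swap_top s
      rw [Equiv.swap_comm] at rep
      refine ⟨_, _, rep, h.swap_top_down hlt hw ?_ ?_ ?_ ?_, .refl, bruhatLE_swap_of_gt hlt hw⟩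
      · intro hk
        rw [if_pos hk] at fd
        rw [Fin.le_def]
        omega
      · intro hk
        rw [if_neg (by omega)] at fc
        rw [Fin.le_def]
        omega
      · intro e hs h1 h2 h3
        have h4 : u e ≠ u d := fun x => h1.ne (u.injective x)
        have h5 := hb e h2 h3
        have fe := hf e
        have h6 := h.inv e c
        unfold SameBlock at *
        simp only [← hs] at fe
        split_ifs at fc fd fe <;> omega
      · intro e hs h1 h2 h3
        have h4 : u e ≠ u c := fun x => h1.ne (u.injective x).symm
        have h5 := hb e h2 h3
        have fe := hf e
        have h6 := h.inv d e
        have := (u e).2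
        unfold SameBlock at *
        simp only [← hs] at fe
        split_ifs at fc fd fe <;> omega
  · rw [one_mul] at s1 s2 s3 s4 hval hnone
    have hck : (c : ℕ) < k := by
      by_contra hk
      rw [if_neg hk] at fc
      omega
    have hdk : k ≤ (d : ℕ) := by
      by_contra! hk
      rw [if_pos hk] at fd
      omega
    rw [if_pos hck] at fc
    rw [if_neg hdk.not_gt] at fd
    have hlt : c < d := hck.trans_le hdk
    have hu : u c < u d := by
      rw [Fin.lt_def]
      omega
    refine ⟨_, _, hf.swap_bot s ?_, h.swap_bot hlt hu ?_ ?_ ?_ ?_ ?_, bruhatLE_swap hlt hu, .refl⟩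
    · rw [if_pos hck, if_neg hdk.not_gt]
      ring
    · intro _
      rw [Fin.le_def]
      omega
    · intro _
      rw [Fin.le_def]
      omega
    · intro e hs h1 h2 h3
      by_contra! h4
      have h5 : w c < w e := lt_of_le_of_ne h4 fun x => h1.ne (w.injective x).symm
      have := (w e).2
      have h6 := hnone (w e : ℕ) (by exact_mod_cast h5) (by omega)
      rw [hf.apply_of_lt (hs.1 hck)] at h6
      omega
    · intro e hs h1 h2 h3
      by_contra! h4
      have h5 : w e < w d := lt_of_le_of_ne h4 fun x => h1.ne (w.injective x).symm
      have h6 := hnone ((w e : ℕ) + 1 * n) (by omega) (by omega)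
      unfold SameBlock at hs
      rw [f.add_mul, hf.apply_of_le (a := e) (by omega)] at h6
      omega
    · intro hs
      unfold SameBlock at hs
      omega

theorem Represents.exists_of_le (hn : 0 < n) (hf : Represents f u w) (h : IsKPair k u w)
    (hfg : f ≤ g) : ∃ u' w', Represents g u' w' ∧ IsKPair k u' w' ∧
      bruhatLE u u' ∧ bruhatLE w' w := by
  obtain ⟨ks, q, -⟩ := ((Bound.le_iff_rankLE hn).1 hfg).exists_rising hn (Bound.isPriority_emod hn)
  induction q generalizing u w with
  | nil => exact ⟨u, w, hf, h, .refl, .refl⟩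
  | cons s q ih =>
    obtain ⟨u1, w1, r1, k1, hu1, hw1⟩ := hf.exists_of_step hn h s
    obtain ⟨u2, w2, r2, k2, hu2, hw2⟩ := ih r1 k1 (q.le hn)
    exact ⟨u2, w2, r2, k2, hu1.trans hu2, hw2.trans hw1⟩

theorem bruhatIcc_subset_iff (h : bruhatLE u' w') :
    bruhatIcc u' w' ⊆ bruhatIcc u w ↔ bruhatLE u u' ∧ bruhatLE w' w := by
  constructor
  · intro hs
    exact ⟨(hs ⟨.refl, h⟩).1, (hs ⟨h, .refl⟩).2⟩
  · rintro ⟨h1, h2⟩ x ⟨h3, h4⟩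
    exact ⟨h1.trans h3, h4.trans h2⟩

namespace Q

/-- The bounded affine permutation represented by a class of intervals. -/
noncomputable def toBound (hn : 0 < n) (hkn : k ≤ n) : Q k n → Bound k n :=
  Quotient.lift (fun K : KInterval k n => (K.le.isKPair.exists_represents hn hkn).choose) (by
    intro K K' h
    induction h with
    | rel K K' h =>
      obtain ⟨z, hz, hu, -, hw, -⟩ := h
      refine Represents.unique hn ?_ (K'.le.isKPair.exists_represents hn hkn).choose_spec
      rw [hu, hw]
      exact (K.le.isKPair.exists_represents hn hkn).choose_spec.mul hz
    | refl => rfl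
    | symm _ _ _ ih => exact ih.symm
    | trans _ _ _ _ _ ih1 ih2 => exact ih1.trans ih2)

theorem represents_toBound (hn : 0 < n) (hkn : k ≤ n) (K : KInterval k n) :
    Represents (toBound hn hkn (Quotient.mk _ K)) K.bot K.top :=
  (K.le.isKPair.exists_represents hn hkn).choose_spec

theorem toBound_bijective (hn : 0 < n) (hkn : k ≤ n) :
    Function.Bijective (toBound (k := k) hn hkn) := by
  constructor
  · intro q q' h
    obtain ⟨K, rfl⟩ := Quotient.exists_rep q
    obtain ⟨K', rfl⟩ := Quotient.exists_rep q'
    have h1 := represents_toBound hn hkn K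
    have h2 := represents_toBound hn hkn K'
    rw [← h] at h2
    obtain ⟨u, w, r, p, inc⟩ := exists_represents_increasing hn (toBound hn hkn (Quotient.mk _ K))
    set K0 : KInterval k n := ⟨u, w, p.kBruhatLE⟩
    have e1 := KInterval.rel_of_increasing (K := K0) r h1 inc
    have e2 := KInterval.rel_of_increasing (K := K0) r h2 inc
    exact Quotient.sound ((Relation.EqvGen.rel _ _ e1).symm.trans _ _ _ (.rel _ _ e2))
  · intro f
    obtain ⟨u, w, r, p, -⟩ := exists_represents_increasing hn f
    exact ⟨Quotient.mk _ ⟨u, w, p.kBruhatLE⟩, (represents_toBound hn hkn _).unique hn r⟩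

theorem rel_iff (hn : 0 < n) (hkn : k ≤ n) (q' q : Q k n) :
    Q.Rel q' q ↔ toBound hn hkn q ≤ toBound hn hkn q' := by
  constructor
  · rintro ⟨K', K, rfl, rfl, hs⟩
    obtain ⟨hu, hw⟩ := (bruhatIcc_subset_iff K'.le.bruhatLE).1 hs
    exact (represents_toBound hn hkn K).le_of_bruhatLE hn (represents_toBound hn hkn K')
      K.le.isKPair hu hw
  · intro h
    obtain ⟨K, rfl⟩ := Quotient.exists_rep q
    obtain ⟨u', w', r, p, hu, hw⟩ :=
      (represents_toBound hn hkn K).exists_of_le hn K.le.isKPair h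
    refine ⟨⟨u', w', p.kBruhatLE⟩, K, (toBound_bijective hn hkn).1 ?_, rfl,
      (bruhatIcc_subset_iff p.kBruhatLE.bruhatLE).2 ⟨hu, hw⟩⟩
    exact (represents_toBound hn hkn _).unique hn r

theorem exists_isPartialOrder_eulerian_shellable (hkn : k ≤ n) :
    ∃ hQ : IsPartialOrder (Q k n) Q.Rel,
      letI : PartialOrder (Q k n) := posetOf Q.Rel hQ
      IsEulerian (Q k n) ∧ IsELShellable (Q k n) ∧
        IsEulerian (Q k n)ᵒᵈ ∧ IsELShellable (Q k n)ᵒᵈ := by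
  rcases Nat.eq_zero_or_pos n with rfl | hn
  · have : Subsingleton (KInterval k 0) := ⟨fun K K' => by
      cases K
      cases K'
      congr 1 <;> exact Subsingleton.elim _ _⟩
    have sub : Subsingleton (Q k 0) := inferInstanceAs (Subsingleton (Quotient _))
    have refl : ∀ q : Q k 0, Q.Rel q q := fun q => by
      obtain ⟨K, rfl⟩ := Quotient.exists_rep q
      exact ⟨K, K, rfl, rfl, subset_rfl⟩
    have hQ : IsPartialOrder (Q k 0) Q.Rel :=
      { refl := refl
        trans := fun a b c _ _ => Subsingleton.elim a c ▸ refl a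
        antisymm := fun a b _ _ => Subsingleton.elim a b }
    refine ⟨hQ, ?_⟩
    let : PartialOrder (Q k 0) := posetOf Q.Rel hQ
    exact GoodLabeling.eulerian_shellable
      (.of_subsingleton (fun _ => 0) (fun _ _ => (0 : ℤ)))
  · have hQ : IsPartialOrder (Q k n) Q.Rel :=
      { refl := fun a => (rel_iff hn hkn a a).2 le_rfl
        trans := fun a b c h1 h2 => (rel_iff hn hkn a c).2
          (((rel_iff hn hkn b c).1 h2).trans ((rel_iff hn hkn a b).1 h1))
        antisymm := fun a b h1 h2 => (toBound_bijective hn hkn).1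
          (((rel_iff hn hkn b a).1 h2).antisymm ((rel_iff hn hkn a b).1 h1)) }
    refine ⟨hQ, ?_⟩
    let : PartialOrder (Q k n) := posetOf Q.Rel hQ
    let e : Q k n ≃o (Bound k n)ᵒᵈ :=
      ⟨(Equiv.ofBijective _ (toBound_bijective hn hkn)).trans OrderDual.toDual,
        fun {a b} => (rel_iff hn hkn a b).symm⟩
    obtain ⟨_, _, G⟩ := Bound.exists_goodLabeling hkn
    have : Finite (Q k n) := .of_equiv _ (Equiv.ofBijective _ (toBound_bijective hn hkn)).symm
    exact (G.dual.ofOrderIso e).eulerian_shellable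

end Q

end QIso

end Positroid

theorem corollary3 (k n : ℕ) (hkn : k ≤ n) :
    (∃ hQ : IsPartialOrder (Positroid.Q k n) Positroid.Q.Rel,
      letI : PartialOrder (Positroid.Q k n) := Positroid.posetOf Positroid.Q.Rel hQ
      Positroid.IsEulerian (Positroid.Q k n) ∧
      Positroid.IsELShellable (Positroid.Q k n) ∧
      Positroid.IsEulerian (Positroid.Q k n)ᵒᵈ ∧
      Positroid.IsELShellable (Positroid.Q k n)ᵒᵈ) ∧
    (Positroid.IsEulerian (Positroid.Bound k n) ∧
      Positroid.IsELShellable (Positroid.Bound k n) ∧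
      Positroid.IsEulerian (Positroid.Bound k n)ᵒᵈ ∧
      Positroid.IsELShellable (Positroid.Bound k n)ᵒᵈ) ∧
    (Positroid.IsEulerian (Positroid.Jugg k n) ∧
      Positroid.IsELShellable (Positroid.Jugg k n) ∧
      Positroid.IsEulerian (Positroid.Jugg k n)ᵒᵈ ∧
      Positroid.IsELShellable (Positroid.Jugg k n)ᵒᵈ) := by
  obtain ⟨_, _, G⟩ := Positroid.Bound.exists_goodLabeling hkn
  exact ⟨Positroid.Q.exists_isPartialOrder_eulerian_shellable hkn, G.eulerian_shellable,
    Positroid.Jugg.eulerian_shellable hkn⟩
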